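/- **Theorem (Resolution size-depth trade-offs, general).** A clause is a finite disjunction of literals over pairwise distinct variables, its width is the number of its literals, and a CNF formula $F$ is a finite set of clauses; it is an $8$-CNF if all its clauses have width at most $8$, and its size $S(F)$ is the sum of the widths of its clauses. A resolution refutation of $F$ is a sequence of clauses ending in the empty clause, in which each clause is either a clause of $F$ or is derived from two specified earlier clauses $C\lor x$ and $D\lor\overline{x}$ as $C\lor D$. Its size is the number of clauses in the sequence, and its depth is the number of edges of a longest path in the directed acyclic graph that has an edge to each derived clause from each of its two premises. There are absolute constants $C,\varepsilon>0$ such that for all integers $n\ge 2$, $m\ge 1$, $k$ and $c$ with $$3\le c\le k-1<\frac{n}{2\ln n}$$ there is an $8$-CNF formula $F$ such that 1. $F$ has at most $C\,m\,k^2(2n)^{c+1}$ variables and size $S(F)\le C\,m^4k^2(2n)^{c+1}$; 2. $F$ has a resolution refutation of size at most $C\,m^{k+4}k^2(4n)^k$; 3. every resolution refutation of $F$ of size at most $\left(\frac{m+1}{2}\right)^{k+c}$ has depth at least $\varepsilon\, n^k$. In particular, for any integer functions $m=m(n)\ge 1$, $k=k(n)$, $c=c(n)$ satisfying these conditions there are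 $8$-CNF formulas $F_n$ with $O(mk^2(2n)^{c+1})$ variables and size $O(m^4k^2(2n)^{c+1})$ that resolution refutes in size $O(m^{k+4}k^2(4n)^k)$, while any refutation of size at most $\left(\frac{m+1}{2}\right)^{k+c}$ has depth $\Omega(n^k)$. -/

import Mathlib

namespace Resolution

/-- A literal over the variables `ℕ`: `(v, true)` is the variable `v` and `(v, false)` is its
negation. -/
abbrev Literal : Type := ℕ × Bool

/-- A clause: a finite disjunction of literals over pairwise distinct variables, i.e. a finite set
of literals in which no variable occurs both positively and negatively. -/
abbrev Clause : Type :=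
  {C : Finset Literal // ∀ a ∈ C, ∀ b ∈ C, a.1 = b.1 → a = b}

/-- The width of a clause is the number of its literals. -/
def Clause.width (C : Clause) : ℕ := C.1.card

/-- A CNF formula, viewed as a finite set of clauses. -/
abbrev CNF : Type := Finset Clause

/-- `F` is a `w`-CNF: every clause has width at most `w`. -/
def CNF.IsKCNF (F : CNF) (w : ℕ) : Prop := ∀ C ∈ F, Clause.width C ≤ w

/-- The set of variables appearing in `F`. -/
def CNF.vars (F : CNF) : Finset ℕ := F.biUnion fun C => C.1.image Prod.fst

/-- The formula size `S(F)`: the sum of the widths of the clauses of `F`. -/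
def CNF.size (F : CNF) : ℕ := ∑ C ∈ F, Clause.width C

/-- The resolution rule: from `A = C ∨ x` and `B = D ∨ ¬x` infer `E = C ∨ D`. -/
def Resolves (A B E : Clause) : Prop :=
  ∃ x : ℕ, (x, true) ∈ A.1 ∧ (x, false) ∈ B.1 ∧
    E.1 = A.1.erase (x, true) ∪ B.1.erase (x, false)

/-- A resolution refutation of `F`: a sequence of clauses whose last one is empty, in which every
clause is marked either as a clause of `F` (`premises i = none`), or as derived by the resolution
rule from two specified earlier clauses (`premises i = some (j, k)`). -/
structure Refutation (F : CNF) where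
  /-- the size (length): the number of clauses in the sequence -/
  size : ℕ
  clause : Fin size → Clause
  premises : Fin size → Option (Fin size × Fin size)
  mem_of_none : ∀ i, premises i = none → clause i ∈ F
  resolves_of_some : ∀ i j k, premises i = some (j, k) →
    j < i ∧ k < i ∧ Resolves (clause j) (clause k) (clause i)
  size_pos : 0 < size
  last_eq_empty : (clause ⟨size - 1, Nat.sub_lt size_pos Nat.one_pos⟩).1 = ∅

namespace Refutation

variable {F : CNF}

/-- The edge relation of the DAG of a refutation: there are edges from `j` and from `k` to `i`
exactly when the `i`-th clause is derived from the `j`-th and the `k`-th clause. -/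
def edges (π : Refutation F) : SetRel (Fin π.size) (Fin π.size) :=
  {p | ∃ k, π.premises p.2 = some (p.1, k) ∨ π.premises p.2 = some (k, p.1)}

/-- The depth of a refutation: the number of edges of a longest path in its DAG. -/
noncomputable def depth (π : Refutation F) : ℕ :=
  sSup (Set.range fun p : RelSeries π.edges => p.length)

theorem length_lt_size (π : Refutation F) (p : RelSeries π.edges) : p.length < π.size := by
  have hlt : ∀ a b, (a, b) ∈ π.edges → a < b := by
    rintro a b ⟨k, h | h⟩
    · exact (π.resolves_of_some _ _ _ h).1
    · exact (π.resolves_of_some _ _ _ h).2.1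
  have hmono : StrictMono p.toFun :=
    Fin.strictMono_iff_lt_succ.2 fun i => hlt _ _ (p.step i)
  have := Fintype.card_le_of_injective _ hmono.injective
  simpa using this

/-- The supremum in the definition of the depth is attained, so it is a maximum. -/
theorem depth_isGreatest (π : Refutation F) :
    IsGreatest (Set.range fun p : RelSeries π.edges => p.length) π.depth := by
  have hb : BddAbove (Set.range fun p : RelSeries π.edges => p.length) :=
    ⟨π.size, by rintro _ ⟨p, rfl⟩; exact (π.length_lt_size p).le⟩
  refine ⟨Nat.sSup_mem ?_ hb, fun _ hx => le_csSup hb hx⟩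
  exact ⟨0, RelSeries.singleton π.edges ⟨0, π.size_pos⟩, rfl⟩

end Refutation

end Resolution

/-!
The formula is a system of parity constraints on a folded cylinder, with every variable replaced by
an `m`-ary selector gadget.

*The folded cylinder.* A cylinder has `k` rows, arranged cyclically, and its columns are the
integers. Fix pairwise coprime numbers `q i` in `[n, 2 n]`, one for each row. The row `r` is folded
up to the period `4 * k * ∏ j ≤ c, q (r + j)`, so that only about `k ^ 2 * (2 n) ^ (c + 1)`
vertices remain, while the columns of the whole cylinder repeat only after `4 * k * ∏ i, q i`
steps, which is more than `n ^ k`. Two strips of `2 * k` columns are attached half of this common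
period apart, and one of them carries a single unit of charge, which makes the system of all vertex
constraints inconsistent.

*Small refutations are narrow.* For a random choice of the selected indices and of the data bits
that are not selected, a clause that mentions `w` selected bits survives with small probability, so
that under some choice every surviving clause of a refutation of size at most `((m + 1) / 2) ^ w`
mentions fewer than `w` of them (`exists_narrow_restriction`). Hence a defender who answers queries
to the variables, remembers fewer than `w` of them at a time and stays consistent for `t` steps
follows a path of length `t` back from the empty clause (`le_depth_of_strategy`).

*The defender of the cylinder*, for `w = k + c`, keeps the charge hidden in a column of one of the
strips that contains no remembered vertical edge, and satisfies all consequences of the system thus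
modified. The charge gets stuck only if the remembered edges `S` cut it off. Such a cut has an edge
in every row (`Closed.full`). Since `|S| ≤ k + c`, at most `c` of its edges are vertical, so the
single edges of different rows are at most `c` columns apart in the folded cylinder
(`Separates.drift`); and among any `c + 1` consecutive rows one has just one edge in `S`, so that
every `q i` divides the period of such a row. By the Chinese remainder theorem the cut has a
location in the unfolded cylinder (`Separates.exists_loc`), which is unique up to `2 * c` modulo
the common period (`Full.loc_close`). One query therefore moves the location by at most `2 * c`,
and the defender survives for a constant fraction of `∏ i, q i` queries before the cut can travel
from one strip to the other.

*The upper bound* sweeps a cut of `k + 2` edges over the unfolded cylinder, one column after the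
other (`CylParams.exists_sweep`). Adding one lifted constraint to the lifted parity of the cut
takes `30 * (2 * m) ^ (k + 3) * m` clauses (`Ext.covEq_add`).

*The numbers `q i`* are primes between `n` and `2 * n`. There are `n / (2 * log n) + 1` of them for
large `n` (`exists_le_card_primes`): one compares the central binomial coefficient with its prime
factorization, for which the bound `log 4` on the growth rate of the logarithm of the primorial
would just not suffice, while the multinomial coefficient `(6 n)! / (n! (2 n)! (3 n)!)` gives the
better rate `1.3`. For bounded `n`, `k` is bounded as well, and the formula `x ∧ ¬x` will do.
-/

set_option linter.unusedSectionVars false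
set_option linter.unusedFintypeInType false
set_option linter.unusedDecidableInType false

namespace Resolution

/-! ### Resolution derivations as lists of clauses -/

/-- A set of literals in which no variable occurs with both signs. -/
def Consistent (L : Finset Literal) : Prop := ∀ a ∈ L, ∀ b ∈ L, a.1 = b.1 → a = b

theorem Consistent.mono {L L' : Finset Literal} (h : Consistent L) (hs : L' ⊆ L) :
    Consistent L' :=
  fun a ha b hb => h a (hs ha) b (hs hb)

theorem Consistent.insert {L : Finset Literal} (h : Consistent L) {v : ℕ} (b : Bool)
    (hv : ∀ b', (v, b') ∉ L) : Consistent (insert (v, b) L) := by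
  intro x hx y hy hxy
  rw [Finset.mem_insert] at hx hy
  rcases hx with rfl | hx <;> rcases hy with rfl | hy
  · rfl
  · exact absurd (show (v, y.2) ∈ L by rw [show v = y.1 from hxy]; exact hy) (hv _)
  · exact absurd (show (v, x.2) ∈ L by rw [show v = x.1 from hxy.symm]; exact hx) (hv _)
  · exact h _ hx _ hy hxy

/-- `Deriv F l`: the list `l`, read from its end to its head, is a resolution derivation
from `F`. -/
inductive Deriv (F : CNF) : List Clause → Prop
  | nil : Deriv F []
  | ax {l : List Clause} {A : Clause} : Deriv F l → A ∈ F → Deriv F (A :: l)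
  | res {l : List Clause} {A B E : Clause} :
      Deriv F l → A ∈ l → B ∈ l → Resolves A B E → Deriv F (E :: l)

/-- `Cov l L`: some clause in the list `l` subsumes the set of literals `L`. -/
def Cov (l : List Clause) (L : Finset Literal) : Prop := ∃ A ∈ l, A.1 ⊆ L

theorem Cov.mono {l l' : List Clause} {L L' : Finset Literal} (h : Cov l L) (hl : l ⊆ l')
    (hL : L ⊆ L') : Cov l' L' := by
  obtain ⟨A, hA, hAL⟩ := h
  exact ⟨A, hl hA, fun _ h => hL (hAL h)⟩

/-- `Ext F n l P`: the derivation `l` can be prolonged by at most `n` clauses to one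
with the property `P`. -/
def Ext (F : CNF) (n : ℕ) (l : List Clause) (P : List Clause → Prop) : Prop :=
  ∃ l', Deriv F l' ∧ l ⊆ l' ∧ l'.length ≤ l.length + n ∧ P l'

variable {F : CNF}

theorem Ext.of_deriv {l : List Clause} {P : List Clause → Prop} (hl : Deriv F l) (h : P l)
    (n : ℕ) : Ext F n l P :=
  ⟨l, hl, fun _ h => h, by omega, h⟩

theorem Ext.bind {n n' : ℕ} {l : List Clause} {P Q : List Clause → Prop} (h : Ext F n l P)
    (hQ : ∀ l', Deriv F l' → l ⊆ l' → P l' → Ext F n' l' Q) : Ext F (n + n') l Q := by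
  obtain ⟨l', hd, hs, hlen, hP⟩ := h
  obtain ⟨l'', hd', hs', hlen', hQ'⟩ := hQ l' hd hs hP
  exact ⟨l'', hd', fun _ h => hs' (hs h), by omega, hQ'⟩

theorem Ext.mono {n n' : ℕ} {l : List Clause} {P Q : List Clause → Prop} (h : Ext F n l P)
    (hn : n ≤ n') (hQ : ∀ l', Deriv F l' → l ⊆ l' → P l' → Q l') : Ext F n' l Q := by
  obtain ⟨l', hd, hs, hlen, hP⟩ := h
  exact ⟨l', hd, hs, by omega, hQ l' hd hs hP⟩

theorem Ext.axiom_cov {l : List Clause} (hl : Deriv F l) {A : Clause} (hA : A ∈ F)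
    {L : Finset Literal} (hL : A.1 ⊆ L) : Ext F 1 l (fun l' => Cov l' L) :=
  ⟨A :: l, hl.ax hA, List.subset_cons_self _ _, by simp, A, by simp, hL⟩

/-- One resolution step, up to subsumption. -/
theorem Ext.resolve {l : List Clause} (hl : Deriv F l) {L : Finset Literal} (hL : Consistent L)
    {v : ℕ} (ht : Cov l (insert (v, true) L)) (hf : Cov l (insert (v, false) L)) :
    Ext F 1 l (fun l' => Cov l' L) := by
  obtain ⟨A, hA, hAL⟩ := ht
  obtain ⟨B, hB, hBL⟩ := hf
  by_cases h1 : (v, true) ∈ A.1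
  · by_cases h2 : (v, false) ∈ B.1
    · have hs : A.1.erase (v, true) ∪ B.1.erase (v, false) ⊆ L := by
        refine Finset.union_subset ?_ ?_
        · rwa [← Finset.subset_insert_iff]
        · rwa [← Finset.subset_insert_iff]
      refine ⟨⟨_, hL.mono hs⟩ :: l, hl.res hA hB ⟨v, h1, h2, rfl⟩, List.subset_cons_self _ _,
        by simp, ⟨_, hL.mono hs⟩, by simp, hs⟩
    · exact .of_deriv hl ⟨B, hB, (Finset.subset_insert_iff_of_notMem h2).1 hBL⟩ 1
  · exact .of_deriv hl ⟨A, hA, (Finset.subset_insert_iff_of_notMem h1).1 hAL⟩ 1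

/-- Prolongations that establish the facts `P a` one after the other. -/
theorem Ext.forall_finset {α : Type*} {n : ℕ} {P : α → List Clause → Prop}
    (hmono : ∀ a l l', l ⊆ l' → P a l → P a l') (s : Finset α) {l : List Clause}
    (hl : Deriv F l) (h : ∀ a ∈ s, ∀ l', Deriv F l' → l ⊆ l' → Ext F n l' (P a)) :
    Ext F (s.card * n) l (fun l' => ∀ a ∈ s, P a l') := by
  classical
  induction s using Finset.induction_on with
  | empty => exact .of_deriv hl (by simp) _
  | insert a s ha ih =>
    have := Ext.bind (ih fun b hb => h b (Finset.mem_insert_of_mem hb))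
      (fun l' hd hs hP => Ext.mono (h a (Finset.mem_insert_self _ _) l' hd hs) le_rfl
        (Q := fun l'' => ∀ b ∈ insert a s, P b l'') (by
          intro l'' _ hs' hPa b hb
          rcases Finset.mem_insert.1 hb with rfl | hb
          · exact hPa
          · exact hmono b l' l'' hs' (hP b hb)))
    refine this.mono ?_ (fun _ _ _ h => h)
    rw [Finset.card_insert_of_notMem ha, Nat.succ_mul]

/-- Each clause of a derivation is an axiom or follows from two clauses further down the list. -/
theorem Deriv.step {l : List Clause} (h : Deriv F l) (i : Fin l.length) :
    l.get i ∈ F ∨ ∃ j k : Fin l.length, i < j ∧ i < k ∧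
      Resolves (l.get j) (l.get k) (l.get i) := by
  induction h with
  | nil => exact i.elim0
  | @ax l A hd hA ih =>
    refine Fin.cases (Or.inl hA) (fun i => ?_) i
    rcases ih i with h | ⟨j, k, hj, hk, hr⟩
    · exact Or.inl h
    · exact Or.inr ⟨j.succ, k.succ, Fin.succ_lt_succ_iff.2 hj, Fin.succ_lt_succ_iff.2 hk, hr⟩
  | @res l A B E hd hA hB hr ih =>
    refine Fin.cases (Or.inr ?_) (fun i => ?_) i
    · obtain ⟨j, rfl⟩ := List.get_of_mem hA
      obtain ⟨k, rfl⟩ := List.get_of_mem hB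
      exact ⟨j.succ, k.succ, Fin.succ_pos _, Fin.succ_pos _, hr⟩
    · rcases ih i with h | ⟨j, k, hj, hk, hr⟩
      · exact Or.inl h
      · exact Or.inr ⟨j.succ, k.succ, Fin.succ_lt_succ_iff.2 hj, Fin.succ_lt_succ_iff.2 hk, hr⟩

theorem Deriv.of_cons {l : List Clause} {A : Clause} (h : Deriv F (A :: l)) : Deriv F l := by
  cases h <;> assumption

theorem Deriv.exists_refutation_of_head {l : List Clause} {A : Clause} (h : Deriv F (A :: l))
    (hA : A.1 = ∅) : ∃ π : Refutation F, π.size = (A :: l).length := by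
  classical
  set l' := A :: l with hl'
  have key : ∀ i : Fin l'.length, ∃ p : Option (Fin l'.length × Fin l'.length),
      (p = none → l'.get i.rev ∈ F) ∧ ∀ j k, p = some (j, k) →
        j < i ∧ k < i ∧ Resolves (l'.get j.rev) (l'.get k.rev) (l'.get i.rev) := by
    intro i
    rcases h.step i.rev with h | ⟨j, k, hj, hk, hr⟩
    · exact ⟨none, fun _ => h, by simp⟩
    · refine ⟨some (j.rev, k.rev), by simp, ?_⟩
      rintro _ _ ⟨⟩
      refine ⟨?_, ?_, by simpa using hr⟩
      · rw [← Fin.rev_lt_rev]; simpa using hj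
      · rw [← Fin.rev_lt_rev]; simpa using hk
  choose p hp1 hp2 using key
  refine ⟨⟨l'.length, fun i => l'.get i.rev, p, hp1, fun i => hp2 i, by simp [l'], ?_⟩, rfl⟩
  have : (Fin.rev ⟨l'.length - 1, Nat.sub_lt (by simp [l']) Nat.one_pos⟩ : Fin l'.length) =
      ⟨0, by simp [l']⟩ := by
    ext; simp [Fin.rev, l']
  simpa [this, l'] using hA

/-- A derivation of a subsumer of the empty clause gives a refutation, cut off at the empty clause.
-/
theorem Deriv.exists_refutation {l : List Clause} (h : Deriv F l) (hc : Cov l ∅) :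
    ∃ π : Refutation F, π.size ≤ l.length := by
  induction l with
  | nil => obtain ⟨A, hA, -⟩ := hc; simp at hA
  | cons B l ih =>
    obtain ⟨A, hA, hA0⟩ := hc
    rcases List.mem_cons.1 hA with rfl | hA
    · obtain ⟨π, hπ⟩ := h.exists_refutation_of_head (Finset.subset_empty.1 hA0)
      exact ⟨π, hπ.le⟩
    · obtain ⟨π, hπ⟩ := ih h.of_cons ⟨A, hA, hA0⟩
      exact ⟨π, hπ.trans (by simp)⟩

/-! ### Parity systems and their lifts by selector gadgets -/

/-- The variables of the gadget that replaces one base variable: data bits, selector bits, and the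
extension variables that express that some selector is set. -/
inductive GadgetVar (m : ℕ) : Type
  | data (i : Fin m)
  | sel (i : Fin m)
  | chain (i : Fin (m + 1))
  deriving Fintype

theorem GadgetVar.card (m : ℕ) : Fintype.card (GadgetVar m) = 3 * m + 1 := by
  let e : GadgetVar m ≃ Fin m ⊕ Fin m ⊕ Fin (m + 1) :=
    { toFun := fun x => match x with
        | .data i => .inl i
        | .sel i => .inr (.inl i)
        | .chain i => .inr (.inr i)
      invFun := fun x => match x with
        | .inl i => .data i
        | .inr (.inl i) => .sel i
        | .inr (.inr i) => .chain i
      left_inv := by rintro (i | i | i) <;> rfl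
      right_inv := by rintro (i | i | i) <;> rfl }
  rw [Fintype.card_congr e]
  simp; omega

/-- A system of linear equations over `ZMod 2` with variables `E`: for each `v : V`, the sum of the
variables in `inc v` is `charge v`. -/
structure ParitySystem (E V : Type) where
  /-- the variables of an equation -/
  inc : V → Finset E
  /-- the right-hand side of an equation -/
  charge : V → ZMod 2

/-- The element of `ZMod 2` represented by a truth value. -/
def bit (b : Bool) : ZMod 2 := if b then 1 else 0

variable {E V : Type} [Fintype E] [DecidableEq E] [Fintype V] {m : ℕ}

/-- For a base assignment `β` and selected indices `I`, the lift of the clause over the base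
variables `S` that is falsified by `β`. -/
def liftSet (enc : E × GadgetVar m ↪ ℕ) (S : Finset E) (β : E → Bool) (I : E → Fin m) :
    Finset Literal :=
  S.biUnion fun e => {(enc (e, .sel (I e)), false), (enc (e, .data (I e)), !β e)}

/-- The clauses expressing that some selector of the gadget of `e` is set. The variable `chain i`
stands for the statement that one of the selectors below `i` is set; this breaks the clause of all
selectors into clauses of width at most `3`. -/
def gadgetSets (enc : E × GadgetVar m ↪ ℕ) (e : E) : Finset (Finset Literal) :=
  {{(enc (e, .chain 0), false)}, {(enc (e, .chain (Fin.last m)), true)}} ∪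
    Finset.univ.image fun i : Fin m =>
      {(enc (e, .chain i.castSucc), true), (enc (e, .sel i), true), (enc (e, .chain i.succ), false)}

open Classical in
/-- The clauses that express the equation `v`, lifted. -/
noncomputable def equationSets (P : ParitySystem E V) (enc : E × GadgetVar m ↪ ℕ) (v : V) :
    Finset (Finset Literal) :=
  (Finset.univ.filter fun p : (E → Bool) × (E → Fin m) =>
    ∑ e ∈ P.inc v, bit (p.1 e) ≠ P.charge v).image fun p => liftSet enc (P.inc v) p.1 p.2

open Classical in
/-- The CNF formula obtained by lifting a parity system: for every equation the lifts of the
clauses that exclude its violations, and the clauses of the gadgets. -/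
noncomputable def liftCNF (P : ParitySystem E V) (enc : E × GadgetVar m ↪ ℕ) : CNF :=
  ((Finset.univ.biUnion (equationSets P enc)) ∪ Finset.univ.biUnion (gadgetSets enc)).subtype _

variable {P : ParitySystem E V} {enc : E × GadgetVar m ↪ ℕ}

theorem mem_liftSet {S : Finset E} {β : E → Bool} {I : E → Fin m} {l : Literal} :
    l ∈ liftSet enc S β I ↔ ∃ e ∈ S, l = (enc (e, .sel (I e)), false) ∨
      l = (enc (e, .data (I e)), !β e) := by
  simp [liftSet]

/-- Together with `gadgetSets_consistent`, this shows that `subtype` in the definition of `liftCNF`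
discards nothing. -/
theorem liftSet_consistent (S : Finset E) (β : E → Bool) (I : E → Fin m) :
    Consistent (liftSet enc S β I) := by
  intro a ha b hb hab
  rw [mem_liftSet] at ha hb
  obtain ⟨e, he, rfl | rfl⟩ := ha <;> obtain ⟨e', he', rfl | rfl⟩ := hb <;>
    have := enc.injective hab <;> simp at this <;> obtain ⟨rfl, -⟩ := this <;> rfl

end Resolution

namespace Resolution
variable {E V : Type} [Fintype E] [DecidableEq E] [Fintype V] {m : ℕ}
variable {P : ParitySystem E V} {enc : E × GadgetVar m ↪ ℕ}

/-! ### Lifting resolution steps -/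

theorem mem_liftCNF {C : Clause} : C ∈ liftCNF P enc ↔
    (∃ v, ∃ β : E → Bool, ∃ I : E → Fin m, ∑ e ∈ P.inc v, bit (β e) ≠ P.charge v ∧
      C.1 = liftSet enc (P.inc v) β I) ∨ ∃ e, C.1 ∈ gadgetSets enc e := by
  classical
  simp only [liftCNF, equationSets, Finset.mem_subtype, Finset.mem_union, Finset.mem_biUnion,
    Finset.mem_univ, true_and, Finset.mem_image, Finset.mem_filter, Prod.exists]
  refine or_congr (exists_congr fun v => exists_congr fun β => exists_congr fun I =>
    and_congr Iff.rfl ⟨fun h => h.symm, fun h => h.symm⟩) Iff.rfl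

theorem mem_gadgetSets {e : E} {L : Finset Literal} : L ∈ gadgetSets enc e ↔
    L = {(enc (e, .chain 0), false)} ∨ L = {(enc (e, .chain (Fin.last m)), true)} ∨
    ∃ i : Fin m, L = {(enc (e, .chain i.castSucc), true), (enc (e, .sel i), true),
      (enc (e, .chain i.succ), false)} := by
  simp [gadgetSets, eq_comm]

theorem gadgetSets_consistent {e : E} {L : Finset Literal} (h : L ∈ gadgetSets enc e) :
    Consistent L := by
  rw [mem_gadgetSets] at h
  rcases h with rfl | rfl | ⟨i, rfl⟩
  · intro a ha b hb _
    simp at ha hb; rw [ha, hb]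
  · intro a ha b hb _
    simp at ha hb; rw [ha, hb]
  · intro a ha b hb hab
    simp at ha hb
    rcases ha with rfl | rfl | rfl <;> rcases hb with rfl | rfl | rfl <;>
      first | rfl | (exfalso; simp [Fin.ext_iff] at hab)

theorem Ext.gadget_axiom {l : List Clause} (hl : Deriv (liftCNF P enc) l) {e : E}
    {L L' : Finset Literal} (hL : L ∈ gadgetSets enc e) (hs : L ⊆ L') :
    Ext (liftCNF P enc) 1 l (fun l' => Cov l' L') :=
  Ext.axiom_cov hl (A := ⟨L, gadgetSets_consistent hL⟩) (mem_liftCNF.2 (Or.inr ⟨e, hL⟩)) hs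

theorem liftSet_insert_update {S : Finset E} {x : E} (hx : x ∉ S) (β : E → Bool)
    (I : E → Fin m) (b : Bool) (i : Fin m) :
    liftSet enc (insert x S) (Function.update β x b) (Function.update I x i) =
      insert (enc (x, .data i), !b) (insert (enc (x, .sel i), false) (liftSet enc S β I)) := by
  ext l
  simp only [Finset.mem_insert, mem_liftSet, exists_eq_or_imp, Function.update_self]
  have : (∃ a ∈ S, l = (enc (a, .sel (Function.update I x i a)), false) ∨
      l = (enc (a, .data (Function.update I x i a)), !Function.update β x b a)) ↔
      (∃ a ∈ S, l = (enc (a, .sel (I a)), false) ∨ l = (enc (a, .data (I a)), !β a)) := by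
    refine exists_congr fun a => and_congr_right fun ha => ?_
    have : a ≠ x := fun h => hx (h ▸ ha)
    rw [Function.update_of_ne this, Function.update_of_ne this]
  rw [this, or_assoc, or_left_comm]

theorem enc_notMem_liftSet {S : Finset E} {x : E} (hx : x ∉ S) (β : E → Bool)
    (I : E → Fin m) (g : GadgetVar m) (b : Bool) : (enc (x, g), b) ∉ liftSet enc S β I := by
  rw [mem_liftSet]
  rintro ⟨e, he, h | h⟩ <;> simp at h <;> exact hx (h.1.1 ▸ he)

/-- Lifting of one resolution step on the base variable `x`: the selectors of `x` are eliminated one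
after the other along the chain of extension variables. -/
theorem Ext.lift_resolve (hm : 1 ≤ m) {l : List Clause} (hl : Deriv (liftCNF P enc) l)
    {S : Finset E} {x : E} (hx : x ∉ S) (β : E → Bool) (I : E → Fin m)
    (h : ∀ b i, Cov l (liftSet enc (insert x S) (Function.update β x b)
      (Function.update I x i))) :
    Ext (liftCNF P enc) (7 * m) l (fun l' => Cov l' (liftSet enc S β I)) := by
  set L := liftSet enc S β I with hLdef
  have hL : Consistent L := liftSet_consistent _ _ _
  have hnot : ∀ (g : GadgetVar m) (b : Bool), (enc (x, g), b) ∉ L :=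
    enc_notMem_liftSet hx β I
  have chain : ∀ (j : ℕ) (hj : j < m + 1), Ext (liftCNF P enc) (4 * j + 1) l
      (fun l' => Cov l' (insert (enc (x, .chain ⟨j, hj⟩), false) L)) := by
    intro j
    induction j with
    | zero =>
      intro hj
      exact Ext.gadget_axiom hl (e := x) (mem_gadgetSets.2 (Or.inl rfl)) (by simp)
    | succ j ih =>
      intro hj
      have hj' : j < m := by omega
      set i : Fin m := ⟨j, hj'⟩
      set L1 := insert (enc (x, .chain ⟨j + 1, hj⟩), false) L with hL1
      have hL1c : Consistent L1 := hL.insert _ fun b' => hnot _ b'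
      -- eliminate the data variable selected by `i`
      have s1 : Ext (liftCNF P enc) (4 * j + 1 + 1) l (fun l' =>
          Cov l' (insert (enc (x, .chain ⟨j, by omega⟩), false) L) ∧
          Cov l' (insert (enc (x, .sel i), false) L)) := by
        refine (ih (by omega)).bind fun l' hd hs hP => ?_
        refine Ext.mono (Ext.resolve hd (L := insert (enc (x, .sel i), false) L)
          (hL.insert _ fun b' => hnot _ b') (v := enc (x, .data i)) ?_ ?_) le_rfl
          fun l'' _ hs' hc => ⟨hP.mono hs' (fun _ h => h), hc⟩
        · have := h false i
          rw [liftSet_insert_update hx] at this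
          exact this.mono hs (fun _ h => h)
        · have := h true i
          rw [liftSet_insert_update hx] at this
          exact this.mono hs (fun _ h => h)
      have s2 : Ext (liftCNF P enc) (4 * j + 1 + 1 + 1) l (fun l' =>
          Cov l' (insert (enc (x, .chain ⟨j, by omega⟩), false) L) ∧
          Cov l' (insert (enc (x, .sel i), false) L) ∧
          Cov l' (insert (enc (x, .chain ⟨j, by omega⟩), true)
            (insert (enc (x, .sel i), true) L1))) := by
        refine s1.bind fun l' hd hs hP => ?_
        refine Ext.mono (Ext.gadget_axiom hd (e := x)
          (mem_gadgetSets.2 (Or.inr (Or.inr ⟨i, rfl⟩))) ?_) le_rfl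
          fun l'' _ hs' hc => ⟨hP.1.mono hs' (fun _ h => h), hP.2.mono hs' (fun _ h => h), hc⟩
        intro l hl
        simp only [Finset.mem_insert, Finset.mem_singleton] at hl ⊢
        rcases hl with rfl | rfl | rfl
        · exact Or.inl rfl
        · exact Or.inr (Or.inl rfl)
        · exact Or.inr (Or.inr (by rw [hL1]; exact Finset.mem_insert_self _ _))
      have s3 : Ext (liftCNF P enc) (4 * j + 1 + 1 + 1 + 1) l (fun l' =>
          Cov l' (insert (enc (x, .sel i), false) L) ∧
          Cov l' (insert (enc (x, .sel i), true) L1)) := by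
        refine s2.bind fun l' hd hs hP => ?_
        refine Ext.mono (Ext.resolve hd (L := insert (enc (x, .sel i), true) L1)
          (hL1c.insert _ fun b' => ?_) (v := enc (x, .chain ⟨j, by omega⟩)) hP.2.2 ?_) le_rfl
          fun l'' _ hs' hc => ⟨hP.2.1.mono hs' (fun _ h => h), hc⟩
        · simp [hL1, hnot]
        · refine hP.1.mono (fun _ h => h) ?_
          intro y hy
          simp only [hL1, Finset.mem_insert] at hy ⊢
          tauto
      refine Ext.mono (s3.bind fun l' hd hs hP => Ext.resolve hd (L := L1) hL1c
        (v := enc (x, .sel i)) hP.2 (hP.1.mono (fun _ h => h) ?_)) (by omega)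
        fun _ _ _ h => h
      intro y hy
      simp only [hL1, Finset.mem_insert] at hy ⊢
      tauto
  have s4 : Ext (liftCNF P enc) (4 * m + 1 + 1) l (fun l' =>
      Cov l' (insert (enc (x, .chain (Fin.last m)), false) L) ∧
      Cov l' (insert (enc (x, .chain (Fin.last m)), true) L)) := by
    refine (chain m (by omega)).bind fun l' hd hs hP => ?_
    refine Ext.mono (Ext.gadget_axiom hd (e := x) (mem_gadgetSets.2 (Or.inr (Or.inl rfl)))
      (by simp)) le_rfl fun l'' _ hs' hc => ⟨hP.mono hs' (fun _ h => h), hc⟩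
  exact Ext.mono (s4.bind fun l' hd hs hP => Ext.resolve hd hL hP.2 hP.1) (by omega)
    fun _ _ _ h => h

open Classical in
/-- There are at most `(2 m) ^ |S|` lifts of clauses over the base variables `S`. -/
theorem card_image_liftSet_le (S : Finset E) (A : Finset ((E → Bool) × (E → Fin m))) :
    (A.image fun p => liftSet enc S p.1 p.2).card ≤ (2 * m) ^ S.card := by
  let f : (S → Bool × Fin m) → Finset Literal := fun g => S.attach.biUnion fun e =>
    {(enc (e.1, .sel (g e).2), false), (enc (e.1, .data (g e).2), !(g e).1)}
  calc (A.image fun p => liftSet enc S p.1 p.2).card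
      ≤ (Finset.univ.image f).card := by
        refine Finset.card_le_card fun L hL => ?_
        obtain ⟨p, -, rfl⟩ := Finset.mem_image.1 hL
        refine Finset.mem_image.2 ⟨fun e => (p.1 e, p.2 e), Finset.mem_univ _, ?_⟩
        ext l
        simp [f, liftSet]
    _ ≤ Fintype.card (S → Bool × Fin m) := Finset.card_image_le
    _ = (2 * m) ^ S.card := by simp

/-! ### Lifted derivations of linear equations -/

/-- The set of variables that occur in a linear form. -/
def lsupp (f : E → ZMod 2) : Finset E := Finset.univ.filter fun e => f e ≠ 0

/-- The lifted clauses over the variables `S` that are falsified by an assignment which violates the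
equation `f = b` are all subsumed by clauses of `l`. -/
def CovEq (enc : E × GadgetVar m ↪ ℕ) (l : List Clause) (S : Finset E) (f : E → ZMod 2)
    (b : ZMod 2) : Prop :=
  ∀ β : E → Bool, ∑ e, f e * bit (β e) ≠ b → ∀ I : E → Fin m, Cov l (liftSet enc S β I)

theorem CovEq.mono {l l' : List Clause} {S : Finset E} {f : E → ZMod 2} {b : ZMod 2}
    (h : CovEq enc l S f b) (hl : l ⊆ l') : CovEq enc l' S f b :=
  fun β hβ I => (h β hβ I).mono hl (fun _ h => h)

/-- A variable that does not occur in the equation is eliminated from the clauses that represent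
it. -/
theorem Ext.covEq_erase (hm : 1 ≤ m) {l : List Clause} (hl : Deriv (liftCNF P enc) l)
    {S : Finset E} {x : E} (hx : x ∉ S) {f : E → ZMod 2} (hfx : f x = 0) {b : ZMod 2}
    (h : CovEq enc l (insert x S) f b) :
    Ext (liftCNF P enc) ((2 * m) ^ S.card * (7 * m)) l (fun l' => CovEq enc l' S f b) := by
  classical
  let A : Finset ((E → Bool) × (E → Fin m)) :=
    Finset.univ.filter fun p => ∑ e, f e * bit (p.1 e) ≠ b
  let T := A.image fun p => liftSet enc S p.1 p.2
  have := Ext.forall_finset (F := liftCNF P enc) (n := 7 * m) (P := fun L l => Cov l L)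
    (fun L l l' hs h => h.mono hs (fun _ h => h)) T hl (by
      intro L hL l' hd hs
      obtain ⟨⟨β, I⟩, hp, rfl⟩ := Finset.mem_image.1 hL
      refine Ext.lift_resolve hm hd hx β I fun b' i => (h.mono hs) _ ?_ _
      rw [Finset.mem_filter] at hp
      convert hp.2 using 1
      refine Finset.sum_congr rfl fun e _ => ?_
      by_cases hex : e = x
      · subst hex; simp [hfx]
      · simp [Function.update_of_ne hex])
  refine this.mono (Nat.mul_le_mul_right _ (card_image_liftSet_le S A)) ?_
  intro l' _ _ hc β hβ I
  exact hc _ (Finset.mem_image.2 ⟨(β, I), by simpa [A] using hβ, rfl⟩)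

theorem Ext.covEq_erase_finset (hm : 1 ≤ m) {S : Finset E} {f : E → ZMod 2} {b : ZMod 2}
    {w : ℕ} (Q : Finset E) : ∀ {l : List Clause}, Deriv (liftCNF P enc) l →
    Disjoint Q S → (∀ x ∈ Q, f x = 0) → (S ∪ Q).card ≤ w + 1 → CovEq enc l (S ∪ Q) f b →
    Ext (liftCNF P enc) (Q.card * ((2 * m) ^ w * (7 * m))) l
      (fun l' => CovEq enc l' S f b) := by
  induction Q using Finset.induction_on with
  | empty => intro l hl _ _ _ h; exact .of_deriv hl (by simpa using h) _
  | insert x Q hx ih =>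
    intro l hl hd hf hw h
    rw [Finset.disjoint_insert_left] at hd
    have hxS : x ∉ S ∪ Q := by simp [hd.1, hx]
    rw [Finset.union_insert] at hw h
    rw [Finset.card_insert_of_notMem hxS] at hw
    have := (Ext.covEq_erase hm hl hxS (hf x (by simp)) h).bind fun l' hd' _ h' =>
      ih hd' hd.2 (fun y hy => hf y (by simp [hy])) (by omega) h'
    refine this.mono ?_ fun _ _ _ h => h
    have hpow := Nat.mul_le_mul_right (7 * m)
      (Nat.pow_le_pow_right (by omega : 0 < 2 * m) (by omega : (S ∪ Q).card ≤ w))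
    rw [Finset.card_insert_of_notMem hx, Nat.succ_mul Q.card]
    omega

theorem lsupp_sum_bit {S : Finset E} {f : E → ZMod 2} (h : lsupp f ⊆ S) (β : E → Bool) :
    ∑ e, f e * bit (β e) = ∑ e ∈ S, f e * bit (β e) := by
  symm
  refine Finset.sum_subset (Finset.subset_univ _) fun e _ he => ?_
  have : e ∉ lsupp f := fun h' => he (h h')
  simp [lsupp] at this
  simp [this]

theorem liftSet_mono {S T : Finset E} (h : S ⊆ T) (β : E → Bool) (I : E → Fin m) :
    liftSet enc S β I ⊆ liftSet enc T β I :=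
  Finset.biUnion_subset_biUnion_of_subset_left _ h

/-- Adding an equation of the system to a derived equation. -/
theorem Ext.covEq_add (hm : 1 ≤ m) {l : List Clause} (hl : Deriv (liftCNF P enc) l)
    {f g : E → ZMod 2} {b : ZMod 2} {v : V} {w : ℕ} (hw : 3 ≤ w)
    (hg : ∀ e, g e = if e ∈ P.inc v then 1 else 0) (hv : (P.inc v).card ≤ 4)
    (hfg : (lsupp f ∪ lsupp g).card ≤ w + 1) (h : CovEq enc l (lsupp f) f b) :
    Ext (liftCNF P enc) (30 * (2 * m) ^ w * m) l
      (fun l' => CovEq enc l' (lsupp (f + g)) (f + g) (b + P.charge v)) := by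
  classical
  have hsg : lsupp g = P.inc v := by
    ext e; simp only [lsupp, hg, Finset.mem_filter, Finset.mem_univ, true_and]
    split_ifs <;> simp_all
  have hdot : ∀ β : E → Bool, ∑ e, g e * bit (β e) = ∑ e ∈ P.inc v, bit (β e) := by
    intro β
    rw [lsupp_sum_bit (S := P.inc v) hsg.le]
    exact Finset.sum_congr rfl fun e he => by simp [hg, he]
  -- the axioms
  let A : Finset ((E → Bool) × (E → Fin m)) :=
    Finset.univ.filter fun p => ∑ e, g e * bit (p.1 e) ≠ P.charge v
  let T := A.image fun p => liftSet enc (P.inc v) p.1 p.2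
  have h1 := Ext.forall_finset (F := liftCNF P enc) (n := 1) (P := fun L l => Cov l L)
    (fun L l l' hs h => h.mono hs (fun _ h => h)) T hl (by
      intro L hL l' hd hs
      obtain ⟨⟨β, I⟩, hp, rfl⟩ := Finset.mem_image.1 hL
      refine Ext.axiom_cov hd (A := ⟨_, liftSet_consistent (P.inc v) β I⟩)
        (mem_liftCNF.2 (Or.inl ⟨v, β, I, ?_, rfl⟩)) (fun _ h => h)
      rw [← hdot]
      simpa [A] using hp)
  have hT : T.card ≤ (2 * m) ^ w * (2 * m) :=
    ((card_image_liftSet_le (P.inc v) A).trans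
      (Nat.pow_le_pow_right (by omega) (hv.trans (by omega : 4 ≤ w + 1)))).trans_eq (pow_succ _ _)
  have hQ : (lsupp f ∩ lsupp g).card ≤ 4 :=
    (Finset.card_le_card Finset.inter_subset_right).trans (hsg ▸ hv)
  have hS : lsupp (f + g) ∪ (lsupp f ∩ lsupp g) = lsupp f ∪ lsupp g := by
    have hz : ∀ a : ZMod 2, a = 0 ∨ a = 1 := by decide
    ext e
    simp only [lsupp, Finset.mem_union, Finset.mem_inter, Finset.mem_filter, Finset.mem_univ,
      true_and, Pi.add_apply]
    rcases hz (f e) with h1 | h1 <;> rcases hz (g e) with h2 | h2 <;> simp [h1, h2]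
  have hfg0 : ∀ x ∈ lsupp f ∩ lsupp g, (f + g) x = 0 := by
    have hz : ∀ a : ZMod 2, a ≠ 0 → a = 1 := by decide
    intro x hx
    simp only [lsupp, Finset.mem_inter, Finset.mem_filter, Finset.mem_univ, true_and] at hx
    rw [Pi.add_apply, hz _ hx.1, hz _ hx.2]; decide
  have h2 := h1.bind fun l' hd hs hc => by
    refine Ext.covEq_erase_finset hm (S := lsupp (f + g)) (f := f + g) (b := b + P.charge v)
      (w := w) (lsupp f ∩ lsupp g) hd ?_ hfg0 (by rwa [hS]) ?_
    · rw [Finset.disjoint_left]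
      intro x hx hx'
      simp only [lsupp, Finset.mem_filter] at hx'
      exact hx'.2 (hfg0 x hx)
    · rw [hS]
      intro β hβ I
      by_cases hfb : ∑ e, f e * bit (β e) = b
      · have : ∑ e, g e * bit (β e) ≠ P.charge v := by
          intro hgb
          apply hβ
          simp only [Pi.add_apply, add_mul, Finset.sum_add_distrib, hfb, hgb]
        refine (hc (liftSet enc (P.inc v) β I)
          (Finset.mem_image.2 ⟨(β, I), by simpa [A] using this, rfl⟩)).mono (fun _ h => h) ?_
        exact liftSet_mono (hsg ▸ Finset.subset_union_right) β I
      · exact ((h.mono hs) β hfb I).mono (fun _ h => h)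
          (liftSet_mono Finset.subset_union_left β I)
  refine h2.mono ?_ fun _ _ _ h => h
  calc T.card * 1 + (lsupp f ∩ lsupp g).card * ((2 * m) ^ w * (7 * m))
      ≤ (2 * m) ^ w * (2 * m) * 1 + 4 * ((2 * m) ^ w * (7 * m)) := by gcongr
    _ = 30 * (2 * m) ^ w * m := by ring

end Resolution

namespace Resolution
variable {E V : Type} [Fintype E] [DecidableEq E] [Fintype V] {m : ℕ}
variable {P : ParitySystem E V} {enc : E × GadgetVar m ↪ ℕ}

/-! ### Random restrictions of lifted formulas -/

/-- A restriction: for each base variable a selected index, and values for the data bits (the value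
of the selected one is ignored). -/
abbrev Restr (E : Type) (m : ℕ) : Type := E → Fin m × (Fin m → Bool)

/-- The value of a gadget variable when the selected data bit carries the value `b`. -/
def gadgetVal (r : Fin m × (Fin m → Bool)) (b : Bool) : GadgetVar m → Bool
  | .data i => if i = r.1 then b else r.2 i
  | .sel i => decide (i = r.1)
  | .chain i => decide (r.1.val < i.val)

open Classical in
/-- The total assignment given by a restriction `ρ` and a base assignment `α`. -/
noncomputable def totalVal (enc : E × GadgetVar m ↪ ℕ) (ρ : Restr E m) (α : E → Bool)
    (n : ℕ) : Bool :=
  if h : ∃ x, enc x = n then gadgetVal (ρ h.choose.1) (α h.choose.1) h.choose.2 else false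

theorem totalVal_enc (ρ : Restr E m) (α : E → Bool) (e : E) (g : GadgetVar m) :
    totalVal enc ρ α (enc (e, g)) = gadgetVal (ρ e) (α e) g := by
  have h : ∃ x, enc x = enc (e, g) := ⟨_, rfl⟩
  have h' : h.choose = (e, g) := enc.injective h.choose_spec
  rw [totalVal, dif_pos h, h']

/-- Under `ρ`, the base assignment matters for the selected data bits only. -/
theorem totalVal_congr (ρ : Restr E m) {α α' : E → Bool} {n : ℕ}
    (h : ∀ e, n = enc (e, .data (ρ e).1) → α e = α' e) :
    totalVal enc ρ α n = totalVal enc ρ α' n := by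
  by_cases hn : ∃ x, enc x = n
  · obtain ⟨⟨e, g⟩, rfl⟩ := hn
    rw [totalVal_enc, totalVal_enc]
    cases g with
    | data i =>
      by_cases hi : i = (ρ e).1
      · subst hi; rw [h e rfl]
      · simp [gadgetVal, hi]
    | sel i => rfl
    | chain i => rfl
  · rw [totalVal, totalVal, dif_neg hn, dif_neg hn]

/-- The assignment `τ` falsifies all literals of `C`. -/
def Falsifies (τ : ℕ → Bool) (C : Clause) : Prop := ∀ l ∈ C.1, τ l.1 = !l.2

open Classical in
/-- The base variables whose selected data bit occurs in `C`. -/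
noncomputable def live (enc : E × GadgetVar m ↪ ℕ) (ρ : Restr E m) (C : Clause) : Finset E :=
  Finset.univ.filter fun e => ∃ b, (enc (e, .data (ρ e).1), b) ∈ C.1

theorem mem_live {ρ : Restr E m} {C : Clause} {e : E} :
    e ∈ live enc ρ C ↔ ∃ b, (enc (e, .data (ρ e).1), b) ∈ C.1 := by
  simp [live]

/-- The restriction `ρ` does not satisfy `C`. -/
def Survives (enc : E × GadgetVar m ↪ ℕ) (ρ : Restr E m) (C : Clause) : Prop :=
  ∃ α, Falsifies (totalVal enc ρ α) C

/-- The number of bit vectors with prescribed entries on `A`. -/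
theorem card_filter_agree (A : Finset (Fin m)) (s : Fin m → Bool) :
    (Finset.univ.filter fun f : Fin m → Bool => ∀ j ∈ A, f j = s j).card = 2 ^ (m - A.card) := by
  classical
  have : (Finset.univ.filter fun f : Fin m → Bool => ∀ j ∈ A, f j = s j) =
      Fintype.piFinset fun j => if j ∈ A then {s j} else Finset.univ := by
    ext f
    simp only [Finset.mem_filter, Finset.mem_univ, true_and, Fintype.mem_piFinset]
    refine forall_congr' fun j => ?_
    by_cases hj : j ∈ A <;> simp [hj]
  rw [this, Fintype.card_piFinset]
  have : ∀ j, (if j ∈ A then {s j} else (Finset.univ : Finset Bool)).card =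
      if j ∈ A then 1 else 2 := by intro j; split_ifs <;> simp
  simp only [this]
  rw [Finset.prod_ite]
  simp only [Finset.prod_const_one, one_mul, Finset.prod_const]
  congr 1
  rw [Finset.filter_not, Finset.card_sdiff_of_subset (Finset.filter_subset _ _)]
  simp

/-- The contribution of one gadget to the moment of the number of live variables. If the clause
mentions the data bits `A` of the gadget, then the average of the weight `t = (m + 1) / 2` of a live
gadget and the weight `1` of a falsified one is `(|A| + 1) / 2 ^ |A| ≤ 1`. -/
theorem sum_gadget_weight_le (A : Finset (Fin m)) (s : Fin m → Bool) :
    ∑ r : Fin m × (Fin m → Bool), (if ∀ j ∈ A, j ≠ r.1 → r.2 j = s j then (1 : ℝ) else 0) *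
      (if r.1 ∈ A then ((m : ℝ) + 1) / 2 else 1) ≤ m * 2 ^ m := by
  classical
  rw [Fintype.sum_prod_type]
  have hA : A.card ≤ m := by simpa using Finset.card_le_univ A
  have inner : ∀ i : Fin m, ∑ f : Fin m → Bool,
      (if ∀ j ∈ A, j ≠ i → f j = s j then (1 : ℝ) else 0) *
      (if i ∈ A then ((m : ℝ) + 1) / 2 else 1) =
      if i ∈ A then 2 ^ (m - A.card) * ((m : ℝ) + 1) else 2 ^ (m - A.card) := by
    intro i
    rw [← Finset.sum_mul, Finset.sum_boole]
    have : (Finset.univ.filter fun f : Fin m → Bool => ∀ j ∈ A, j ≠ i → f j = s j) =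
        (Finset.univ.filter fun f : Fin m → Bool => ∀ j ∈ A.erase i, f j = s j) := by
      ext f
      simp only [Finset.mem_filter, Finset.mem_univ, true_and, Finset.mem_erase]
      exact ⟨fun h j hj => h j hj.2 hj.1, fun h j hj hj' => h j ⟨hj', hj⟩⟩
    rw [this, card_filter_agree]
    by_cases hi : i ∈ A
    · have hpos : 0 < A.card := Finset.card_pos.2 ⟨i, hi⟩
      rw [if_pos hi, if_pos hi, Finset.card_erase_of_mem hi,
        show m - (A.card - 1) = m - A.card + 1 by omega]
      push_cast
      ring
    · rw [if_neg hi, if_neg hi, Finset.erase_eq_of_notMem hi]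
      simp
  simp only [inner]
  rw [Finset.sum_ite]
  simp only [Finset.sum_const, nsmul_eq_mul]
  have h1 : (Finset.univ.filter fun i => i ∈ A).card = A.card := by simp
  have h2 : (Finset.univ.filter fun i => i ∉ A).card = m - A.card := by
    rw [Finset.filter_not, Finset.card_sdiff_of_subset (Finset.filter_subset _ _)]; simp
  rw [h1, h2, Nat.cast_sub hA]
  have h3 : ((A.card : ℝ) + 1) ≤ 2 ^ A.card := by exact_mod_cast Nat.lt_two_pow_self (n := A.card)
  have h4 : (2 : ℝ) ^ m = 2 ^ (m - A.card) * 2 ^ A.card := by rw [← pow_add]; congr 1; omega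
  rw [h4]
  have h5 : (0 : ℝ) ≤ m * 2 ^ (m - A.card) := by positivity
  nlinarith [mul_le_mul_of_nonneg_left h3 h5]

open Classical in
/-- The moment bound for a clause, as a product of the contributions of the gadgets. The right-hand
side is the number of restrictions. -/
theorem sum_weight_le (C : Clause) :
    ∑ ρ : Restr E m, (if Survives enc ρ C then (((m : ℝ) + 1) / 2) ^ (live enc ρ C).card else 0) ≤
      ((m : ℝ) * 2 ^ m) ^ Fintype.card E := by
  let A : E → Finset (Fin m) := fun e => Finset.univ.filter fun i => ∃ b, (enc (e, .data i), b) ∈ C.1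
  let s : E → Fin m → Bool := fun e i => decide ((enc (e, .data i), false) ∈ C.1)
  let g : E → Fin m × (Fin m → Bool) → ℝ := fun e r =>
    (if ∀ j ∈ A e, j ≠ r.1 → r.2 j = s e j then (1 : ℝ) else 0) *
      (if r.1 ∈ A e then ((m : ℝ) + 1) / 2 else 1)
  have hg0 : ∀ e r, 0 ≤ g e r := by
    intro e r
    refine mul_nonneg ?_ ?_ <;> split_ifs <;> positivity
  calc ∑ ρ : Restr E m, (if Survives enc ρ C then (((m : ℝ) + 1) / 2) ^ (live enc ρ C).card else 0)
      ≤ ∑ ρ : Restr E m, ∏ e, g e (ρ e) := by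
        refine Finset.sum_le_sum fun ρ _ => ?_
        split_ifs with hs
        · obtain ⟨α, hα⟩ := hs
          have h1 : ∀ e, g e (ρ e) = if e ∈ live enc ρ C then ((m : ℝ) + 1) / 2 else 1 := by
            intro e
            have h2 : ∀ j ∈ A e, j ≠ (ρ e).1 → (ρ e).2 j = s e j := by
              intro j hj hne
              obtain ⟨b, hb⟩ := (Finset.mem_filter.1 hj).2
              have h3 := hα _ hb
              rw [totalVal_enc] at h3
              simp only [gadgetVal, if_neg hne] at h3
              rw [h3]
              cases b with
              | false => simp [s, hb]
              | true =>
                have : (enc (e, .data j), false) ∉ C.1 := fun h => by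
                  simpa using C.2 _ hb _ h rfl
                simp [s, this]
            have h4 : (ρ e).1 ∈ A e ↔ e ∈ live enc ρ C := by simp [A, mem_live]
            simp only [g]
            rw [if_pos h2, one_mul]
            simp only [h4]
          simp only [h1]
          rw [Finset.prod_ite]
          simp [div_pow]
        · exact Finset.prod_nonneg fun e _ => hg0 e _
    _ = ∏ e, ∑ r, g e r := (Fintype.prod_sum g).symm
    _ ≤ ∏ _e : E, ((m : ℝ) * 2 ^ m) :=
        Finset.prod_le_prod (fun e _ => Finset.sum_nonneg fun r _ => hg0 e r)
          fun e _ => sum_gadget_weight_le (A e) (s e)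
    _ = ((m : ℝ) * 2 ^ m) ^ Fintype.card E := by simp

theorem live_empty (ρ : Restr E m) {C : Clause} (h : C.1 = ∅) : live enc ρ C = ∅ := by
  ext e; simp [mem_live, h]

/-- A small refutation is narrow under some restriction: every clause that is not satisfied has
fewer than `w` live variables. -/
theorem exists_narrow_restriction (hm : 1 ≤ m) {w : ℕ} (hw : 1 ≤ w) {F : CNF} (π : Refutation F)
    (hsize : (π.size : ℝ) ≤ (((m : ℝ) + 1) / 2) ^ w) :
    ∃ ρ : Restr E m, ∀ i, Survives enc ρ (π.clause i) → (live enc ρ (π.clause i)).card < w := by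
  classical
  by_contra! hcon
  set t : ℝ := ((m : ℝ) + 1) / 2 with ht
  have hm' : (1 : ℝ) ≤ m := by exact_mod_cast hm
  have ht1 : 1 ≤ t := by rw [ht]; linarith
  set last : Fin π.size := ⟨π.size - 1, Nat.sub_lt π.size_pos Nat.one_pos⟩ with hlast
  set X : ℝ := ((m : ℝ) * 2 ^ m) ^ Fintype.card E with hX
  have hXpos : 0 < X := by positivity
  have hcard : (Fintype.card (Restr E m) : ℝ) = X := by
    simp [hX]
  have h1 : X * t ^ w ≤ ∑ i ∈ Finset.univ.erase last, ∑ ρ : Restr E m,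
      (if Survives enc ρ (π.clause i) then t ^ (live enc ρ (π.clause i)).card else 0) := by
    rw [Finset.sum_comm]
    calc X * t ^ w = ∑ _ρ : Restr E m, t ^ w := by simp [← hcard]
      _ ≤ _ := by
        refine Finset.sum_le_sum fun ρ _ => ?_
        obtain ⟨i, hi, hiw⟩ := hcon ρ
        have hne : i ≠ last := by
          rintro rfl
          rw [live_empty ρ π.last_eq_empty] at hiw
          simp at hiw; omega
        calc t ^ w ≤ t ^ (live enc ρ (π.clause i)).card := pow_le_pow_right₀ ht1 hiw
          _ = (if Survives enc ρ (π.clause i) then t ^ (live enc ρ (π.clause i)).card else 0) :=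
            (if_pos hi).symm
          _ ≤ _ := Finset.single_le_sum (f := fun i => if Survives enc ρ (π.clause i) then
              t ^ (live enc ρ (π.clause i)).card else 0)
            (fun j _ => by split_ifs <;> positivity)
            (Finset.mem_erase.2 ⟨hne, Finset.mem_univ _⟩)
  have h2 : X * t ^ w ≤ ((π.size : ℝ) - 1) * X := by
    refine h1.trans ((Finset.sum_le_sum fun i _ => sum_weight_le (enc := enc) (π.clause i)).trans ?_)
    rw [Finset.sum_const, Finset.card_erase_of_mem (Finset.mem_univ _), nsmul_eq_mul]
    simp only [Finset.card_univ, Fintype.card_fin]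
    rw [Nat.cast_sub π.size_pos]
    simp [hX]
  -- the empty last clause is not counted, which makes the inequality strict
  nlinarith

/-! ### Walking down a narrow refutation -/

/-- A strategy for staying consistent with the system for `t` steps while remembering fewer than `w`
variables: `St t S α` says that the values of `α` on `S` can be defended for `t` more steps. -/
structure DefenderStrategy (P : ParitySystem E V) (w : ℕ)
    (St : ℕ → Finset E → (E → Bool) → Prop) : Prop where
  /-- variables may be forgotten -/
  mono : ∀ t S S' α, St t S α → S' ⊆ S → St t S' α
  /-- steps may be skipped -/
  weaken : ∀ t S α, St (t + 1) S α → St t S α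
  /-- any variable can be queried as long as fewer than `w` are remembered -/
  query : ∀ t S α, St (t + 1) S α → S.card < w → ∀ x, ∃ α' : E → Bool,
    (∀ e ∈ S, α' e = α e) ∧ St t (insert x S) α'
  /-- no equation is violated -/
  sound : ∀ t S α v, St t S α → P.inc v ⊆ S → ∑ e ∈ P.inc v, bit (α e) = P.charge v

/-- A clause falsified by a defended assignment is not an axiom: the total assignments given by
restrictions satisfy the gadgets, and the defender satisfies the equations. -/
theorem Falsifies.not_mem_liftCNF {St : ℕ → Finset E → (E → Bool) → Prop} {w : ℕ}
    (hS : DefenderStrategy P w St) {ρ : Restr E m} {α : E → Bool} {C : Clause} {t : ℕ}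
    (hf : Falsifies (totalVal enc ρ α) C) (hst : St t (live enc ρ C) α) : C ∉ liftCNF P enc := by
  intro hC
  rcases mem_liftCNF.1 hC with ⟨v, β, I, hβ, hCe⟩ | ⟨e, he⟩
  · have key : ∀ e ∈ P.inc v, e ∈ live enc ρ C ∧ α e = β e := by
      intro e he
      have h1 := hf (enc (e, .sel (I e)), false)
        (by rw [hCe, mem_liftSet]; exact ⟨e, he, Or.inl rfl⟩)
      have hd : (enc (e, .data (I e)), !β e) ∈ C.1 := by
        rw [hCe, mem_liftSet]; exact ⟨e, he, Or.inr rfl⟩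
      have h2 := hf _ hd
      rw [totalVal_enc] at h1 h2
      simp only [gadgetVal, Bool.not_false, decide_eq_true_eq] at h1
      simp only [gadgetVal, h1, if_true, Bool.not_not] at h2
      exact ⟨mem_live.2 ⟨_, h1 ▸ hd⟩, h2⟩
    apply hβ
    rw [← hS.sound t _ α v hst fun e he => (key e he).1]
    exact Finset.sum_congr rfl fun e he => by rw [(key e he).2]
  · rcases mem_gadgetSets.1 he with h | h | ⟨i, h⟩
    · have := hf (enc (e, .chain 0), false) (by simp [h])
      rw [totalVal_enc] at this
      simp [gadgetVal] at this
    · have := hf (enc (e, .chain (Fin.last m)), true) (by simp [h])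
      rw [totalVal_enc] at this
      simp [gadgetVal] at this
    · have h1 := hf (enc (e, .chain i.castSucc), true) (by simp [h])
      have h2 := hf (enc (e, .sel i), true) (by simp [h])
      have h3 := hf (enc (e, .chain i.succ), false) (by simp [h])
      rw [totalVal_enc] at h1 h2 h3
      simp [gadgetVal, Fin.ext_iff] at h1 h2 h3
      omega

theorem Refutation.edge_left {F : CNF} {π : Refutation F} {i j k : Fin π.size}
    (h : π.premises i = some (j, k)) : (j, i) ∈ π.edges := ⟨k, Or.inl h⟩

theorem Refutation.edge_right {F : CNF} {π : Refutation F} {i j k : Fin π.size}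
    (h : π.premises i = some (j, k)) : (k, i) ∈ π.edges := ⟨j, Or.inr h⟩

/-- A predicate that can be pushed from each clause to one of its premises `t` times yields a path
of length `t`. -/
theorem Refutation.exists_path {F : CNF} (π : Refutation F) (Q : ℕ → Fin π.size → Prop)
    (h : ∀ t i, Q (t + 1) i → ∃ j, (j, i) ∈ π.edges ∧ Q t j) (t : ℕ) :
    ∀ i, Q t i → ∃ p : RelSeries π.edges, p.last = i ∧ p.length = t := by
  induction t with
  | zero => exact fun i _ => ⟨RelSeries.singleton _ i, rfl, rfl⟩
  | succ t ih =>
    intro i hi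
    obtain ⟨j, hji, hj⟩ := h t i hi
    obtain ⟨p, hp, hlen⟩ := ih j hj
    exact ⟨p.snoc i (by rw [hp]; exact hji), by simp, by simp [hlen]⟩

/-- If the system can be defended for `t` steps with fewer than `w` variables, then every small
refutation of its lift has depth at least `t`. -/
theorem le_depth_of_strategy (hm : 1 ≤ m) {w : ℕ} (hw : 1 ≤ w)
    {St : ℕ → Finset E → (E → Bool) → Prop} (hS : DefenderStrategy P w St) {t : ℕ}
    {α₀ : E → Bool} (h0 : St t ∅ α₀) (π : Refutation (liftCNF P enc))
    (hsize : (π.size : ℝ) ≤ (((m : ℝ) + 1) / 2) ^ w) : t ≤ π.depth := by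
  obtain ⟨ρ, hρ⟩ := exists_narrow_restriction (enc := enc) hm hw π hsize
  let Q : ℕ → Fin π.size → Prop := fun t i => ∃ α, Falsifies (totalVal enc ρ α) (π.clause i) ∧
    St t (live enc ρ (π.clause i)) α
  have step : ∀ t i, Q (t + 1) i → ∃ j, (j, i) ∈ π.edges ∧ Q t j := by
    rintro t i ⟨α, hf, hst⟩
    cases hp : π.premises i with
    | none => exact absurd (π.mem_of_none i hp) (hf.not_mem_liftCNF hS hst)
    | some jk =>
      obtain ⟨j, k⟩ := jk
      obtain ⟨-, -, z, hA, hB, hE⟩ := π.resolves_of_some i j k hp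
      set C := π.clause i
      have hlt := hρ i ⟨α, hf⟩
      -- the values after the resolved variable has been queried
      obtain ⟨S, α', hα', hst', hlive⟩ : ∃ S, ∃ α' : E → Bool,
          (∀ e ∈ live enc ρ C, α' e = α e) ∧ St t S α' ∧ ∀ e,
            (e ∈ live enc ρ C ∨ z = enc (e, .data (ρ e).1)) → e ∈ S := by
        by_cases hz : ∃ e, z = enc (e, .data (ρ e).1)
        · obtain ⟨e, rfl⟩ := hz
          obtain ⟨α', h1, h2⟩ := hS.query t _ α hst hlt e
          refine ⟨_, α', h1, h2, ?_⟩
          rintro e' (he' | he')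
          · exact Finset.mem_insert_of_mem he'
          · have := enc.injective he'
            simp only [Prod.mk.injEq] at this
            rw [← this.1]
            exact Finset.mem_insert_self _ _
        · refine ⟨_, α, fun _ _ => rfl, hS.weaken _ _ _ hst, ?_⟩
          rintro e (he | he)
          · exact he
          · exact absurd ⟨e, he⟩ hz
      have hf' : Falsifies (totalVal enc ρ α') C := by
        intro l hl
        rw [← hf l hl]
        refine totalVal_congr ρ fun e he => hα' e ?_
        exact mem_live.2 ⟨l.2, he ▸ hl⟩
      have push : ∀ (D : Clause) (b : Bool), (z, b) ∈ D.1 → D.1.erase (z, b) ⊆ C.1 →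
          totalVal enc ρ α' z = !b → Falsifies (totalVal enc ρ α') D ∧ St t (live enc ρ D) α' := by
        intro D b hb hD hz
        refine ⟨fun l hl => ?_, hS.mono _ _ _ _ hst' fun e he => ?_⟩
        · by_cases h : l = (z, b)
          · rw [h]; exact hz
          · exact hf' l (hD (Finset.mem_erase.2 ⟨h, hl⟩))
        · obtain ⟨b', hb'⟩ := mem_live.1 he
          by_cases h : (enc (e, GadgetVar.data (ρ e).1), b') = (z, b)
          · exact hlive e (Or.inr (Prod.ext_iff.1 h).1.symm)
          · exact hlive e (Or.inl (mem_live.2 ⟨b', hD (Finset.mem_erase.2 ⟨h, hb'⟩)⟩))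
      cases hz : totalVal enc ρ α' z with
      | false =>
        exact ⟨j, π.edge_left hp, α', push _ true hA (hE ▸ Finset.subset_union_left) (by simp [hz])⟩
      | true =>
        exact ⟨k, π.edge_right hp, α',
          push _ false hB (hE ▸ Finset.subset_union_right) (by simp [hz])⟩
  obtain ⟨p, -, hp⟩ := π.exists_path Q step t ⟨π.size - 1, Nat.sub_lt π.size_pos Nat.one_pos⟩
    ⟨α₀, by intro l hl; rw [π.last_eq_empty] at hl; simp at hl,
      by rw [live_empty ρ π.last_eq_empty]; exact h0⟩
  rw [← hp]
  exact π.depth_isGreatest.2 ⟨p, rfl⟩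

end Resolution

namespace Resolution

/-! ### The compressed cylinder -/

/-- Parameters of the compressed cylinder: pairwise coprime numbers `q i`, one for each of the `k`
rows; the row `r` has a period divisible by the `c + 1` numbers `q r, …, q (r + c)`. -/
structure CylParams (k : ℕ) where
  /-- one less than the number of the `q i` that a row involves -/
  c : ℕ
  /-- the coprime numbers -/
  q : ZMod k → ℕ
  four_le : 4 ≤ k
  c_lt : c + 1 ≤ k
  two_le_q : ∀ i, 2 ≤ q i
  coprime : Pairwise (Function.onFun Nat.Coprime q)

namespace CylParams
variable {k : ℕ}

/-- The period of the row `r`. The factor `4 * k` lets an error of up to `3 * c` columns be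
recognized modulo a period. -/
def per (p : CylParams k) (r : ZMod k) : ℕ :=
  4 * k * ∏ j ∈ Finset.range (p.c + 1), p.q (r + (j : ℕ))

/-- The period of the edges between the rows `r` and `r + 1`: the greatest common divisor of the
periods of the two rows, up to the case that `c + 1 = k`. -/
def vper (p : CylParams k) (r : ZMod k) : ℕ :=
  4 * k * ∏ j ∈ Finset.range p.c, p.q (r + ((j + 1 : ℕ) : ZMod k))

/-- The product of all `q i`. -/
def total [NeZero k] (p : CylParams k) : ℕ := ∏ i, p.q i

/-- The column of the ring at which the strip on side `s` is attached; the two columns are half of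
the common period `4 * k * total` of all rows apart. -/
def pos [NeZero k] (p : CylParams k) (s : Bool) : ℕ := if s then 2 * k * p.total else 0

variable (p : CylParams k)

theorem q_pos (i : ZMod k) : 0 < p.q i := lt_of_lt_of_le (by norm_num) (p.two_le_q i)

theorem per_eq (r : ZMod k) : p.per r = p.q r * p.vper r := by
  rw [per, Finset.prod_range_succ', vper]
  simp; ring

theorem per_succ_eq (r : ZMod k) :
    p.per (r + 1) = p.vper r * p.q (r + ((p.c + 1 : ℕ) : ZMod k)) := by
  have h1 : ∀ j : ℕ, r + 1 + (j : ZMod k) = r + ((j + 1 : ℕ) : ZMod k) := by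
    intro j; push_cast; ring
  rw [per, Finset.prod_range_succ, vper, ← mul_assoc]
  simp only [h1]

theorem vper_dvd_per (r : ZMod k) : p.vper r ∣ p.per r := p.per_eq r ▸ Dvd.intro_left _ rfl

theorem vper_dvd_per_succ (r : ZMod k) : p.vper r ∣ p.per (r + 1) :=
  p.per_succ_eq r ▸ Dvd.intro _ rfl

theorem vper_pos (r : ZMod k) : 0 < p.vper r := by
  have := p.four_le
  exact Nat.mul_pos (by omega) (Finset.prod_pos fun _ _ => p.q_pos _)

theorem per_ge (r : ZMod k) : 2 ≤ p.per r := by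
  rw [per_eq]
  exact (p.two_le_q r).trans (Nat.le_mul_of_pos_right _ (p.vper_pos r))

instance (r : ZMod k) : NeZero (p.vper r) := ⟨(p.vper_pos r).ne'⟩
instance (r : ZMod k) : NeZero (p.per r) := ⟨by have := p.per_ge r; omega⟩

theorem four_mul_dvd_vper (r : ZMod k) : 4 * k ∣ p.vper r := Dvd.intro _ rfl

theorem four_mul_dvd_per (r : ZMod k) : 4 * k ∣ p.per r := Dvd.intro _ rfl

theorem mul_q_dvd_per (i : ZMod k) {j : ℕ} (hj : j ≤ p.c) :
    4 * k * p.q i ∣ p.per (i - (j : ℕ)) := by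
  refine mul_dvd_mul_left _ ?_
  have := Finset.dvd_prod_of_mem (fun j' : ℕ => p.q (i - (j : ℕ) + (j' : ℕ)))
    (Finset.mem_range.2 (Nat.lt_succ_of_le hj))
  simpa using this

theorem mul_q_dvd_vper (i : ZMod k) {j : ℕ} (hj : j < p.c) :
    4 * k * p.q i ∣ p.vper (i - ((j + 1 : ℕ) : ZMod k)) := by
  refine mul_dvd_mul_left _ ?_
  have := Finset.dvd_prod_of_mem
    (fun j' : ℕ => p.q (i - ((j + 1 : ℕ) : ZMod k) + ((j' + 1 : ℕ) : ZMod k)))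
    (Finset.mem_range.2 hj)
  simpa using this

/-- The variables: horizontal and vertical edges of the ring and of the two strips. The edge
`h r a` joins the columns `a` and `a + 1` of the row `r`. The edge `v r g` is folded more tightly
than the rows `r` and `r + 1` that it joins, and so it is a hyperedge: its ends are all vertices of
these two rows in columns congruent to `g`. The edge `hs s r j` leaves the vertex `strip s r j`
away from the ring; for the last column of a strip it is isolated. -/
inductive Edge (p : CylParams k) : Type
  | h (r : ZMod k) (a : ZMod (p.per r))
  | v (r : ZMod k) (g : ZMod (p.vper r))
  | hs (s : Bool) (r : ZMod k) (j : Fin (2 * k))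
  | vs (s : Bool) (r : ZMod k) (j : Fin (2 * k))

/-- The equations: vertices of the ring and of the two strips. -/
inductive Vertex (p : CylParams k) : Type
  | ring (r : ZMod k) (a : ZMod (p.per r))
  | strip (s : Bool) (r : ZMod k) (j : Fin (2 * k))

noncomputable instance : DecidableEq p.Edge := Classical.decEq _
noncomputable instance : DecidableEq p.Vertex := Classical.decEq _

variable [NeZero k]

/-- The edges as a disjoint sum. -/
def edgeToSum : p.Edge → (Σ r, ZMod (p.per r)) ⊕ (Σ r, ZMod (p.vper r)) ⊕
    (Bool × ZMod k × Fin (2 * k)) ⊕ (Bool × ZMod k × Fin (2 * k))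
  | .h r a => .inl ⟨r, a⟩
  | .v r a => .inr (.inl ⟨r, a⟩)
  | .hs s r j => .inr (.inr (.inl (s, r, j)))
  | .vs s r j => .inr (.inr (.inr (s, r, j)))

theorem edgeToSum_injective : Function.Injective p.edgeToSum := by
  rintro (⟨r, a⟩ | ⟨r, a⟩ | ⟨s, r, j⟩ | ⟨s, r, j⟩) (⟨r', a'⟩ | ⟨r', a'⟩ | ⟨s', r', j'⟩ | ⟨s', r', j'⟩) h <;>
    simp [edgeToSum] at h
  · obtain ⟨rfl, h⟩ := h; rw [eq_of_heq h]
  · obtain ⟨rfl, h⟩ := h; rw [eq_of_heq h]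
  · obtain ⟨rfl, rfl, rfl⟩ := h; rfl
  · obtain ⟨rfl, rfl, rfl⟩ := h; rfl

/-- The vertices as a disjoint sum. -/
def vertexToSum : p.Vertex → (Σ r, ZMod (p.per r)) ⊕ (Bool × ZMod k × Fin (2 * k))
  | .ring r a => .inl ⟨r, a⟩
  | .strip s r j => .inr (s, r, j)

theorem vertexToSum_injective : Function.Injective p.vertexToSum := by
  rintro (⟨r, a⟩ | ⟨s, r, j⟩) (⟨r', a'⟩ | ⟨s', r', j'⟩) h <;> simp [vertexToSum] at h
  · obtain ⟨rfl, h⟩ := h; rw [eq_of_heq h]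
  · obtain ⟨rfl, rfl, rfl⟩ := h; rfl

noncomputable instance : Fintype p.Edge := Fintype.ofInjective _ p.edgeToSum_injective
noncomputable instance : Fintype p.Vertex := Fintype.ofInjective _ p.vertexToSum_injective

/-- The index of the strip vertices next to the ring. -/
def inner : Fin (2 * k) := ⟨0, Nat.mul_pos (by norm_num) (NeZero.pos k)⟩

/-- The horizontal edge from the vertex `strip s r j` towards the ring. -/
def inEdge (s : Bool) (r : ZMod k) (j : Fin (2 * k)) : p.Edge :=
  if j.val = 0 then .h r (p.pos s : ℕ) else .hs s r ⟨j.val - 1, by omega⟩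

open Classical in
/-- The edges at a vertex. The innermost strip vertices are attached to ring edges, which thereby
have three ends. -/
noncomputable def inc : p.Vertex → Finset p.Edge
  | .ring r a => {.h r (a - 1), .h r a, .v r a.cast, .v (r - 1) a.cast}
  | .strip s r j => {p.inEdge s r j, .vs s r j, .vs s (r - 1) j} ∪
      if j.val + 1 < 2 * k then {.hs s r j} else ∅

open Classical in
/-- The compressed cylinder with a single charged vertex. -/
noncomputable def system : ParitySystem p.Edge p.Vertex where
  inc := p.inc
  charge v := if v = .strip false 0 inner then 1 else 0

/-- The coefficients of the sum of the equations selected by `U`. -/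
def bd (U : p.Vertex → ZMod 2) : p.Edge → ZMod 2
  | .h r a => U (.ring r a) + U (.ring r (a + 1)) +
      ∑ s : Bool, if ((p.pos s : ℕ) : ZMod (p.per r)) = a then U (.strip s r inner) else 0
  | .v r g => (∑ a : ZMod (p.per r), if (a.cast : ZMod (p.vper r)) = g then U (.ring r a) else 0) +
      ∑ a : ZMod (p.per (r + 1)), if (a.cast : ZMod (p.vper r)) = g then U (.ring (r + 1) a) else 0
  | .hs s r j => if h : j.val + 1 < 2 * k then
      U (.strip s r j) + U (.strip s r ⟨j.val + 1, h⟩) else 0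
  | .vs s r j => U (.strip s r j) + U (.strip s (r + 1) j)

theorem bd_add (U U' : p.Vertex → ZMod 2) (e : p.Edge) :
    p.bd (U + U') e = p.bd U e + p.bd U' e := by
  cases e with
  | h r a =>
    simp only [bd, Pi.add_apply, Fintype.sum_bool]
    split_ifs <;> ring
  | v r g =>
    have : ∀ a b : ZMod 2, ∀ P : Prop, ∀ _ : Decidable P, (if P then a + b else 0) =
      (if P then a else 0) + (if P then b else 0) := by intros; split_ifs <;> simp
    simp only [bd, Pi.add_apply, this, Finset.sum_add_distrib]
    ring
  | hs s r j => 
    simp only [bd, Pi.add_apply]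
    split_ifs <;> ring
  | vs s r j => simp only [bd, Pi.add_apply]; ring

theorem one_ne_zero_row (p : CylParams k) : (1 : ZMod k) ≠ 0 := by
  have := p.four_le
  have : Fact (1 < k) := ⟨by omega⟩
  exact one_ne_zero

theorem one_ne_zero_per (r : ZMod k) : (1 : ZMod (p.per r)) ≠ 0 := by
  have : Fact (1 < p.per r) := ⟨p.per_ge r⟩
  exact one_ne_zero

theorem v_eq_iff {r r' : ZMod k} (hr : r = r') {n : ℕ} (a : ZMod n) (g : ZMod (p.vper r')) :
    (Edge.v r (a.cast) : p.Edge) = .v r' g ↔ (a.cast : ZMod (p.vper r')) = g := by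
  subst hr; simp

theorem bd_single_ring (r : ZMod k) (a : ZMod (p.per r)) (e : p.Edge) :
    p.bd (Pi.single (.ring r a) 1) e = if e ∈ p.inc (.ring r a) then 1 else 0 := by
  classical
  have h1 := p.one_ne_zero_row
  cases e with
  | h r' a' =>
    by_cases hr : r' = r
    · subst hr
      have h2 := p.one_ne_zero_per r'
      have h3 : a' ≠ a' + 1 := by simpa using h2
      simp only [bd, inc, Pi.single_apply, Fintype.sum_bool, Finset.mem_insert,
        Finset.mem_singleton, Vertex.ring.injEq, Edge.h.injEq, heq_eq_eq, true_and, reduceCtorEq,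
        if_false, ite_self, add_zero, or_false, eq_sub_iff_add_eq]
      by_cases h4 : a' = a
      · have : a' + 1 ≠ a := fun h => h3 (h4.trans h.symm)
        simp [h4, h2]
      · simp [h4]
    · simp [bd, inc, hr]
  | v r' g =>
    by_cases hr : r' = r
    · subst hr
      have h3 : r' + 1 ≠ r' := by simpa using h1
      have h4 : r' ≠ r' - 1 := by simpa [eq_sub_iff_add_eq] using h1
      simp only [bd, inc, Pi.single_apply, Finset.mem_insert,
        Finset.mem_singleton, Vertex.ring.injEq, Edge.v.injEq, heq_eq_eq, true_and, reduceCtorEq,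
        false_or, h3, h4, false_and, or_false, if_false, ite_self, Finset.sum_const_zero, add_zero]
      have : ∀ x : ZMod (p.per r'), (if (x.cast : ZMod (p.vper r')) = g then
          if x = a then (1 : ZMod 2) else 0 else 0) =
          if x = a then (if g = (a.cast : ZMod (p.vper r')) then (1 : ZMod 2) else 0) else 0 := by
        intro x
        by_cases hx : x = a
        · subst hx; simp [eq_comm]
        · simp [hx]
      simp only [this]
      simp
    · by_cases hr' : r' + 1 = r
      · subst hr'
        have h4 : r' ≠ r' + 1 := by simpa using h1
        have h5 : (Edge.v r' g = Edge.v (r' + 1 - 1) (a.cast : ZMod _) : Prop) ↔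
            (a.cast : ZMod (p.vper r')) = g := by
          rw [eq_comm]; exact p.v_eq_iff (by ring) a g
        simp only [bd, inc, Pi.single_apply, Finset.mem_insert,
          Finset.mem_singleton, Vertex.ring.injEq, heq_eq_eq, true_and, reduceCtorEq,
          false_or, h5, false_and, if_false, ite_self, Finset.sum_const_zero, zero_add, h4]
        have h6 : ¬ (Edge.v r' g = (Edge.v (r' + 1) a.cast : p.Edge)) := by
          intro h; injection h with h; exact h4 h
        have : ∀ x : ZMod (p.per (r' + 1)), (if (x.cast : ZMod (p.vper r')) = g then
            if x = a then (1 : ZMod 2) else 0 else 0) =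
            if x = a then (if (a.cast : ZMod (p.vper r')) = g then (1 : ZMod 2) else 0) else 0 := by
          intro x
          by_cases hx : x = a
          · subst hx; simp
          · simp [hx]
        simp only [this, h6, false_or]
        simp
      · have h5 : r' ≠ r - 1 := fun h => hr' (by rw [h]; ring)
        simp [bd, inc, hr, hr', h5]
  | hs s' r' j' => simp [bd, inc]
  | vs s' r' j' => simp [bd, inc]

theorem bd_single_strip (s : Bool) (r : ZMod k) (j : Fin (2 * k)) (e : p.Edge) :
    p.bd (Pi.single (.strip s r j) 1) e = if e ∈ p.inc (.strip s r j) then 1 else 0 := by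
  classical
  have h1 := p.one_ne_zero_row
  have hi : inner = j ↔ j.val = 0 := by rw [Fin.ext_iff]; exact eq_comm
  cases e with
  | h r' a' =>
    have h2 : (Edge.h r' a' : p.Edge) ∈ p.inc (.strip s r j) ↔
        j.val = 0 ∧ r' = r ∧ ((p.pos s : ℕ) : ZMod (p.per r')) = a' := by
      simp only [inc, inEdge, Finset.mem_union, Finset.mem_insert, Finset.mem_singleton]
      by_cases hj : j.val = 0
      · by_cases hr : r' = r
        · subst hr; simp [hj, eq_comm]; split_ifs <;> simp
        · simp [hj, hr]; split_ifs <;> simp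
      · simp [hj]; split_ifs <;> simp
    simp only [h2, bd, Pi.single_apply, reduceCtorEq, if_false, zero_add, Vertex.strip.injEq,
      Fintype.sum_bool]
    cases s <;> by_cases hj : j.val = 0 <;> by_cases hr : r' = r <;>
      simp [hj, hr, hi]
  | v r' g =>
    have : (Edge.v r' g : p.Edge) ∉ p.inc (.strip s r j) := by
      simp only [inc, inEdge]; split_ifs <;> simp
    simp [bd, this]
  | hs s' r' j' =>
    have h2 : (Edge.hs s' r' j' : p.Edge) ∈ p.inc (.strip s r j) ↔
        s' = s ∧ r' = r ∧ j'.val + 1 < 2 * k ∧ (j'.val + 1 = j.val ∨ j'.val = j.val) := by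
      simp only [inc, inEdge, Finset.mem_union, Finset.mem_insert, Finset.mem_singleton]
      have := j.2
      split_ifs <;> simp only [Edge.hs.injEq, Fin.ext_iff, Finset.mem_singleton,
        Finset.notMem_empty] <;> grind
    simp only [h2, bd, Pi.single_apply, Vertex.strip.injEq, Fin.ext_iff]
    by_cases hs : s' = s <;> by_cases hr : r' = r <;> by_cases hj : j'.val + 1 < 2 * k <;>
      simp only [hs, hr, hj, true_and, false_and, and_false, if_false, dite_true, dite_false,
        add_zero]
    by_cases h3 : j'.val + 1 = j.val
    · have h4 : j'.val ≠ j.val := by omega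
      simp only [h3, h4, if_true, if_false, zero_add, true_or]
    · simp only [h3, if_false, add_zero, false_or]
  | vs s' r' j' =>
    have h2 : (Edge.vs s' r' j' : p.Edge) ∈ p.inc (.strip s r j) ↔
        s' = s ∧ j' = j ∧ (r' = r ∨ r' + 1 = r) := by
      simp only [inc, inEdge, Finset.mem_union, Finset.mem_insert, Finset.mem_singleton]
      split_ifs <;> simp [eq_sub_iff_add_eq] <;> tauto
    simp only [h2, bd, Pi.single_apply, Vertex.strip.injEq]
    by_cases hs : s' = s <;> by_cases hj : j' = j <;> simp [hs, hj]
    by_cases h3 : r' = r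
    · have h4 : r' + 1 ≠ r := by rw [h3]; simpa using h1
      simp [h3, h1]
    · simp [h3]

/-- The function `bd` is additive and agrees with the system on single equations, so it describes
all linear combinations of equations. -/
theorem bd_single (v : p.Vertex) (e : p.Edge) :
    p.bd (Pi.single v 1) e = if e ∈ p.inc v then 1 else 0 := by
  cases v with
  | ring r a => exact p.bd_single_ring r a e
  | strip s r j => exact p.bd_single_strip s r j e

end CylParams
end Resolution

namespace Resolution

/-! ### Closed vertex sets -/

theorem zmod_two_cases (a : ZMod 2) : a = 0 ∨ a = 1 := by
  revert a; decide

/-- A `0`-`1` function on a cycle that changes its value at `x` and `y` only is `1` on one of the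
two arcs between them; so if it is supported on at most `c` points, then `x` and `y` have distance
at most `c`. -/
theorem exists_small_diff {n c : ℕ} [NeZero n] (d : ZMod n → ZMod 2) (x y : ZMod n)
    (hd : ∀ g, d g + d (g + 1) = (if x = g then 1 else 0) + (if y = g then 1 else 0))
    (D : Finset (ZMod n)) (hD : ∀ g, d g ≠ 0 → g ∈ D) (hc : D.card ≤ c) :
    ∃ z : ℤ, |z| ≤ c ∧ x = y + (z : ZMod n) := by
  have hstep : ∀ g, x ≠ g → y ≠ g → d (g + 1) = d g := by
    intro g h1 h2
    have := hd g
    rw [if_neg h1, if_neg h2, add_zero, CharTwo.add_eq_zero] at this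
    exact this.symm
  -- the function is constant along an arc
  have const : ∀ x y : ZMod n, (∀ g, x ≠ g → y ≠ g → d (g + 1) = d g) →
      ∀ j : ℕ, j < (y - x).val → d (x + ((j + 1 : ℕ) : ZMod n)) = d (x + 1) := by
    intro x y hstep j
    induction j with
    | zero => intro _; simp
    | succ j ih =>
      intro hj
      have hlt := ZMod.val_lt (y - x)
      have h2 : x ≠ x + ((j + 1 : ℕ) : ZMod n) := by
        intro h
        rw [left_eq_add, ZMod.natCast_eq_zero_iff] at h
        exact absurd (Nat.le_of_dvd (by omega) h) (by omega)
      have h3 : y ≠ x + ((j + 1 : ℕ) : ZMod n) := by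
        intro h
        have : y - x = ((j + 1 : ℕ) : ZMod n) := by rw [h]; ring
        rw [this, ZMod.val_natCast] at hj
        exact absurd hj (not_lt.2 (Nat.mod_le _ _))
      rw [← ih (by omega), ← hstep _ h2 h3]
      congr 1; push_cast; ring
  have arc : ∀ x y : ZMod n, (∀ g, x ≠ g → y ≠ g → d (g + 1) = d g) → d (x + 1) = 1 →
      (y - x).val ≤ c := by
    intro x y hstep h1
    have : ((Finset.range (y - x).val).image fun j : ℕ => x + ((j + 1 : ℕ) : ZMod n)) ⊆ D := by
      intro g hg
      obtain ⟨j, hj, rfl⟩ := Finset.mem_image.1 hg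
      exact hD _ (by rw [const x y hstep j (Finset.mem_range.1 hj), h1]; exact one_ne_zero)
    refine le_trans ?_ ((Finset.card_le_card this).trans hc)
    rw [Finset.card_image_of_injOn, Finset.card_range]
    intro i hi j hj hij
    have hlt := ZMod.val_lt (y - x)
    simp only [Finset.coe_range, Set.mem_Iio] at hi hj
    simp only [add_right_inj, ZMod.natCast_eq_natCast_iff'] at hij
    rw [Nat.mod_eq_of_lt (by omega), Nat.mod_eq_of_lt (by omega)] at hij
    omega
  by_cases hxy : x = y
  · exact ⟨0, by simp, by simp [hxy]⟩
  have h0 : d x + d (x + 1) = 1 := by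
    rw [hd x, if_pos rfl, if_neg (Ne.symm hxy), add_zero]
  rcases zmod_two_cases (d (x + 1)) with h1 | h1
  · -- then `d y = 0` as well, and the arc from `y` to `x` carries the value `1`
    have hpos : 0 < (y - x).val := by
      rw [Nat.pos_iff_ne_zero, Ne, ZMod.val_eq_zero, sub_eq_zero]
      exact Ne.symm hxy
    have hdy : d y = 0 := by
      have := const x y hstep ((y - x).val - 1) (by omega)
      rw [Nat.sub_add_cancel hpos, ZMod.natCast_zmod_val, h1] at this
      simpa using this
    have h2 : d (y + 1) = 1 := by
      have := hd y
      rw [hdy, if_neg hxy, if_pos rfl] at this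
      simpa using this
    have h3 := arc y x (fun g h1 h2 => hstep g h2 h1) h2
    refine ⟨((x - y).val : ℕ), by rw [Nat.abs_cast]; exact_mod_cast h3, ?_⟩
    rw [Int.cast_natCast, ZMod.natCast_zmod_val]; ring
  · have h3 := arc x y hstep h1
    refine ⟨-((y - x).val : ℕ), by rw [abs_neg, Nat.abs_cast]; exact_mod_cast h3, ?_⟩
    rw [Int.cast_neg, Int.cast_natCast, ZMod.natCast_zmod_val]; ring

namespace CylParams
variable {k : ℕ} [NeZero k] (p : CylParams k)

/-- The row of a horizontal edge. -/
def row : p.Edge → Option (ZMod k)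
  | .h r _ => some r
  | .v _ _ => none
  | .hs _ r _ => some r
  | .vs _ _ _ => none

/-- The horizontal edges of the row `r` in `S`. -/
def rowEdges (S : Finset p.Edge) (r : ZMod k) : Finset p.Edge := S.filter fun e => p.row e = some r

/-- The column of the ring that a horizontal edge of the row `r` represents: strip edges stand for
the column at which their strip is attached. -/
def Anchor (r : ZMod k) (a : ZMod (p.per r)) (e : p.Edge) : Prop :=
  e = .h r a ∨ ∃ s j, e = .hs s r j ∧ a = (p.pos s : ℕ)

/-- Every row contains a horizontal edge of `S`. -/
def Full (S : Finset p.Edge) : Prop := ∀ r, (p.rowEdges S r).Nonempty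

/-- The column `x` of the universal cover is a location of `S`: up to an error of `c`, it is
represented by the edge of `S` in each row that contains just one. -/
def Loc (S : Finset p.Edge) (x : ℤ) : Prop :=
  ∀ r e a, p.rowEdges S r = {e} → p.Anchor r a e →
    ∃ z : ℤ, |z| ≤ p.c ∧ ((x - z : ℤ) : ZMod (p.per r)) = a

/-- The sum of the equations selected by `U` mentions variables of `S` only. -/
def Closed (S : Finset p.Edge) (U : p.Vertex → ZMod 2) : Prop := ∀ e, p.bd U e ≠ 0 → e ∈ S

/-- No vertical edge of the strip column `j` on side `s` is in `S`. -/
def FreeCol (S : Finset p.Edge) (s : Bool) (j : Fin (2 * k)) : Prop := ∀ r, .vs s r j ∉ S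

variable {p} {S T : Finset p.Edge} {U : p.Vertex → ZMod 2}

theorem Closed.bd_eq_zero (h : p.Closed S U) {e : p.Edge} (he : e ∉ S) : p.bd U e = 0 := by
  by_contra hne; exact he (h e hne)

theorem Closed.mono (h : p.Closed S U) (hS : S ⊆ T) : p.Closed T U := fun e he => hS (h e he)

theorem FreeCol.mono {s : Bool} {j : Fin (2 * k)} (h : p.FreeCol T s j) (hS : S ⊆ T) :
    p.FreeCol S s j := fun r hr => h r (hS hr)

theorem Full.mono (h : p.Full S) (hS : S ⊆ T) : p.Full T :=
  fun r => (h r).mono (Finset.filter_subset_filter _ hS)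

theorem Loc.mono {x : ℤ} (h : p.Loc S x) (hS : S ⊆ T) (hf : p.Full S) : p.Loc T x := by
  intro r e a he ha
  refine h r e a ?_ ha
  have hsub : p.rowEdges S r ⊆ {e} := he ▸ Finset.filter_subset_filter _ hS
  exact (Finset.subset_singleton_iff.1 hsub).resolve_left (hf r).ne_empty

theorem exists_anchor {r : ZMod k} {e : p.Edge} (h : p.row e = some r) : ∃ a, p.Anchor r a e := by
  cases e with
  | h r' a => obtain rfl : r' = r := by simpa [row] using h
              exact ⟨a, Or.inl rfl⟩
  | v r' a => simp [row] at h
  | hs s r' j => obtain rfl : r' = r := by simpa [row] using h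
                 exact ⟨_, Or.inr ⟨s, j, rfl, rfl⟩⟩
  | vs s r' j => simp [row] at h

/-- Small sets of edges leave a column free. -/
theorem exists_freeCol (hS : S.card < 2 * k) (s : Bool) : ∃ j, p.FreeCol S s j := by
  classical
  by_contra! h
  simp only [FreeCol, not_forall, not_not] at h
  choose r hr using h
  have := Finset.card_le_card_of_injOn (s := Finset.univ) (t := S) (fun j => Edge.vs s (r j) j)
    (fun j _ => hr j) (fun i _ j _ hij => by simpa using (Edge.vs.inj hij).2.2)
  simp at this
  omega

/-- A closed set contains a free column entirely or not at all. -/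
theorem FreeCol.const {s : Bool} {j : Fin (2 * k)} (h : p.FreeCol S s j) (hU : p.Closed S U)
    (r : ZMod k) : U (.strip s r j) = U (.strip s 0 j) := by
  have hstep : ∀ r : ZMod k, U (.strip s (r + 1) j) = U (.strip s r j) := by
    intro r
    have := hU.bd_eq_zero (h r)
    simp only [bd, CharTwo.add_eq_zero] at this
    exact this.symm
  have : ∀ n : ℕ, U (.strip s (n : ZMod k) j) = U (.strip s 0 j) := by
    intro n
    induction n with
    | zero => simp
    | succ n ih => rw [Nat.cast_succ, hstep, ih]
  simpa using this r.val

theorem strip_const {s : Bool} {r : ZMod k} (h : ∀ j, p.bd U (.hs s r j) = 0)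
    (j : Fin (2 * k)) : U (.strip s r j) = U (.strip s r inner) := by
  obtain ⟨n, hn⟩ := j
  induction n with
  | zero => rfl
  | succ n ih =>
    have := h ⟨n, by omega⟩
    simp only [bd, hn, dite_true, CharTwo.add_eq_zero] at this
    rw [← this, ih]

/-- Along a row of the ring only the two attachments of strips remain. -/
theorem sum_bd_row (U : p.Vertex → ZMod 2) (r : ZMod k) :
    ∑ a, p.bd U (.h r a) = U (.strip false r inner) + U (.strip true r inner) := by
  simp only [bd, Finset.sum_add_distrib]
  have : ∑ a : ZMod (p.per r), U (.ring r (a + 1)) = ∑ a : ZMod (p.per r), U (.ring r a) :=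
    Equiv.sum_comp (Equiv.addRight (1 : ZMod (p.per r))) fun a => U (.ring r a)
  rw [this, CharTwo.add_self_eq_zero, zero_add, Finset.sum_comm]
  simp [add_comm]

theorem notMem_of_rowEdges_eq_empty {r : ZMod k} (h : p.rowEdges S r = ∅) {e : p.Edge}
    (he : p.row e = some r) : e ∉ S := by
  intro hS
  have : e ∈ p.rowEdges S r := Finset.mem_filter.2 ⟨hS, he⟩
  simp [h] at this

/-- If a closed set separates two free columns, then there are edges of `S` in every row. -/
theorem Closed.full (hU : p.Closed S U) {s₁ s₂ : Bool} {j₁ j₂ : Fin (2 * k)}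
    (h₁ : p.FreeCol S s₁ j₁) (h₂ : p.FreeCol S s₂ j₂)
    (hne : U (.strip s₁ 0 j₁) ≠ U (.strip s₂ 0 j₂)) : p.Full S := by
  intro r
  by_contra hr
  rw [Finset.not_nonempty_iff_eq_empty] at hr
  have hz : ∀ e, p.row e = some r → p.bd U e = 0 :=
    fun e he => hU.bd_eq_zero (notMem_of_rowEdges_eq_empty hr he)
  have hstrip : ∀ s j, U (.strip s r j) = U (.strip s r inner) :=
    fun s => strip_const fun j => hz _ rfl
  have hsum := sum_bd_row U r
  rw [Finset.sum_eq_zero fun a _ => hz (.h r a) rfl, eq_comm, CharTwo.add_eq_zero] at hsum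
  apply hne
  rw [← h₁.const hU r, ← h₂.const hU r, hstrip s₁ j₁, hstrip s₂ j₂]
  cases s₁ <;> cases s₂ <;> first | rfl | exact hsum | exact hsum.symm

theorem notMem_of_rowEdges_eq_singleton {r : ZMod k} {e e' : p.Edge} (h : p.rowEdges S r = {e})
    (he : p.row e' = some r) (hne : e' ≠ e) : e' ∉ S := by
  intro hS
  have : e' ∈ p.rowEdges S r := Finset.mem_filter.2 ⟨hS, he⟩
  rw [h, Finset.mem_singleton] at this
  exact hne this

/-- If a closed set separates two free columns of one strip, then that strip is a location. -/
theorem Closed.loc_pos (hU : p.Closed S U) {s : Bool} {j₁ j₂ : Fin (2 * k)}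
    (h₁ : p.FreeCol S s j₁) (h₂ : p.FreeCol S s j₂)
    (hne : U (.strip s 0 j₁) ≠ U (.strip s 0 j₂)) : p.Loc S (p.pos s) := by
  intro r e a he ha
  refine ⟨0, by simp, ?_⟩
  have key : ∃ j, e = .hs s r j := by
    by_contra! hcon
    apply hne
    have hstrip : ∀ j, U (.strip s r j) = U (.strip s r inner) := strip_const fun j =>
      hU.bd_eq_zero (notMem_of_rowEdges_eq_singleton he rfl (hcon j).symm)
    rw [← h₁.const hU r, ← h₂.const hU r, hstrip j₁, hstrip j₂]
  obtain ⟨j, rfl⟩ := key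
  rcases ha with ha | ⟨s', j', ha, rfl⟩
  · cases ha
  · cases ha
    simp

section Separated

variable {l₀ l₁ : ZMod 2}

/-- In a row with a single horizontal edge, a closed set is an arc from the anchor of that edge to
one of the two strips. -/
theorem Closed.ring_step (hU : p.Closed S U) {j₀ j₁ : Fin (2 * k)} {r : ZMod k}
    (h₀ : U (.strip false r j₀) = l₀) (h₁ : U (.strip true r j₁) = l₁) (hl : l₀ + l₁ = 1)
    {e : p.Edge} {a : ZMod (p.per r)} (he : p.rowEdges S r = {e}) (ha : p.Anchor r a e)
    (a' : ZMod (p.per r)) :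
    U (.ring r a') + U (.ring r (a' + 1)) = (if a = a' then 1 else 0) +
      ((if ((p.pos false : ℕ) : ZMod (p.per r)) = a' then l₀ else 0) +
      (if ((p.pos true : ℕ) : ZMod (p.per r)) = a' then l₁ else 0)) := by
  have hz : ∀ e', p.row e' = some r → e' ≠ e → p.bd U e' = 0 :=
    fun e' he' hne => hU.bd_eq_zero (notMem_of_rowEdges_eq_singleton he he' hne)
  have hbd : U (.ring r a') + U (.ring r (a' + 1)) = p.bd U (.h r a') +
      ((if ((p.pos false : ℕ) : ZMod (p.per r)) = a' then U (.strip false r inner) else 0) +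
      (if ((p.pos true : ℕ) : ZMod (p.per r)) = a' then U (.strip true r inner) else 0)) := by
    rw [bd, Fintype.sum_bool, add_comm (ite _ _ _) (ite _ _ _), add_assoc, CharTwo.add_self_eq_zero,
      add_zero]
  have hsum := sum_bd_row U r
  rw [hbd]
  rcases ha with rfl | ⟨s, j, rfl, rfl⟩
  · have e0 : U (.strip false r inner) = l₀ :=
      (strip_const (fun j => hz _ rfl (by simp)) j₀).symm.trans h₀
    have e1 : U (.strip true r inner) = l₁ :=
      (strip_const (fun j => hz _ rfl (by simp)) j₁).symm.trans h₁
    rw [Finset.sum_eq_single a (fun b _ hb => hz (.h r b) rfl (by simpa using hb)) (by simp),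
      e0, e1, hl] at hsum
    rw [e0, e1]
    congr 1
    split_ifs with h
    · rw [← h, hsum]
    · exact hz _ rfl (by simpa using Ne.symm h)
  · rw [Finset.sum_eq_zero fun b _ => hz (.h r b) rfl (by simp), eq_comm, CharTwo.add_eq_zero]
      at hsum
    rw [hz (.h r a') rfl (by simp), zero_add]
    cases s with
    | false =>
      have e1 : U (.strip true r inner) = l₁ :=
        (strip_const (fun j => hz _ rfl (by simp)) j₁).symm.trans h₁
      rw [hsum, e1]
      have : l₁ = 1 + l₀ := by rw [← hl, add_right_comm, CharTwo.add_self_eq_zero, zero_add]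
      by_cases h : ((p.pos false : ℕ) : ZMod (p.per r)) = a'
      · simp only [if_pos h]; rw [← add_assoc, ← this]
      · simp [if_neg h]
    | true =>
      have e0 : U (.strip false r inner) = l₀ :=
        (strip_const (fun j => hz _ rfl (by simp)) j₀).symm.trans h₀
      rw [← hsum, e0]
      have : l₀ = 1 + l₁ := by rw [← hl, add_assoc, CharTwo.add_self_eq_zero, add_zero]
      by_cases h : ((p.pos true : ℕ) : ZMod (p.per r)) = a'
      · simp only [if_pos h]; rw [add_left_comm, ← this, add_comm]
      · simp [if_neg h]

/-- The number of vertices of the row `r` in `U`, counted modulo `2` in each residue class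
modulo `n`. -/
def push (U : p.Vertex → ZMod 2) (n : ℕ) (r : ZMod k) (g : ZMod n) : ZMod 2 :=
  ∑ a : ZMod (p.per r), if (a.cast : ZMod n) = g then U (.ring r a) else 0

theorem sum_ite_ite_eq {α : Type*} [Fintype α] [DecidableEq α] (Q : α → Prop) [DecidablePred Q]
    (x : α) (u : ZMod 2) :
    ∑ b, (if Q b then if x = b then u else 0 else 0) = if Q x then u else 0 := by
  rw [Finset.sum_eq_single x]
  · simp
  · intro b _ hb; simp [hb.symm]
  · simp

/-- The relation of `Closed.ring_step` between consecutive columns persists under folding. -/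
theorem push_step {n : ℕ} {r : ZMod k} (hn : n ∣ p.per r) {a : ZMod (p.per r)}
    (h : ∀ a', U (.ring r a') + U (.ring r (a' + 1)) = (if a = a' then 1 else 0) +
      ((if ((p.pos false : ℕ) : ZMod (p.per r)) = a' then l₀ else 0) +
      (if ((p.pos true : ℕ) : ZMod (p.per r)) = a' then l₁ else 0))) (g : ZMod n) :
    push U n r g + push U n r (g + 1) = (if (a.cast : ZMod n) = g then 1 else 0) +
      ((if ((p.pos false : ℕ) : ZMod n) = g then l₀ else 0) +
      (if ((p.pos true : ℕ) : ZMod n) = g then l₁ else 0)) := by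
  have h1 : push U n r (g + 1) =
      ∑ a : ZMod (p.per r), if (a.cast : ZMod n) = g then U (.ring r (a + 1)) else 0 := by
    rw [push, ← Equiv.sum_comp (Equiv.addRight (1 : ZMod (p.per r)))]
    refine Finset.sum_congr rfl fun a _ => ?_
    simp only [Equiv.coe_addRight, ZMod.cast_add hn, ZMod.cast_one hn, add_left_inj]
  rw [h1, push, ← Finset.sum_add_distrib]
  have h2 : ∀ b : ZMod (p.per r), ((if (b.cast : ZMod n) = g then U (.ring r b) else 0) +
      if (b.cast : ZMod n) = g then U (.ring r (b + 1)) else 0) =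
      (if (b.cast : ZMod n) = g then (if a = b then 1 else 0) else 0) +
      ((if (b.cast : ZMod n) = g then
        (if ((p.pos false : ℕ) : ZMod (p.per r)) = b then l₀ else 0) else 0) +
      (if (b.cast : ZMod n) = g then
        (if ((p.pos true : ℕ) : ZMod (p.per r)) = b then l₁ else 0) else 0)) := by
    intro b
    by_cases hb : (b.cast : ZMod n) = g
    · simp only [if_pos hb]; exact h b
    · simp only [if_neg hb, add_zero]
  simp only [h2, Finset.sum_add_distrib, sum_ite_ite_eq, ZMod.cast_natCast hn]

theorem cast_cast_of_dvd {n g' m' : ℕ} (h1 : n ∣ g') (h2 : g' ∣ m') [NeZero m'] (a : ZMod m') :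
    ((a.cast : ZMod g').cast : ZMod n) = a.cast := by
  obtain ⟨x, rfl⟩ := ZMod.natCast_zmod_surjective a
  rw [ZMod.cast_natCast h2, ZMod.cast_natCast h1, ZMod.cast_natCast (h1.trans h2)]

/-- The push-forwards of adjacent rows differ by vertical edges of the cut only. -/
theorem push_add_push_succ {n : ℕ} {r : ZMod k} (hn : n ∣ p.vper r) (g : ZMod n) :
    push U n r g + push U n (r + 1) g =
      ∑ y : ZMod (p.vper r), if (y.cast : ZMod n) = g then p.bd U (.v r y) else 0 := by
  have h1 : ∀ y : ZMod (p.vper r), (if (y.cast : ZMod n) = g then p.bd U (.v r y) else 0) =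
      (∑ a : ZMod (p.per r), if (y.cast : ZMod n) = g then
        if (a.cast : ZMod (p.vper r)) = y then U (.ring r a) else 0 else 0) +
      ∑ a : ZMod (p.per (r + 1)), if (y.cast : ZMod n) = g then
        if (a.cast : ZMod (p.vper r)) = y then U (.ring (r + 1) a) else 0 else 0 := by
    intro y
    by_cases hy : (y.cast : ZMod n) = g
    · simp only [if_pos hy, bd]
    · simp [if_neg hy]
  simp only [h1, Finset.sum_add_distrib]
  rw [Finset.sum_comm, Finset.sum_comm (s := Finset.univ (α := ZMod (p.vper r)))]
  simp only [sum_ite_ite_eq, cast_cast_of_dvd hn (p.vper_dvd_per r),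
    cast_cast_of_dvd hn (p.vper_dvd_per_succ r)]
  rfl

/-- Where the push-forwards of two rows differ, `S` has a vertical edge. -/
theorem Closed.push_chain (hU : p.Closed S U) {n : ℕ} (r : ZMod k) (d : ℕ)
    (hn : ∀ j < d, n ∣ p.vper (r + (j : ℕ))) (g : ZMod n)
    (h : push U n r g + push U n (r + (d : ℕ)) g ≠ 0) :
    ∃ r', ∃ y : ZMod (p.vper r'), .v r' y ∈ S ∧ (y.cast : ZMod n) = g := by
  induction d with
  | zero => simp [CharTwo.add_self_eq_zero] at h
  | succ d ih =>
    by_cases h1 : push U n r g + push U n (r + (d : ℕ)) g = 0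
    · have h2 : push U n (r + (d : ℕ)) g + push U n (r + (d : ℕ) + 1) g ≠ 0 := by
        rw [CharTwo.add_eq_zero] at h1
        rw [← h1]
        convert h using 3
        push_cast; ring
      rw [push_add_push_succ (hn d (Nat.lt_succ_self d))] at h2
      obtain ⟨y, -, hy⟩ := Finset.exists_ne_zero_of_sum_ne_zero h2
      have h3 := (ite_ne_right_iff.1 hy)
      exact ⟨_, y, hU _ h3.2, h3.1⟩
    · exact ih (fun j hj => hn j (Nat.lt_succ_of_lt hj)) h1

end Separated

end CylParams
end Resolution

namespace Resolution
/-! ### The location of a cut -/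

namespace CylParams
variable {k : ℕ} [NeZero k] {p : CylParams k} {S T : Finset p.Edge} {U : p.Vertex → ZMod 2}

theorem int_dvd_of_eq {a b c : ℤ} (h : a ∣ b) (e : b = c) : a ∣ c := e ▸ h

theorem card_eq_sum_rowEdges (S : Finset p.Edge) :
    S.card = (S.filter fun e => p.row e = none).card + ∑ r, (p.rowEdges S r).card := by
  classical
  rw [Finset.card_eq_sum_card_fiberwise (f := p.row) (t := Finset.univ) (by simp),
    Fintype.sum_option]
  rfl

/-- With one edge in each of the `k` rows, at most `c` edges are left over. -/
theorem Full.card_vertical_le (hf : p.Full S) (hS : S.card ≤ k + p.c) :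
    (S.filter fun e => p.row e = none).card ≤ p.c := by
  have h1 := card_eq_sum_rowEdges S
  have h2 : ∑ _r : ZMod k, 1 ≤ ∑ r, (p.rowEdges S r).card :=
    Finset.sum_le_sum fun r _ => (hf r).card_pos
  simp at h2
  omega

theorem natCast_injOn_range {a : ℕ} (h : a ≤ k) :
    Set.InjOn (fun j : ℕ => (j : ZMod k)) (Finset.range a) := by
  intro i hi j hj hij
  simp only [Finset.coe_range, Set.mem_Iio] at hi hj
  simp only [ZMod.natCast_eq_natCast_iff'] at hij
  rwa [Nat.mod_eq_of_lt (by omega), Nat.mod_eq_of_lt (by omega)] at hij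

/-- Among the `c + 1` rows whose period involves `q i`, one contains just one edge of `S`. -/
theorem Full.exists_single (hf : p.Full S) (hS : S.card ≤ k + p.c) (i : ZMod k) :
    ∃ j ≤ p.c, ∃ e, p.rowEdges S (i - (j : ℕ)) = {e} := by
  classical
  by_contra! hcon
  have h1 := card_eq_sum_rowEdges S
  let A : Finset (ZMod k) := (Finset.range (p.c + 1)).image fun j : ℕ => i - (j : ZMod k)
  have hA : A.card = p.c + 1 := by
    rw [Finset.card_image_of_injOn, Finset.card_range]
    intro x hx y hy hxy
    exact natCast_injOn_range p.c_lt hx hy (by simpa using hxy)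
  have h2 : ∑ r : ZMod k, (1 + if r ∈ A then 1 else 0) ≤ ∑ r, (p.rowEdges S r).card := by
    refine Finset.sum_le_sum fun r _ => ?_
    have hpos := (hf r).card_pos
    split_ifs with hr
    · obtain ⟨j, hj, rfl⟩ := Finset.mem_image.1 hr
      have hne : (p.rowEdges S (i - (j : ℕ))).card ≠ 1 := by
        intro h
        obtain ⟨e, he⟩ := Finset.card_eq_one.1 h
        exact hcon j (Nat.lt_succ_iff.1 (Finset.mem_range.1 hj)) e he
      omega
    · omega
  rw [Finset.sum_add_distrib] at h2
  simp [hA] at h2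
  omega

theorem cast_eq_iff {n a b : ℕ} [NeZero a] [NeZero b] (x : ZMod a) (y : ZMod b) (z : ℤ) :
    (x.cast : ZMod n) = y.cast + (z : ZMod n) ↔ (n : ℤ) ∣ (x.val : ℤ) - y.val - z := by
  rw [← ZMod.natCast_val x, ← ZMod.natCast_val y]
  have : ((y.val : ℕ) : ZMod n) + (z : ZMod n) = ((y.val + z : ℤ) : ZMod n) := by push_cast; rfl
  rw [this, eq_comm, show ((x.val : ℕ) : ZMod n) = ((x.val : ℤ) : ZMod n) by push_cast; rfl,
    ZMod.intCast_eq_intCast_iff_dvd_sub]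
  rw [sub_sub]

/-- A closed set which separates a free column of one strip from a free column of the other. -/
structure Separates (S : Finset p.Edge) (U : p.Vertex → ZMod 2) (j₀ j₁ : Fin (2 * k)) : Prop where
  closed : p.Closed S U
  free₀ : p.FreeCol S false j₀
  free₁ : p.FreeCol S true j₁
  ne : U (.strip false 0 j₀) ≠ U (.strip true 0 j₁)

variable {j₀ j₁ : Fin (2 * k)}

/-- The anchors of two rows with a single edge agree up to the number of vertical edges of `S`,
modulo every number that divides the vertical periods between the two rows. -/
theorem Separates.drift (h : Separates S U j₀ j₁) (hS : S.card ≤ k + p.c) {n : ℕ} [NeZero n]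
    (r : ZMod k) (d : ℕ) (hn : n ∣ p.per r) (hn' : n ∣ p.per (r + (d : ℕ)))
    (hv : ∀ j < d, n ∣ p.vper (r + (j : ℕ))) {e e' : p.Edge} {a : ZMod (p.per r)}
    {a' : ZMod (p.per (r + (d : ℕ)))} (he : p.rowEdges S r = {e}) (ha : p.Anchor r a e)
    (he' : p.rowEdges S (r + (d : ℕ)) = {e'}) (ha' : p.Anchor (r + (d : ℕ)) a' e') :
    ∃ z : ℤ, |z| ≤ p.c ∧ (n : ℤ) ∣ (a.val : ℤ) - a'.val - z := by
  classical
  have hl : U (.strip false 0 j₀) + U (.strip true 0 j₁) = 1 := by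
    rcases zmod_two_cases (U (.strip false 0 j₀) + U (.strip true 0 j₁)) with h0 | h1
    · exact absurd (CharTwo.add_eq_zero.1 h0) h.ne
    · exact h1
  have hf := h.closed.full h.free₀ h.free₁ h.ne
  let toP : p.Edge → ZMod n := fun e => match e with
    | .v _ y => y.cast
    | _ => 0
  have key := fun g => push_step (U := U) hn (h.closed.ring_step (h.free₀.const h.closed r)
    (h.free₁.const h.closed r) hl he ha) g
  have key' := fun g => push_step (U := U) hn' (h.closed.ring_step
    (h.free₀.const h.closed _) (h.free₁.const h.closed _) hl he' ha') g
  obtain ⟨z, hz, hz'⟩ := exists_small_diff (c := p.c)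
    (fun g => push U n r g + push U n (r + (d : ℕ)) g) (a.cast : ZMod n) (a'.cast) (by
      intro g
      rw [add_add_add_comm, key g, key' g, add_add_add_comm, CharTwo.add_self_eq_zero, add_zero])
    ((S.filter fun e => p.row e = none).image toP) (by
      intro g hg
      obtain ⟨r', y, hy, rfl⟩ := h.closed.push_chain r d hv g hg
      exact Finset.mem_image.2 ⟨.v r' y, Finset.mem_filter.2 ⟨hy, rfl⟩, rfl⟩)
    (Finset.card_image_le.trans (hf.card_vertical_le hS))
  exact ⟨z, hz, (cast_eq_iff _ _ _).1 hz'⟩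

/-- All anchors of single edges agree up to `c` modulo `4 * k`. -/
theorem Separates.drift_base (h : Separates S U j₀ j₁) (hS : S.card ≤ k + p.c)
    {r r' : ZMod k} {e e' : p.Edge} {a : ZMod (p.per r)} {a' : ZMod (p.per r')}
    (he : p.rowEdges S r = {e}) (ha : p.Anchor r a e)
    (he' : p.rowEdges S r' = {e'}) (ha' : p.Anchor r' a' e') :
    ∃ z : ℤ, |z| ≤ p.c ∧ ((4 * k : ℕ) : ℤ) ∣ (a.val : ℤ) - a'.val - z := by
  have : NeZero (4 * k) := ⟨by have := p.four_le; omega⟩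
  obtain ⟨d, rfl⟩ : ∃ d : ℕ, r' = r + (d : ℕ) := ⟨(r' - r).val, by simp⟩
  exact h.drift hS r d (p.four_mul_dvd_per _) (p.four_mul_dvd_per _)
    (fun _ _ => p.four_mul_dvd_vper _) he ha he' ha'

/-- Anchors of single edges in rows that involve `q i` agree up to `c` modulo `4 * k * q i`. -/
theorem Separates.drift_q (h : Separates S U j₀ j₁) (hS : S.card ≤ k + p.c) (i : ZMod k)
    {j j' : ℕ} (hj : j ≤ p.c) (hj' : j' ≤ p.c) {r r' : ZMod k} (hr : r = i - (j : ℕ))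
    (hr' : r' = i - (j' : ℕ)) {e e' : p.Edge} {a : ZMod (p.per r)} {a' : ZMod (p.per r')}
    (he : p.rowEdges S r = {e}) (ha : p.Anchor r a e)
    (he' : p.rowEdges S r' = {e'}) (ha' : p.Anchor r' a' e') :
    ∃ z : ℤ, |z| ≤ p.c ∧ ((4 * k * p.q i : ℕ) : ℤ) ∣ (a.val : ℤ) - a'.val - z := by
  have aux : ∀ {j j' : ℕ} (_ : j' ≤ j) (_ : j ≤ p.c) {r r' : ZMod k} (_ : r = i - (j : ℕ))
      (_ : r' = i - (j' : ℕ)) {e e' : p.Edge} {a : ZMod (p.per r)} {a' : ZMod (p.per r')}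
      (_ : p.rowEdges S r = {e}) (_ : p.Anchor r a e)
      (_ : p.rowEdges S r' = {e'}) (_ : p.Anchor r' a' e'),
      ∃ z : ℤ, |z| ≤ p.c ∧ ((4 * k * p.q i : ℕ) : ℤ) ∣ (a.val : ℤ) - a'.val - z := by
    intro j j' hjj hj r r' hr hr' e e' a a' he ha he' ha'
    have : NeZero (4 * k * p.q i) :=
      ⟨by have := p.four_le; have := p.q_pos i; positivity⟩
    obtain ⟨d, rfl⟩ := Nat.exists_eq_add_of_le hjj
    obtain rfl : r' = r + (d : ℕ) := by rw [hr, hr']; push_cast; ring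
    refine h.drift hS r d ?_ ?_ ?_ he ha he' ha'
    · rw [hr]; exact p.mul_q_dvd_per i hj
    · rw [hr']; exact p.mul_q_dvd_per i (by omega)
    · intro t ht
      have h1 : r + (t : ℕ) = i - ((j' + d - t - 1 + 1 : ℕ) : ZMod k) := by
        rw [Nat.sub_add_cancel (by omega), Nat.cast_sub (by omega), hr]; ring
      rw [h1]
      exact p.mul_q_dvd_vper i (by omega)
  rcases le_total j' j with hjj | hjj
  · exact aux hjj hj hr hr' he ha he' ha'
  · obtain ⟨z, hz, hd⟩ := aux hjj hj' hr' hr he' ha' he ha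
    refine ⟨-z, by rwa [abs_neg], ?_⟩
    rw [← dvd_neg]
    have e1 : -((a.val : ℤ) - a'.val - -z) = a'.val - a.val - z := by ring
    rwa [e1]

/-- The Chinese remainder theorem for the numbers `q i`. -/
theorem exists_crt (p : CylParams k) (y : ZMod k → ℤ) :
    ∃ Y : ℤ, ∀ i, (p.q i : ℤ) ∣ Y - y i := by
  obtain ⟨u, hu⟩ := (ZMod.prodEquivPi p.q p.coprime).surjective fun i => (y i : ZMod (p.q i))
  obtain ⟨Y, rfl⟩ := ZMod.intCast_surjective u
  refine ⟨Y, fun i => ?_⟩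
  have := congrFun hu i
  rw [map_intCast, Pi.intCast_apply, eq_comm, ZMod.intCast_eq_intCast_iff_dvd_sub] at this
  exact this

theorem isCoprime_q (p : CylParams k) {i j : ZMod k} (h : i ≠ j) :
    IsCoprime (p.q i : ℤ) (p.q j : ℤ) := Nat.isCoprime_iff_coprime.2 (p.coprime h)

theorem per_dvd {p : CylParams k} {r : ZMod k} {y : ℤ}
    (h : ∀ t ≤ p.c, (p.q (r + (t : ℕ)) : ℤ) ∣ y) : (p.per r : ℤ) ∣ (4 * k : ℕ) * y := by
  rw [per, Nat.cast_mul]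
  refine mul_dvd_mul_left _ ?_
  rw [Nat.cast_prod]
  refine Finset.prod_dvd_of_coprime ?_ fun t ht => h t (Nat.lt_succ_iff.1 (Finset.mem_range.1 ht))
  intro a ha b hb hab
  refine p.isCoprime_q fun h => hab (natCast_injOn_range p.c_lt ha hb ?_)
  simpa using h

theorem total_dvd {p : CylParams k} {y : ℤ} (h : ∀ i, (p.q i : ℤ) ∣ y) : (p.total : ℤ) ∣ y := by
  rw [total, Nat.cast_prod]
  exact Finset.prod_dvd_of_coprime (fun a _ b _ hab => p.isCoprime_q hab) fun i _ => h i

theorem eq_zero_of_four_mul_dvd {z : ℤ} (h : ((4 * k : ℕ) : ℤ) ∣ z) (hz : |z| < 4 * k) : z = 0 := by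
  refine Int.eq_zero_of_abs_lt_dvd h ?_
  push_cast; exact hz

/-- A closed set which separates the two strips has a location. -/
theorem Separates.exists_loc (h : Separates S U j₀ j₁) (hS : S.card ≤ k + p.c) :
    ∃ x, p.Loc S x := by
  have hf := h.closed.full h.free₀ h.free₁ h.ne
  have hck : (p.c : ℤ) + 1 ≤ k := by exact_mod_cast p.c_lt
  have hrow : ∀ {r e}, p.rowEdges S r = {e} → p.row e = some r := by
    intro r e he
    exact (Finset.mem_filter.1 (he ▸ Finset.mem_singleton_self e : e ∈ p.rowEdges S r)).2
  choose j hj e he using hf.exists_single hS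
  have hanchor := fun i => exists_anchor (hrow (he i))
  choose a ha using hanchor
  -- all anchors are close to `b` modulo `4 * k`
  set b : ℤ := ((a 0).val : ℤ)
  have hnear : ∀ {r e'} {a' : ZMod (p.per r)}, p.rowEdges S r = {e'} → p.Anchor r a' e' →
      ∃ δ y : ℤ, |δ| ≤ p.c ∧ (a'.val : ℤ) = b + δ + (4 * k : ℕ) * y := by
    intro r e' a' he' ha'
    obtain ⟨z, hz, y, hy⟩ := h.drift_base hS he' ha' (he 0) (ha 0)
    exact ⟨z, y, hz, by rw [← hy]; simp only [b]; ring⟩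
  choose δ y hδ hy using fun i => hnear (he i) (ha i)
  obtain ⟨Y, hY⟩ := p.exists_crt y
  -- the location is the common residue `b`, with the multiples of `4 * k` glued together
  refine ⟨b + (4 * k : ℕ) * Y, fun r e' a' he' ha' => ?_⟩
  obtain ⟨δ', y', hδ', hy'⟩ := hnear he' ha'
  refine ⟨-δ', by rwa [abs_neg], ?_⟩
  have hdvd : (p.per r : ℤ) ∣ (4 * k : ℕ) * (Y - y') := by
    refine per_dvd fun t ht => ?_
    set i := r + (t : ZMod k) with hi
    obtain ⟨z, hz, hd⟩ := h.drift_q hS i ht (hj i) (by rw [hi]; ring) rfl he' ha' (he i) (ha i)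
    rw [hy', hy i] at hd
    have e1 : b + δ' + ((4 * k : ℕ) : ℤ) * y' - (b + δ i + ((4 * k : ℕ) : ℤ) * y i) - z =
        (δ' - δ i - z) + ((4 * k : ℕ) : ℤ) * (y' - y i) := by ring
    rw [e1] at hd
    have h0 : δ' - δ i - z = 0 := by
      refine eq_zero_of_four_mul_dvd (k := k) ?_ ?_
      · refine (Int.dvd_add_left (Dvd.intro _ rfl)).1 (dvd_trans ?_ hd)
        push_cast
        exact Dvd.intro _ rfl
      · have := hδ i
        rw [abs_le] at this hδ' hz
        rw [abs_lt]
        constructor <;> linarith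
    rw [h0, zero_add, Nat.cast_mul] at hd
    have hk0 : ((4 * k : ℕ) : ℤ) ≠ 0 := by have := p.four_le; positivity
    have h1 := Int.dvd_of_mul_dvd_mul_left hk0 hd
    have h2 := hY i
    have : Y - y' = (Y - y i) - (y' - y i) := by ring
    rw [this]
    exact dvd_sub h2 h1
  have : a' = ((a'.val : ℤ) : ZMod (p.per r)) := by simp
  rw [this, ZMod.intCast_eq_intCast_iff_dvd_sub, hy', ← dvd_neg]
  exact int_dvd_of_eq hdvd (by ring)

/-- Two locations of a small set agree up to `2 * c` modulo the common period of all rows. -/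
theorem Full.loc_close (hf : p.Full S) (hS : S.card ≤ k + p.c) {x y : ℤ} (hx : p.Loc S x)
    (hy : p.Loc S y) :
    ∃ δ : ℤ, |δ| ≤ 2 * p.c ∧ ((4 * k * p.total : ℕ) : ℤ) ∣ x - y - δ := by
  have hck : (p.c : ℤ) + 1 ≤ k := by exact_mod_cast p.c_lt
  have hrow : ∀ {r e}, p.rowEdges S r = {e} → p.row e = some r := by
    intro r e he
    exact (Finset.mem_filter.1 (he ▸ Finset.mem_singleton_self e : e ∈ p.rowEdges S r)).2
  have key : ∀ i, ∃ δ : ℤ, |δ| ≤ 2 * p.c ∧ ((4 * k * p.q i : ℕ) : ℤ) ∣ x - y - δ := by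
    intro i
    obtain ⟨j, hj, e, he⟩ := hf.exists_single hS i
    obtain ⟨a, ha⟩ := exists_anchor (hrow he)
    obtain ⟨z, hz, h1⟩ := hx _ e a he ha
    obtain ⟨z', hz', h2⟩ := hy _ e a he ha
    refine ⟨z - z', ?_, ?_⟩
    · rw [abs_le] at *
      constructor <;> linarith
    · rw [← h2, eq_comm, ZMod.intCast_eq_intCast_iff_dvd_sub] at h1
      refine dvd_trans (Int.natCast_dvd_natCast.2 (p.mul_q_dvd_per i hj)) ?_
      exact int_dvd_of_eq h1 (by ring)
  choose δ hδ hd using key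
  have h4 : ∀ i, ((4 * k : ℕ) : ℤ) ∣ x - y - δ i := fun i =>
    dvd_trans (by push_cast; exact Dvd.intro _ rfl) (hd i)
  have hconst : ∀ i, δ i = δ 0 := by
    intro i
    refine sub_eq_zero.1 (eq_zero_of_four_mul_dvd (k := k) ?_ ?_)
    · exact int_dvd_of_eq (dvd_sub (h4 0) (h4 i)) (by ring)
    · have h1 := hδ i
      have h2 := hδ 0
      rw [abs_le] at h1 h2
      rw [abs_lt]
      constructor <;> linarith
  refine ⟨δ 0, hδ 0, ?_⟩
  obtain ⟨u, hu⟩ := h4 0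
  rw [hu, Nat.cast_mul]
  refine mul_dvd_mul_left _ (total_dvd fun i => ?_)
  have h1 := hd i
  rw [hconst i, hu, Nat.cast_mul] at h1
  exact Int.dvd_of_mul_dvd_mul_left (by have := p.four_le; positivity) h1

/-! ### The defender of the compressed cylinder -/

/-- No location of `S` is within distance `2 * c * t` of the strip on side `s`. -/
def Safe (p : CylParams k) (t : ℕ) (s : Bool) (S : Finset p.Edge) : Prop :=
  p.Full S → ∀ x, p.Loc S x → ∀ z : ℤ, |z| ≤ 2 * p.c * t →
    ¬ ((4 * k * p.total : ℕ) : ℤ) ∣ x - p.pos s - z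

/-- The invariant of the defender: all consequences of the system for the values of `α` on `S` hold
except that the charge has been moved to a free column of a strip which is far from all locations
of `S`. -/
def Defend (p : CylParams k) (t : ℕ) (S : Finset p.Edge) (α : p.Edge → Bool) : Prop :=
  4 * t ≤ p.total ∧ ∃ s j, p.FreeCol S s j ∧ p.Safe t s S ∧ ∀ U, p.Closed S U →
    ∑ e, p.bd U e * bit (α e) = U (.strip false 0 inner) + U (.strip s 0 j)

theorem Safe.mono {t : ℕ} {s : Bool} (h : p.Safe t s T) (hS : S ⊆ T) : p.Safe t s S :=
  fun hf x hx => h (hf.mono hS) x (hx.mono hS hf)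

theorem Safe.weaken {t : ℕ} {s : Bool} (h : p.Safe (t + 1) s S) : p.Safe t s S := by
  intro hf x hx z hz
  refine h hf x hx z (hz.trans ?_)
  push_cast
  nlinarith [Int.natCast_nonneg p.c]

/-- The strips are so far apart that one of them is far from all locations. -/
theorem exists_safe {t : ℕ} (hS : S.card ≤ k + p.c) (ht : 4 * (t + 1) ≤ p.total) :
    ∃ s, p.Safe t s S := by
  by_contra! hcon
  have h0 := hcon false
  have h1 := hcon true
  simp only [Safe, not_forall, not_not] at h0 h1
  obtain ⟨hf, x, hx, z, hz, hd⟩ := h0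
  obtain ⟨-, x', hx', z', hz', hd'⟩ := h1
  obtain ⟨δ, hδ, hd''⟩ := hf.loc_close hS hx hx'
  have h2 := dvd_sub (dvd_sub hd hd') hd''
  simp only [pos, if_true, Bool.false_eq_true, if_false] at h2
  have h3 : x - ((0 : ℕ) : ℤ) - z - (x' - ((2 * k * p.total : ℕ) : ℤ) - z') - (x - x' - δ) =
      (2 * k * p.total : ℕ) - (z - z' - δ) := by push_cast; ring
  rw [h3] at h2
  have hck : (p.c : ℤ) + 1 ≤ k := by exact_mod_cast p.c_lt
  have ht' : 4 * ((t : ℤ) + 1) ≤ p.total := by exact_mod_cast ht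
  have hc0 : (0 : ℤ) ≤ p.c := Int.natCast_nonneg _
  have hsmall : |z - z' - δ| < 2 * k * p.total := by
    have h4 : |z - z' - δ| ≤ 2 * p.c * t + 2 * p.c * t + 2 * p.c := by
      rw [abs_le] at *
      constructor <;> linarith
    have h5 : (p.c : ℤ) * (4 * (t + 1)) ≤ p.c * p.total := mul_le_mul_of_nonneg_left ht' hc0
    have h6 : ((p.c : ℤ) + 1) * p.total ≤ k * p.total :=
      mul_le_mul_of_nonneg_right hck (Int.natCast_nonneg _)
    have h7 : (0 : ℤ) < p.total := by have := Int.natCast_nonneg t; linarith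
    have h8 : (0 : ℤ) ≤ k * p.total := by positivity
    nlinarith
  rw [abs_lt] at hsmall
  obtain ⟨u, hu⟩ := h2
  push_cast at hu
  have h9 : 0 < (4 * (k : ℤ) * p.total) * u := by rw [← hu]; linarith
  have h10 : (4 * (k : ℤ) * p.total) * u < 4 * k * p.total := by rw [← hu]; linarith
  have h11 : (0 : ℤ) ≤ 4 * (k : ℤ) * p.total := by positivity
  rcases le_or_gt u 0 with hu0 | hu0
  · nlinarith
  · nlinarith

/-- The charge can be moved from a safe free column for `S` to a safe free column for `T ⊇ S`. -/
theorem Safe.move {t : ℕ} {s : Bool} {j : Fin (2 * k)} (h : p.Safe (t + 1) s S)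
    (hj : p.FreeCol S s j) (hST : S ⊆ T) (hT : T.card ≤ k + p.c)
    (ht : 4 * (t + 1) ≤ p.total) :
    ∃ s' j', p.FreeCol T s' j' ∧ p.Safe t s' T ∧
      ∀ U, p.Closed S U → U (.strip s 0 j) = U (.strip s' 0 j') := by
  have hS : S.card ≤ k + p.c := (Finset.card_le_card hST).trans hT
  have hT2 : T.card < 2 * k := by have := p.c_lt; omega
  by_cases hsep : ∃ U, p.Closed S U ∧ ∃ s₁ j₁ s₂ j₂, p.FreeCol S s₁ j₁ ∧ p.FreeCol S s₂ j₂ ∧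
      U (.strip s₁ 0 j₁) ≠ U (.strip s₂ 0 j₂)
  -- if `S` has a location, then it is far from the strip `s`, and the charge can stay on this strip
  · obtain ⟨U, hU, s₁, j₁, s₂, j₂, h₁, h₂, hne⟩ := hsep
    have hf := hU.full h₁ h₂ hne
    obtain ⟨y, hy⟩ : ∃ y, p.Loc S y := by
      cases s₁ <;> cases s₂
      · exact ⟨_, hU.loc_pos h₁ h₂ hne⟩
      · exact Separates.exists_loc ⟨hU, h₁, h₂, hne⟩ hS
      · exact Separates.exists_loc ⟨hU, h₂, h₁, hne.symm⟩ hS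
      · exact ⟨_, hU.loc_pos h₁ h₂ hne⟩
    obtain ⟨j', hj'⟩ := exists_freeCol hT2 s
    refine ⟨s, j', hj', ?_, ?_⟩
    · intro hfT x hx z hz hd
      obtain ⟨δ, hδ, hd'⟩ := hfT.loc_close hT hx (hy.mono hST hf)
      refine h hf y hy (z - δ) ?_ ?_
      · push_cast
        rw [abs_le] at *
        constructor <;> linarith
      · exact int_dvd_of_eq (dvd_sub hd hd') (by ring)
    · intro U' hU'
      by_contra hne'
      have hloc := hU'.loc_pos hj (hj'.mono hST) hne'
      exact h hf _ hloc 0 (by simp) (by simp)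
  -- otherwise no consequence for `S` distinguishes between the free columns
  · push Not at hsep
    obtain ⟨s', hs'⟩ := exists_safe hT ht
    obtain ⟨j', hj'⟩ := exists_freeCol hT2 s'
    exact ⟨s', j', hj', hs', fun U hU => hsep U hU _ _ _ _ hj (hj'.mono hST)⟩

theorem exists_bit (a : ZMod 2) : ∃ b, bit b = a := by
  rcases zmod_two_cases a with rfl | rfl
  · exact ⟨false, rfl⟩
  · exact ⟨true, rfl⟩

/-- Values on `S` that satisfy prescribed consequences extend to one more variable. -/
theorem exists_extend (χ : (p.Vertex → ZMod 2) → ZMod 2) (hχ : ∀ U U', χ (U + U') = χ U + χ U')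
    {α : p.Edge → Bool} (hα : ∀ U, p.Closed S U → ∑ e, p.bd U e * bit (α e) = χ U) (x : p.Edge) :
    ∃ α' : p.Edge → Bool, (∀ e ∈ S, α' e = α e) ∧
      ∀ U, p.Closed (insert x S) U → ∑ e, p.bd U e * bit (α' e) = χ U := by
  by_cases hx : x ∈ S
  · exact ⟨α, fun _ _ => rfl, by rwa [Finset.insert_eq_of_mem hx]⟩
  have hclosed : ∀ U, p.Closed (insert x S) U → p.bd U x = 0 → p.Closed S U := by
    intro U hU h0 e he
    rcases Finset.mem_insert.1 (hU e he) with rfl | h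
    · exact absurd h0 he
    · exact h
  have hupd : ∀ (b : Bool), ∀ e ∈ S, Function.update α x b e = α e := by
    intro b e he
    exact Function.update_of_ne (fun h => hx (by rw [← h]; exact he)) _ _
  have hsum : ∀ (b : Bool) U, ∑ e, p.bd U e * bit (Function.update α x b e) =
      p.bd U x * bit b + ∑ e ∈ Finset.univ.erase x, p.bd U e * bit (α e) := by
    intro b U
    rw [← Finset.add_sum_erase _ _ (Finset.mem_univ x), Function.update_self]
    congr 1
    refine Finset.sum_congr rfl fun e he => ?_
    rw [Function.update_of_ne (Finset.ne_of_mem_erase he)]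
  have hsumα : ∀ U, ∑ e, p.bd U e * bit (α e) =
      p.bd U x * bit (α x) + ∑ e ∈ Finset.univ.erase x, p.bd U e * bit (α e) := by
    intro U
    rw [← Finset.add_sum_erase _ _ (Finset.mem_univ x)]
  by_cases hex : ∃ U₀, p.Closed (insert x S) U₀ ∧ p.bd U₀ x = 1
  · obtain ⟨U₀, hU₀, hx₀⟩ := hex
    obtain ⟨b, hb⟩ := exists_bit (χ U₀ + ∑ e ∈ Finset.univ.erase x, p.bd U₀ e * bit (α e))
    refine ⟨Function.update α x b, hupd b, fun U hU => ?_⟩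
    have h₀ : ∑ e, p.bd U₀ e * bit (Function.update α x b e) = χ U₀ := by
      rw [hsum, hx₀, hb, one_mul, add_assoc, CharTwo.add_self_eq_zero, add_zero]
    rcases zmod_two_cases (p.bd U x) with h0 | h1
    · rw [← hα U (hclosed U hU h0), hsum, hsumα, h0, zero_mul, zero_mul]
    · have hU' : p.Closed S (U + U₀) := by
        refine hclosed _ (fun e he => ?_) (by rw [bd_add, h1, hx₀]; decide)
        rw [bd_add] at he
        by_cases h : p.bd U e = 0
        · exact hU₀ e (by simpa [h] using he)
        · exact hU e h
      have h2 := hα _ hU'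
      have h3 : ∑ e, p.bd (U + U₀) e * bit (α e) =
          ∑ e, p.bd (U + U₀) e * bit (Function.update α x b e) := by
        have : p.bd (U + U₀) x = 0 := by rw [bd_add, h1, hx₀]; decide
        rw [hsum, hsumα, this, zero_mul, zero_mul]
      rw [h3, hχ] at h2
      simp only [bd_add, add_mul, Finset.sum_add_distrib] at h2
      rw [h₀] at h2
      exact add_right_cancel h2
  · refine ⟨α, fun _ _ => rfl, fun U hU => hα U (hclosed U hU ?_)⟩
    rcases zmod_two_cases (p.bd U x) with h0 | h1
    · exact h0
    · exact absurd ⟨U, hU, h1⟩ hex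

/-- A query moves the charge to a safe free column and then extends the values. No equation is
violated, because the only one that is treated wrongly has a vertical edge in a free column. -/
theorem defend_isStrategy (p : CylParams k) : DefenderStrategy p.system (k + p.c) p.Defend where
  mono := by
    rintro t S T α ⟨ht, s, j, hj, hs, hα⟩ hS
    exact ⟨ht, s, j, hj.mono hS, hs.mono hS, fun U hU => hα U (hU.mono hS)⟩
  weaken := by
    rintro t S α ⟨ht, s, j, hj, hs, hα⟩
    exact ⟨by omega, s, j, hj, hs.weaken, hα⟩
  query := by
    rintro t S α ⟨ht, s, j, hj, hs, hα⟩ hS x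
    have hT : (insert x S).card ≤ k + p.c := (Finset.card_insert_le _ _).trans hS
    obtain ⟨s', j', hj', hs', hmove⟩ := hs.move hj (Finset.subset_insert x S) hT ht
    obtain ⟨α', h1, h2⟩ := exists_extend
      (fun U => U (.strip false 0 inner) + U (.strip s' 0 j'))
      (by intro U U'; simp only [Pi.add_apply]; ring) (S := S) (α := α)
      (fun U hU => by rw [hα U hU, hmove U hU]) x
    exact ⟨α', h1, by omega, s', j', hj', hs', h2⟩
  sound := by
    classical
    rintro t S α v ⟨ht, s, j, hj, hs, hα⟩ hv
    have hne : v ≠ .strip s 0 j := by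
      rintro rfl
      refine hj 0 (hv ?_)
      simp [system, inc]
    have hcl : p.Closed S (Pi.single v 1) := by
      intro e he
      rw [bd_single] at he
      exact hv (by by_contra h; exact he (if_neg h))
    have := hα _ hcl
    simp only [bd_single, ite_mul, one_mul, zero_mul, ← Finset.sum_filter] at this
    simp only [Finset.filter_mem_eq_inter, Finset.univ_inter, Pi.single_apply, hne.symm, if_false,
      add_zero] at this
    refine Eq.trans ?_ (this.trans ?_)
    · rfl
    · simp only [system, eq_comm]

theorem defend_start (p : CylParams k) {t : ℕ} (ht : 4 * t ≤ p.total) (α : p.Edge → Bool) :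
    p.Defend t ∅ α := by
  refine ⟨ht, false, inner, fun _ => by simp, fun hf => ?_, fun U hU => ?_⟩
  · obtain ⟨e, he⟩ := hf 0
    simp [rowEdges] at he
  · have : ∀ e, p.bd U e = 0 := fun e => hU.bd_eq_zero (by simp)
    simp [this, CharTwo.add_self_eq_zero]

end CylParams
end Resolution

namespace Resolution

/-! ### Sweeping over the cylinder -/

section Column
variable {E V : Type} [Fintype E] [DecidableEq E] [Fintype V] {m : ℕ}
variable {P : ParitySystem E V} {enc : E × GadgetVar m ↪ ℕ} {k : ℕ}

theorem lsupp_add_subset (f g : E → ZMod 2) : lsupp (f + g) ⊆ lsupp f ∪ lsupp g := by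
  intro e he
  simp only [lsupp, Finset.mem_union, Finset.mem_filter, Finset.mem_univ, true_and,
    Pi.add_apply] at *
  by_contra h
  push Not at h
  simp [h.1, h.2] at he

theorem lsupp_sum_subset {ι : Type*} (s : Finset ι) (f : ι → E → ZMod 2) :
    lsupp (∑ i ∈ s, f i) ⊆ s.biUnion fun i => lsupp (f i) := by
  classical
  induction s using Finset.induction_on with
  | empty => intro e he; simp [lsupp] at he
  | insert a s ha ih =>
    rw [Finset.sum_insert ha, Finset.biUnion_insert]
    exact (lsupp_add_subset _ _).trans (Finset.union_subset_union le_rfl ih)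

theorem lsupp_single (e : E) : lsupp (Pi.single e 1 : E → ZMod 2) = {e} := by
  ext x
  simp [lsupp, Pi.single_apply]

theorem sum_range_natCast [NeZero k] {M : Type*} [AddCommMonoid M] (f : ZMod k → M) :
    ∑ j ∈ Finset.range k, f (j : ℕ) = ∑ r, f r := by
  refine Finset.sum_nbij (fun j : ℕ => (j : ZMod k)) (by simp) (CylParams.natCast_injOn_range le_rfl)
    (fun r _ => ⟨r.val, by simpa using ZMod.val_lt r, by simp⟩) (fun _ _ => rfl)

/-- Moving a cut over one column of vertices `Q r`. The horizontal edges of the column are given by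
the linear forms `X r` on one side and `Y r` on the other, its vertical edges are the `A r`. Row by
row, the cut has at most `k + 2` edges. -/
theorem Ext.covEq_column [NeZero k] (hm : 1 ≤ m) {l : List Clause} (hl : Deriv (liftCNF P enc) l)
    (hcard : ∀ v, (P.inc v).card ≤ 4) (Q : ZMod k → V) (X Y : ZMod k → E → ZMod 2)
    (A : ZMod k → E) (hinc : ∀ r e, (if e ∈ P.inc (Q r) then (1 : ZMod 2) else 0) =
      (X r + Y r + Pi.single (A r) 1 + Pi.single (A (r - 1)) 1 : E → ZMod 2) e)
    (hX : ∀ r, (lsupp (X r)).card ≤ 1) (hY : ∀ r, (lsupp (Y r)).card ≤ 1) {b b' : ZMod 2}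
    (hb : b' = b + ∑ r, P.charge (Q r))
    (h : CovEq enc l (lsupp (∑ r, X r)) (∑ r, X r) b) :
    Ext (liftCNF P enc) (k * (30 * (2 * m) ^ (k + 3) * m)) l
      (fun l' => CovEq enc l' (lsupp (∑ r, Y r)) (∑ r, Y r) b') := by
  -- `f n` is the cut when `n` rows have been treated
  let g : ZMod k → E → ZMod 2 := fun r =>
    X r + Y r + Pi.single (A r) 1 + Pi.single (A (r - 1)) 1
  let f : ℕ → E → ZMod 2 := fun n => ∑ r, X r + ∑ j ∈ Finset.range n, g (j : ℕ)
  have htwo : ∀ u : E → ZMod 2, u + u = 0 := fun u => by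
    ext e; exact CharTwo.add_self_eq_zero _
  have hf : ∀ n ≤ k, f n = ∑ j ∈ Finset.range n, Y (j : ℕ) + ∑ j ∈ Finset.Ico n k, X (j : ℕ) +
      Pi.single (A ((n : ℕ) - 1)) 1 + Pi.single (A (-1)) 1 := by
    intro n
    induction n with
    | zero =>
      intro _
      simp only [f, Finset.range_zero, Finset.sum_empty, add_zero, zero_add, Nat.cast_zero,
        zero_sub]
      rw [add_assoc, htwo, add_zero, Nat.Ico_zero_eq_range, sum_range_natCast]
    | succ n ih =>
      intro hn
      have h1 : f (n + 1) = f n + g (n : ℕ) := by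
        simp only [f, Finset.sum_range_succ, add_assoc]
      rw [h1, ih (by omega), Finset.sum_range_succ, Finset.sum_eq_sum_Ico_succ_bot (by omega)]
      have h2 : (((n + 1 : ℕ) : ZMod k) - 1) = (n : ℕ) := by push_cast; ring
      rw [h2]
      simp only [g]
      generalize ∑ j ∈ Finset.range n, Y (j : ℕ) = a1
      generalize ∑ j ∈ Finset.Ico (n + 1) k, X (j : ℕ) = a2
      generalize (Pi.single (A ((n : ZMod k) - 1)) 1 : E → ZMod 2) = a3
      generalize (Pi.single (A (-1)) 1 : E → ZMod 2) = a4
      generalize (Pi.single (A (n : ZMod k)) 1 : E → ZMod 2) = a5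
      have h3 := htwo a3
      have h4 := htwo (X (n : ℕ))
      calc _ = a1 + Y (n : ℕ) + a2 + a5 + a4 + (a3 + a3) + (X (n : ℕ) + X (n : ℕ)) := by abel
        _ = _ := by rw [h3, h4, add_zero, add_zero]
  have hbound : ∀ n < k, (lsupp (f n) ∪ lsupp (g (n : ℕ))).card ≤ k + 3 + 1 := by
    intro n hn
    rw [hf n hn.le]
    let B : Finset E := (Finset.range (n + 1)).biUnion (fun j : ℕ => lsupp (Y (j : ZMod k))) ∪
      (Finset.Ico n k).biUnion (fun j : ℕ => lsupp (X (j : ZMod k))) ∪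
      {A ((n : ℕ) - 1), A (-1), A (n : ℕ)}
    have hsub : lsupp (∑ j ∈ Finset.range n, Y (j : ℕ) + ∑ j ∈ Finset.Ico n k, X (j : ℕ) +
        Pi.single (A ((n : ℕ) - 1)) 1 + Pi.single (A (-1)) 1) ∪ lsupp (g (n : ℕ)) ⊆ B := by
      intro e he
      rcases Finset.mem_union.1 he with he | he
      · rcases Finset.mem_union.1 (lsupp_add_subset _ _ he) with he | he
        · rcases Finset.mem_union.1 (lsupp_add_subset _ _ he) with he | he
          · rcases Finset.mem_union.1 (lsupp_add_subset _ _ he) with he | he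
            · obtain ⟨j, hj, he⟩ := Finset.mem_biUnion.1 (lsupp_sum_subset _ _ he)
              refine Finset.mem_union_left _ (Finset.mem_union_left _ (Finset.mem_biUnion.2
                ⟨j, ?_, he⟩))
              rw [Finset.mem_range] at *; omega
            · exact Finset.mem_union_left _ (Finset.mem_union_right _ (lsupp_sum_subset _ _ he))
          · rw [lsupp_single, Finset.mem_singleton] at he
            exact Finset.mem_union_right _ (by simp [he])
        · rw [lsupp_single, Finset.mem_singleton] at he
          exact Finset.mem_union_right _ (by simp [he])
      · rcases Finset.mem_union.1 (lsupp_add_subset _ _ he) with he | he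
        · rcases Finset.mem_union.1 (lsupp_add_subset _ _ he) with he | he
          · rcases Finset.mem_union.1 (lsupp_add_subset _ _ he) with he | he
            · exact Finset.mem_union_left _ (Finset.mem_union_right _ (Finset.mem_biUnion.2
                ⟨n, by simp [hn], he⟩))
            · exact Finset.mem_union_left _ (Finset.mem_union_left _ (Finset.mem_biUnion.2
                ⟨n, by simp, he⟩))
          · rw [lsupp_single, Finset.mem_singleton] at he
            exact Finset.mem_union_right _ (by simp [he])
        · rw [lsupp_single, Finset.mem_singleton] at he
          exact Finset.mem_union_right _ (by simp [he])
    refine (Finset.card_le_card hsub).trans ?_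
    have h1 : ((Finset.range (n + 1)).biUnion (fun j : ℕ => lsupp (Y (j : ZMod k)))).card ≤ n + 1 := by
      refine (Finset.card_biUnion_le_card_mul _ _ 1 fun j _ => hY _).trans ?_
      simp
    have h2 : ((Finset.Ico n k).biUnion (fun j : ℕ => lsupp (X (j : ZMod k)))).card ≤ k - n := by
      refine (Finset.card_biUnion_le_card_mul _ _ 1 fun j _ => hX _).trans ?_
      simp
    have h3 : ({A ((n : ZMod k) - 1), A (-1), A (n : ZMod k)} : Finset E).card ≤ 3 :=
      Finset.card_le_three
    have h4 : B.card ≤ _ := Finset.card_union_le _ _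
    have h5 := Finset.card_union_le ((Finset.range (n + 1)).biUnion
      (fun j : ℕ => lsupp (Y (j : ZMod k)))) ((Finset.Ico n k).biUnion
      (fun j : ℕ => lsupp (X (j : ZMod k))))
    omega
  have main : ∀ n ≤ k, Ext (liftCNF P enc) (n * (30 * (2 * m) ^ (k + 3) * m)) l
      (fun l' => CovEq enc l' (lsupp (f n)) (f n)
        (b + ∑ j ∈ Finset.range n, P.charge (Q (j : ℕ)))) := by
    intro n
    induction n with
    | zero => intro _; exact .of_deriv hl (by simpa [f] using h) _
    | succ n ih =>
      intro hn
      refine Ext.mono ((ih (by omega)).bind fun l' hd _ h' =>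
        Ext.covEq_add hm hd (g := g (n : ℕ)) (v := Q (n : ℕ)) (w := k + 3) (by omega)
          (fun e => (hinc _ e).symm) (hcard _) (hbound n (by omega)) h')
        (le_of_eq (Nat.succ_mul n _).symm) ?_
      intro l' _ _ h'
      have h1 : f (n + 1) = f n + g (n : ℕ) := by
        simp only [f, Finset.sum_range_succ, add_assoc]
      rw [add_assoc b] at h'
      rw [h1, Finset.sum_range_succ]
      exact h'
  refine (main k le_rfl).mono le_rfl fun l' _ _ h' => ?_
  rw [hf k le_rfl, Finset.Ico_self, Finset.sum_empty, add_zero, CharP.cast_eq_zero, zero_sub,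
    add_assoc, htwo, add_zero, sum_range_natCast, sum_range_natCast (fun r => P.charge (Q r)),
    ← hb] at h'
  exact h'

end Column

namespace CylParams
variable {k : ℕ} [NeZero k] (p : CylParams k)

theorem inc_card_le (v : p.Vertex) : (p.inc v).card ≤ 4 := by
  cases v with
  | ring r a => exact Finset.card_le_four
  | strip s r j =>
    refine (Finset.card_union_le _ _).trans ?_
    have h1 : ({p.inEdge s r j, .vs s r j, .vs s (r - 1) j} : Finset p.Edge).card ≤ 3 :=
      Finset.card_le_three
    have h2 : (if j.val + 1 < 2 * k then {Edge.hs s r j} else ∅ : Finset p.Edge).card ≤ 1 := by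
      split_ifs <;> simp
    convert Nat.add_le_add h1 h2

/-- The edge of the vertex `strip s r j` away from the ring, as a linear form. -/
noncomputable def outForm (s : Bool) (r : ZMod k) (j : Fin (2 * k)) : p.Edge → ZMod 2 :=
  if j.val + 1 < 2 * k then Pi.single (.hs s r j) 1 else 0

theorem lsupp_outForm (s : Bool) (r : ZMod k) (j : Fin (2 * k)) :
    (lsupp (p.outForm s r j)).card ≤ 1 := by
  rw [outForm]
  split_ifs
  · simp [lsupp_single]
  · simp [lsupp]

theorem ite_mem_four {E : Type} [DecidableEq E] {a b c d : E} (hab : a ≠ b) (hac : a ≠ c)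
    (had : a ≠ d) (hbc : b ≠ c) (hbd : b ≠ d) (hcd : c ≠ d) (e : E) :
    (if e = a ∨ e = b ∨ e = c ∨ e = d then (1 : ZMod 2) else 0) =
      (Pi.single a 1 + Pi.single b 1 + Pi.single c 1 + Pi.single d 1 : E → ZMod 2) e := by
  simp only [Pi.add_apply, Pi.single_apply]
  by_cases h1 : e = a
  · subst h1; simp [hab, hac, had]
  by_cases h2 : e = b
  · subst h2; simp [h1, hbc, hbd]
  by_cases h3 : e = c
  · subst h3; simp [h1, h2, hcd]
  simp [h1, h2, h3]

theorem row_ne_pred (p : CylParams k) (r : ZMod k) : r ≠ r - 1 := by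
  have h1 := p.one_ne_zero_row
  simpa [eq_sub_iff_add_eq] using h1

theorem ind_inc_strip (s : Bool) (r : ZMod k) (j : Fin (2 * k)) (e : p.Edge) :
    (if e ∈ p.inc (.strip s r j) then (1 : ZMod 2) else 0) =
      (p.outForm s r j + Pi.single (p.inEdge s r j) 1 + Pi.single (.vs s r j) 1 +
        Pi.single (.vs s (r - 1) j) 1 : p.Edge → ZMod 2) e := by
  have hr := p.row_ne_pred r
  have h1 : ∀ r', p.inEdge s r j ≠ .vs s r' j := by
    intro r'; rw [inEdge]; split_ifs <;> simp
  have h2 : (Edge.hs s r j) ≠ p.inEdge s r j := by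
    rw [inEdge]
    split_ifs with h
    · simp
    · simp [Fin.ext_iff]; omega
  rw [outForm]
  split_ifs with h3 h4 h4
  · rw [← ite_mem_four h2 (by simp) (by simp) (h1 _) (h1 _) (by simpa using hr), if_pos]
    simp only [inc, if_pos h4, Finset.mem_union, Finset.mem_insert, Finset.mem_singleton] at h3
    tauto
  · simp only [inc, if_neg h4, Finset.mem_union, Finset.mem_insert, Finset.mem_singleton,
      Finset.notMem_empty, or_false] at h3
    rcases h3 with rfl | rfl | rfl
    · simp [h1]
    · simp [(h1 _).symm, hr]
    · simp [(h1 _).symm, hr.symm]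
  · rw [← ite_mem_four h2 (by simp) (by simp) (h1 _) (h1 _) (by simpa using hr), if_neg]
    simp only [inc, if_pos h4, Finset.mem_union, Finset.mem_insert, Finset.mem_singleton] at h3
    tauto
  · simp only [inc, if_neg h4, Finset.mem_union, Finset.mem_insert, Finset.mem_singleton,
      Finset.notMem_empty, or_false, not_or] at h3
    simp [h3]

theorem ind_inc_ring (r : ZMod k) (t : ℕ) (e : p.Edge) :
    (if e ∈ p.inc (.ring r ((t + 1 : ℕ) : ZMod (p.per r))) then (1 : ZMod 2) else 0) =
      (Pi.single (.h r (t : ℕ)) 1 + Pi.single (.h r ((t + 1 : ℕ) : ZMod (p.per r))) 1 +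
        Pi.single (.v r ((t + 1 : ℕ) : ZMod (p.vper r))) 1 +
        Pi.single (.v (r - 1) ((t + 1 : ℕ) : ZMod (p.vper (r - 1)))) 1 : p.Edge → ZMod 2) e := by
  have hr := p.row_ne_pred r
  have hd : p.vper (r - 1) ∣ p.per r := by
    have := p.vper_dvd_per_succ (r - 1)
    rwa [sub_add_cancel] at this
  have h1 := p.one_ne_zero_per r
  rw [← ite_mem_four (by simpa using h1) (by simp) (by simp) (by simp) (by simp)
    (by simp [hr])]
  congr 1
  simp only [inc, ZMod.cast_natCast hd, ZMod.cast_natCast (p.vper_dvd_per r), Finset.mem_insert,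
    Finset.mem_singleton]
  have : (((t + 1 : ℕ) : ZMod (p.per r)) - 1) = (t : ℕ) := by push_cast; ring
  rw [this]

variable {m : ℕ} {enc : p.Edge × GadgetVar m ↪ ℕ}

/-- The cost of moving a cut over one column: `k` additions of equations. -/
def columnCost (k m : ℕ) : ℕ := k * (30 * (2 * m) ^ (k + 3) * m)

theorem inEdge_succ (s : Bool) (r : ZMod k) (n : ℕ) (hn : n + 1 < 2 * k) :
    (Pi.single (p.inEdge s r ⟨n + 1, hn⟩) 1 : p.Edge → ZMod 2) =
      p.outForm s r ⟨n, by omega⟩ := by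
  simp [inEdge, outForm, hn]

theorem sum_charge_strip (s : Bool) (j : Fin (2 * k)) :
    ∑ r, p.system.charge (.strip s r j) = if s = false ∧ j = inner then 1 else 0 := by
  simp only [system, Vertex.strip.injEq]
  by_cases hs : s = false <;> by_cases hj : j = inner <;> simp [hs, hj]

/-- The sweep over the whole cylinder derives the inconsistent equation `0 = 1`. -/
theorem exists_sweep (hm : 1 ≤ m) :
    Ext (liftCNF p.system enc) ((4 * k + 2 * k * p.total) * columnCost k m) []
      (fun l => Cov l ∅) := by
  have hk := NeZero.pos k
  have hcard : ∀ v, (p.system.inc v).card ≤ 4 := p.inc_card_le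
  -- the strip that contains the charge, from its far end towards the ring
  have s1 : ∀ n (hn : n < 2 * k), Ext (liftCNF p.system enc) (n * columnCost k m) []
      (fun l => CovEq enc l (lsupp (∑ r, p.outForm false r ⟨2 * k - 1 - n, by omega⟩))
        (∑ r, p.outForm false r ⟨2 * k - 1 - n, by omega⟩) 0) := by
    intro n
    induction n with
    | zero =>
      intro hn
      refine .of_deriv .nil ?_ _
      have : ∀ r, p.outForm false r ⟨2 * k - 1 - 0, by omega⟩ = 0 := by
        intro r; rw [outForm, if_neg]; simp; omega
      simp only [this]
      intro β hβ
      simp at hβ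
    | succ n ih =>
      intro hn
      refine Ext.mono ((ih (by omega)).bind fun l' hd _ h' =>
        Ext.covEq_column hm hd hcard (fun r => .strip false r ⟨2 * k - 1 - n, by omega⟩)
          (fun r => p.outForm false r ⟨2 * k - 1 - n, by omega⟩)
          (fun r => Pi.single (p.inEdge false r ⟨2 * k - 1 - n, by omega⟩) 1)
          (fun r => .vs false r ⟨2 * k - 1 - n, by omega⟩)
          (fun r e => p.ind_inc_strip false r _ e) (fun r => p.lsupp_outForm _ _ _)
          (fun r => by simp [lsupp_single]) rfl h')
        (le_of_eq (Nat.succ_mul n _).symm) ?_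
      intro l' _ _ h'
      have h1 : ∀ r, (Pi.single (p.inEdge false r ⟨2 * k - 1 - n, by omega⟩) 1 :
          p.Edge → ZMod 2) = p.outForm false r ⟨2 * k - 1 - (n + 1), by omega⟩ := by
        intro r
        rw [← p.inEdge_succ false r (2 * k - 1 - (n + 1)) (by omega)]
        congr 3
        omega
      rw [p.sum_charge_strip, if_neg (by simp [inner]; omega), add_zero] at h'
      simpa only [h1] using h'
  -- the last column of that strip contains the charge
  have s2 : Ext (liftCNF p.system enc) (2 * k * columnCost k m) []
      (fun l => CovEq enc l (lsupp (∑ r, Pi.single (.h r ((0 : ℕ) : ZMod (p.per r))) 1))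
        (∑ r, Pi.single (.h r ((0 : ℕ) : ZMod (p.per r))) 1) 1) := by
    refine Ext.mono ((s1 (2 * k - 1) (by omega)).bind fun l' hd _ h' =>
      Ext.covEq_column hm hd hcard (fun r => .strip false r ⟨2 * k - 1 - (2 * k - 1), by omega⟩)
        (fun r => p.outForm false r ⟨2 * k - 1 - (2 * k - 1), by omega⟩)
        (fun r => Pi.single (p.inEdge false r ⟨2 * k - 1 - (2 * k - 1), by omega⟩) 1)
        (fun r => .vs false r ⟨2 * k - 1 - (2 * k - 1), by omega⟩)
        (fun r e => p.ind_inc_strip false r _ e) (fun r => p.lsupp_outForm _ _ _)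
        (fun r => by simp [lsupp_single]) rfl h') ?_ ?_
    · rw [← columnCost, ← Nat.succ_mul]
      exact Nat.mul_le_mul_right _ (by omega)
    · intro l' _ _ h'
      rw [p.sum_charge_strip, if_pos (by simp [inner]), zero_add] at h'
      have h1 : ∀ r, p.inEdge false r ⟨2 * k - 1 - (2 * k - 1), by omega⟩ =
          .h r ((0 : ℕ) : ZMod (p.per r)) := by
        intro r; simp [inEdge, pos]
      simpa only [h1] using h'
  -- the unfolded ring, up to the column of the other strip
  have s3 : ∀ t, Ext (liftCNF p.system enc) ((2 * k + t) * columnCost k m) []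
      (fun l => CovEq enc l (lsupp (∑ r, Pi.single (.h r ((t : ℕ) : ZMod (p.per r))) 1))
        (∑ r, Pi.single (.h r ((t : ℕ) : ZMod (p.per r))) 1) 1) := by
    intro t
    induction t with
    | zero => exact s2
    | succ t ih =>
      refine Ext.mono (ih.bind fun l' hd _ h' =>
        Ext.covEq_column hm hd hcard (fun r => .ring r ((t + 1 : ℕ) : ZMod (p.per r)))
          (fun r => Pi.single (.h r ((t : ℕ) : ZMod (p.per r))) 1)
          (fun r => Pi.single (.h r ((t + 1 : ℕ) : ZMod (p.per r))) 1)
          (fun r => .v r ((t + 1 : ℕ) : ZMod (p.vper r)))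
          (fun r e => p.ind_inc_ring r t e) (fun r => by simp [lsupp_single])
          (fun r => by simp [lsupp_single]) (b' := 1) (by simp [system]) h')
        (le_of_eq (Nat.succ_mul _ _).symm) fun _ _ _ h' => h'
  -- the other strip, from the ring to its far end, where no edges remain
  have s4 : ∀ n (hn : n < 2 * k), Ext (liftCNF p.system enc)
      ((2 * k + 2 * k * p.total + n) * columnCost k m) []
      (fun l => CovEq enc l (lsupp (∑ r, Pi.single (p.inEdge true r ⟨n, hn⟩) 1))
        (∑ r, Pi.single (p.inEdge true r ⟨n, hn⟩) 1) 1) := by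
    intro n
    induction n with
    | zero =>
      intro hn
      refine (s3 (2 * k * p.total)).mono le_rfl fun l' _ _ h' => ?_
      have h1 : ∀ r, p.inEdge true r ⟨0, hn⟩ = .h r ((2 * k * p.total : ℕ) : ZMod (p.per r)) := by
        intro r; simp [inEdge, pos]
      simpa only [h1] using h'
    | succ n ih =>
      intro hn
      refine Ext.mono ((ih (by omega)).bind fun l' hd _ h' =>
        Ext.covEq_column hm hd hcard (fun r => .strip true r ⟨n, by omega⟩)
          (fun r => Pi.single (p.inEdge true r ⟨n, by omega⟩) 1)
          (fun r => p.outForm true r ⟨n, by omega⟩)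
          (fun r => .vs true r ⟨n, by omega⟩)
          (fun r e => (p.ind_inc_strip true r _ e).trans (by
            rw [add_comm (p.outForm true r ⟨n, by omega⟩)])) (fun r => by simp [lsupp_single])
          (fun r => p.lsupp_outForm _ _ _) rfl h')
        (le_of_eq (Nat.succ_mul _ _).symm) ?_
      intro l' _ _ h'
      rw [p.sum_charge_strip, if_neg (by simp), add_zero] at h'
      simpa only [p.inEdge_succ] using h'
  have s5 : Ext (liftCNF p.system enc) ((4 * k + 2 * k * p.total) * columnCost k m) []
      (fun l => CovEq enc l (lsupp (∑ r, p.outForm true r ⟨2 * k - 1, by omega⟩))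
        (∑ r, p.outForm true r ⟨2 * k - 1, by omega⟩) 1) := by
    refine Ext.mono ((s4 (2 * k - 1) (by omega)).bind fun l' hd _ h' =>
      Ext.covEq_column hm hd hcard (fun r => .strip true r ⟨2 * k - 1, by omega⟩)
        (fun r => Pi.single (p.inEdge true r ⟨2 * k - 1, by omega⟩) 1)
        (fun r => p.outForm true r ⟨2 * k - 1, by omega⟩)
        (fun r => .vs true r ⟨2 * k - 1, by omega⟩)
        (fun r e => (p.ind_inc_strip true r _ e).trans (by
          rw [add_comm (p.outForm true r ⟨2 * k - 1, by omega⟩)]))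
        (fun r => by simp [lsupp_single]) (fun r => p.lsupp_outForm _ _ _) rfl h') ?_ ?_
    · rw [← columnCost, ← Nat.succ_mul]
      exact Nat.mul_le_mul_right _ (by omega)
    · intro l' _ _ h'
      rw [p.sum_charge_strip, if_neg (by simp), add_zero] at h'
      exact h'
  refine s5.mono le_rfl fun l' _ _ h' => ?_
  have h0 : ∀ r, p.outForm true r ⟨2 * k - 1, by omega⟩ = 0 := by
    intro r; rw [outForm, if_neg]; simp; omega
  simp only [h0, Finset.sum_const_zero] at h'
  have := h' (fun _ => false) (by simp) (fun _ => ⟨0, hm⟩)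
  simpa [lsupp, liftSet] using this

theorem exists_refutation (hm : 1 ≤ m) : ∃ π : Refutation (liftCNF p.system enc),
    π.size ≤ (4 * k + 2 * k * p.total) * columnCost k m := by
  obtain ⟨l, hd, -, hlen, hc⟩ := p.exists_sweep (enc := enc) hm
  obtain ⟨π, hπ⟩ := hd.exists_refutation hc
  exact ⟨π, hπ.trans (by simpa using hlen)⟩

end CylParams
end Resolution

namespace Resolution

/-! ### The size of the formula -/

section LiftSize
variable {E V : Type} [Fintype E] [DecidableEq E] [Fintype V] {m : ℕ}
variable {P : ParitySystem E V} {enc : E × GadgetVar m ↪ ℕ}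

/-- Each base variable contributes a selector and a data bit. -/
theorem card_liftSet_le (S : Finset E) (β : E → Bool) (I : E → Fin m) :
    (liftSet enc S β I).card ≤ S.card * 2 :=
  Finset.card_biUnion_le_card_mul _ _ _ fun _ _ => Finset.card_le_two

theorem card_le_three_of_mem_gadgetSets {e : E} {L : Finset Literal}
    (h : L ∈ gadgetSets enc e) : L.card ≤ 3 := by
  rcases mem_gadgetSets.1 h with rfl | rfl | ⟨i, rfl⟩
  · simp
  · simp
  · exact Finset.card_le_three

theorem liftCNF_isKCNF (hcard : ∀ v, (P.inc v).card ≤ 4) : (liftCNF P enc).IsKCNF 8 := by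
  intro C hC
  rw [Clause.width]
  rcases mem_liftCNF.1 hC with ⟨v, β, I, -, h⟩ | ⟨e, h⟩
  · rw [h]
    have := card_liftSet_le (enc := enc) (P.inc v) β I
    have := hcard v
    omega
  · exact (card_le_three_of_mem_gadgetSets h).trans (by norm_num)

theorem card_vars_liftCNF_le : (liftCNF P enc).vars.card ≤ Fintype.card E * (3 * m + 1) := by
  have hsub : (liftCNF P enc).vars ⊆ Finset.univ.map enc := by
    intro x hx
    simp only [CNF.vars, Finset.mem_biUnion, Finset.mem_image] at hx
    obtain ⟨C, hC, l, hl, rfl⟩ := hx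
    rw [Finset.mem_map]
    rcases mem_liftCNF.1 hC with ⟨v, β, I, -, h⟩ | ⟨e, h⟩
    · rw [h, mem_liftSet] at hl
      obtain ⟨e, -, rfl | rfl⟩ := hl <;> exact ⟨_, Finset.mem_univ _, rfl⟩
    · rcases mem_gadgetSets.1 h with h | h | ⟨i, h⟩ <;> rw [h] at hl <;>
        simp only [Finset.mem_insert, Finset.mem_singleton] at hl
      · subst hl; exact ⟨_, Finset.mem_univ _, rfl⟩
      · subst hl; exact ⟨_, Finset.mem_univ _, rfl⟩
      · rcases hl with rfl | rfl | rfl <;> exact ⟨_, Finset.mem_univ _, rfl⟩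
  refine (Finset.card_le_card hsub).trans ?_
  rw [Finset.card_map, Finset.card_univ, Fintype.card_prod, GadgetVar.card]

theorem size_liftCNF_le (hm : 1 ≤ m) (hcard : ∀ v, (P.inc v).card ≤ 4) :
    (liftCNF P enc).size ≤
      Fintype.card V * (2 * m) ^ 4 * 8 + Fintype.card E * (m + 2) * 3 := by
  classical
  set A := Finset.univ.biUnion (equationSets P enc) with hA
  set B := Finset.univ.biUnion (gadgetSets enc) with hB
  have h1 : (liftCNF P enc).size ≤ ∑ L ∈ A ∪ B, L.card := by
    have : (liftCNF P enc).size = ∑ L ∈ (A ∪ B).filter _, L.card :=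
      Finset.sum_subtype_eq_sum_filter (s := A ∪ B) (fun L : Finset Literal => L.card)
    rw [this]
    exact Finset.sum_le_sum_of_subset (Finset.filter_subset _ _)
  have h2 : ∑ L ∈ A ∪ B, L.card ≤ ∑ L ∈ A, L.card + ∑ L ∈ B, L.card := by
    rw [← Finset.sum_union_inter]; exact Nat.le_add_right _ _
  have h3 : ∑ L ∈ A, L.card ≤ A.card * 8 := by
    refine Finset.sum_le_card_nsmul _ _ _ fun L hL => ?_
    simp only [hA, equationSets, Finset.mem_biUnion, Finset.mem_image] at hL
    obtain ⟨v, -, x, -, rfl⟩ := hL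
    have := card_liftSet_le (enc := enc) (P.inc v) x.1 x.2
    have := hcard v
    omega
  have h4 : ∑ L ∈ B, L.card ≤ B.card * 3 := by
    refine Finset.sum_le_card_nsmul _ _ _ fun L hL => ?_
    simp only [hB, Finset.mem_biUnion] at hL
    obtain ⟨e, -, hL⟩ := hL
    exact card_le_three_of_mem_gadgetSets hL
  have h5 : A.card ≤ Fintype.card V * (2 * m) ^ 4 := by
    refine Finset.card_biUnion_le_card_mul _ _ _ fun v _ => ?_
    refine (card_image_liftSet_le (enc := enc) (P.inc v) _).trans ?_
    exact Nat.pow_le_pow_right (by omega) (hcard v)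
  have h6 : B.card ≤ Fintype.card E * (m + 2) := by
    refine Finset.card_biUnion_le_card_mul _ _ _ fun e _ => ?_
    refine (Finset.card_union_le _ _).trans ?_
    have h7 := (Finset.card_image_le (s := (Finset.univ : Finset (Fin m)))
      (f := fun i => ({(enc (e, .chain i.castSucc), true), (enc (e, .sel i), true),
        (enc (e, .chain i.succ), false)} : Finset Literal)))
    rw [Finset.card_univ, Fintype.card_fin] at h7
    have h8 : ({{(enc (e, .chain 0), false)}, {(enc (e, .chain (Fin.last m)), true)}} :
      Finset (Finset Literal)).card ≤ 2 := Finset.card_le_two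
    omega
  have h7 := Nat.mul_le_mul_right 8 h5
  have h8 := Nat.mul_le_mul_right 3 h6
  omega

end LiftSize

namespace CylParams
variable {k : ℕ} [NeZero k] (p : CylParams k) {M : ℕ}

theorem per_le (hq : ∀ i, p.q i ≤ M) (r : ZMod k) : p.per r ≤ 4 * k * M ^ (p.c + 1) := by
  refine Nat.mul_le_mul_left _ ?_
  simpa using Finset.prod_le_pow_card (Finset.range (p.c + 1)) (fun j : ℕ => p.q (r + j)) M
    (fun j _ => hq _)

theorem card_sigma_zmod_le (f : ZMod k → ℕ) [∀ r, NeZero (f r)] {N : ℕ} (hf : ∀ r, f r ≤ N) :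
    Fintype.card (Σ r, ZMod (f r)) ≤ k * N := by
  rw [Fintype.card_sigma]
  refine (Finset.sum_le_card_nsmul _ _ N fun r _ => ?_).trans ?_
  · rw [ZMod.card]; exact hf r
  · simp [ZMod.card]

theorem card_edge_le (hM : 1 ≤ M) (hq : ∀ i, p.q i ≤ M) :
    Fintype.card p.Edge ≤ 16 * k ^ 2 * M ^ (p.c + 1) := by
  have h1 := Fintype.card_le_of_injective _ p.edgeToSum_injective
  have h2 := card_sigma_zmod_le p.per (p.per_le hq)
  have h3 := card_sigma_zmod_le p.vper
    (fun r => (Nat.le_of_dvd (NeZero.pos _) (p.vper_dvd_per r)).trans (p.per_le hq r))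
  simp only [Fintype.card_sum, Fintype.card_prod, Fintype.card_bool, ZMod.card,
    Fintype.card_fin] at h1
  have hX : 1 ≤ M ^ (p.c + 1) := Nat.one_le_pow _ _ hM
  generalize M ^ (p.c + 1) = X at *
  nlinarith [Nat.zero_le (k ^ 2)]

theorem card_vertex_le (hM : 1 ≤ M) (hq : ∀ i, p.q i ≤ M) :
    Fintype.card p.Vertex ≤ 8 * k ^ 2 * M ^ (p.c + 1) := by
  have h1 := Fintype.card_le_of_injective _ p.vertexToSum_injective
  have h2 := card_sigma_zmod_le p.per (p.per_le hq)
  simp only [Fintype.card_sum, Fintype.card_prod, Fintype.card_bool, ZMod.card,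
    Fintype.card_fin] at h1
  have hX : 1 ≤ M ^ (p.c + 1) := Nat.one_le_pow _ _ hM
  generalize M ^ (p.c + 1) = X at *
  nlinarith [Nat.zero_le (k ^ 2)]

theorem total_le (hq : ∀ i, p.q i ≤ M) : p.total ≤ M ^ k := by
  simpa [total, ZMod.card] using
    Finset.prod_le_pow_card Finset.univ p.q M (fun j _ => hq _)

theorem le_total (hq : ∀ i, M ≤ p.q i) : M ^ k ≤ p.total := by
  simpa [total, ZMod.card] using
    Finset.pow_card_le_prod Finset.univ p.q M (fun j _ => hq _)

variable {m : ℕ} {enc : p.Edge × GadgetVar m ↪ ℕ}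

theorem vars_le (hm : 1 ≤ m) (hM : 1 ≤ M) (hq : ∀ i, p.q i ≤ M) :
    (liftCNF p.system enc).vars.card ≤ 64 * (m * k ^ 2 * M ^ (p.c + 1)) := by
  refine (card_vars_liftCNF_le.trans (Nat.mul_le_mul (p.card_edge_le hM hq)
    (show 3 * m + 1 ≤ 4 * m by omega))).trans (le_of_eq (by ring))

theorem size_le (hm : 1 ≤ m) (hM : 1 ≤ M) (hq : ∀ i, p.q i ≤ M) :
    (liftCNF p.system enc).size ≤ 1200 * (m ^ 4 * k ^ 2 * M ^ (p.c + 1)) := by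
  refine (size_liftCNF_le hm p.inc_card_le).trans ?_
  have h1 : m + 2 ≤ 3 * m ^ 4 := by
    have : m ≤ m ^ 4 := Nat.le_self_pow (by norm_num) m
    omega
  calc _ ≤ 8 * k ^ 2 * M ^ (p.c + 1) * (2 * m) ^ 4 * 8 +
        16 * k ^ 2 * M ^ (p.c + 1) * (3 * m ^ 4) * 3 := by
        gcongr
        · exact p.card_vertex_le hM hq
        · exact p.card_edge_le hM hq
    _ = 1168 * (m ^ 4 * k ^ 2 * M ^ (p.c + 1)) := by ring
    _ ≤ _ := Nat.mul_le_mul_right _ (by norm_num)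

theorem exists_refutation_le (hm : 1 ≤ m) (hq : ∀ i, p.q i ≤ M) :
    ∃ π : Refutation (liftCNF p.system enc),
      π.size ≤ 1440 * (m ^ (k + 4) * k ^ 2 * (2 * M) ^ k) := by
  obtain ⟨π, hπ⟩ := p.exists_refutation (enc := enc) hm
  refine ⟨π, hπ.trans ?_⟩
  have h1 := p.total_le hq
  have h2 : 1 ≤ p.total := Finset.prod_pos fun i _ => p.q_pos i
  have hk := p.four_le
  calc (4 * k + 2 * k * p.total) * columnCost k m
      ≤ (6 * k * p.total) * columnCost k m := Nat.mul_le_mul_right _ (by nlinarith)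
    _ ≤ (6 * k * M ^ k) * columnCost k m := by gcongr
    _ = _ := by rw [columnCost, mul_pow, mul_pow]; ring
 
end CylParams
end Resolution

namespace Resolution

/-! ### Primes between `n` and `2 * n` -/

/-- The multinomial coefficient `(6 n)! / (n! (2 n)! (3 n)!)` is divisible by every prime between
`n` and `6 * n`, since `⌊6 x⌋ > ⌊x⌋ + ⌊2 x⌋ + ⌊3 x⌋` for `1 / 6 ≤ x < 1`. -/
theorem dvd_choose_mul_choose_of_prime {n p : ℕ} (hp : p.Prime) (h1 : n < p) (h2 : p ≤ 6 * n) :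
    p ∣ (6 * n).choose (3 * n) * (3 * n).choose n := by
  set M := (6 * n).choose (3 * n) * (3 * n).choose n with hM
  have hM0 : M ≠ 0 := Nat.mul_ne_zero (Nat.choose_ne_zero (by omega)) (Nat.choose_ne_zero (by omega))
  have hfac : M * (n.factorial * (2 * n).factorial * (3 * n).factorial) = (6 * n).factorial := by
    have e1 := Nat.choose_mul_factorial_mul_factorial (show 3 * n ≤ 6 * n by omega)
    have e2 := Nat.choose_mul_factorial_mul_factorial (show n ≤ 3 * n by omega)
    rw [show 6 * n - 3 * n = 3 * n by omega] at e1
    rw [show 3 * n - n = 2 * n by omega] at e2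
    rw [← e1]
    nth_rewrite 3 [← e2]
    rw [hM]; ring
  clear_value M
  let b := Nat.log p (6 * n) + 1
  have hb : ∀ j ≤ 6 * n, Nat.log p j < b := fun j hj => Nat.lt_succ_of_le (Nat.log_mono_right hj)
  have hv := congrArg (fun t => t.factorization p) hfac
  rw [Nat.factorization_mul hM0 (by positivity), Nat.factorization_mul (by positivity)
    (by positivity), Nat.factorization_mul (by positivity) (by positivity)] at hv
  simp only [Finsupp.add_apply] at hv
  rw [Nat.factorization_factorial hp (hb n (by omega)),
    Nat.factorization_factorial hp (hb (2 * n) (by omega)),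
    Nat.factorization_factorial hp (hb (3 * n) (by omega)),
    Nat.factorization_factorial hp (hb (6 * n) le_rfl), ← Finset.sum_add_distrib,
    ← Finset.sum_add_distrib] at hv
  have hlog : 1 < b := Nat.succ_lt_succ (Nat.log_pos hp.one_lt h2)
  have hlt : ∑ i ∈ Finset.Ico 1 b, (n / p ^ i + 2 * n / p ^ i + 3 * n / p ^ i) <
      ∑ i ∈ Finset.Ico 1 b, 6 * n / p ^ i := by
    refine Finset.sum_lt_sum (fun i _ => ?_) ⟨1, by simp [hlog], ?_⟩
    · rw [Nat.le_div_iff_mul_le (by have := hp.pos; positivity)]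
      have e1 := Nat.div_mul_le_self n (p ^ i)
      have e2 := Nat.div_mul_le_self (2 * n) (p ^ i)
      have e3 := Nat.div_mul_le_self (3 * n) (p ^ i)
      rw [add_mul, add_mul]; omega
    · rw [pow_one, Nat.div_eq_of_lt h1, zero_add, ← Nat.succ_le_iff,
        Nat.le_div_iff_mul_le hp.pos]
      have a1 : 2 * n / p < 2 := by rw [Nat.div_lt_iff_lt_mul hp.pos]; omega
      have a2 : 3 * n / p < 3 := by rw [Nat.div_lt_iff_lt_mul hp.pos]; omega
      have b1 := Nat.div_mul_le_self (2 * n) p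
      have b2 := Nat.div_mul_le_self (3 * n) p
      have b3 := Nat.lt_div_mul_add hp.pos (a := 2 * n)
      have b4 := Nat.lt_div_mul_add hp.pos (a := 3 * n)
      generalize 2 * n / p = x at *
      generalize 3 * n / p = y at *
      interval_cases x <;> interval_cases y <;> omega
  refine Nat.dvd_of_factorization_pos ?_
  omega

theorem primorial_six_mul_le (n : ℕ) : primorial (6 * n) ≤ primorial n * 512 ^ n := by
  have h1 : primorial (6 * n) =
      primorial n * ∏ p ∈ Finset.Ico (n + 1) (6 * n + 1) with p.Prime, p := by
    have := primorial_add n (5 * n)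
    rwa [show n + 5 * n = 6 * n by ring] at this
  have h2 : (∏ p ∈ Finset.Ico (n + 1) (6 * n + 1) with p.Prime, p) ∣
      (6 * n).choose (3 * n) * (3 * n).choose n := by
    refine Finset.prod_primes_dvd _ (fun p hp => (Finset.mem_filter.1 hp).2.prime) fun p hp => ?_
    rw [Finset.mem_filter, Finset.mem_Ico] at hp
    exact dvd_choose_mul_choose_of_prime hp.2 (by omega) (by omega)
  rw [h1]
  refine Nat.mul_le_mul_left _ ((Nat.le_of_dvd (Nat.mul_pos (Nat.choose_pos (by omega))
    (Nat.choose_pos (by omega))) h2).trans ?_)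
  calc _ ≤ 2 ^ (6 * n) * 2 ^ (3 * n) :=
        Nat.mul_le_mul (Nat.choose_le_two_pow _ _) (Nat.choose_le_two_pow _ _)
    _ = 512 ^ n := by rw [← pow_add, show 6 * n + 3 * n = 9 * n by ring, pow_mul]; norm_num

/-- The rate `9 / 5 * log 2 < 1.25` that results from `primorial_six_mul_le` is rounded up, to make
room for the rounding of `N` to a multiple of `6`; below `500`, the rate `log 4` suffices. -/
theorem log_primorial_le (N : ℕ) : Real.log (primorial N) ≤ 1.3 * N + 50 := by
  induction N using Nat.strong_induction_on with
  | _ N ih =>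
    by_cases hN : N < 500
    · have h1 : Real.log (primorial N) ≤ Real.log ((4 : ℝ) ^ N) :=
        Real.log_le_log (by exact_mod_cast primorial_pos N) (by exact_mod_cast primorial_le_four_pow N)
      have h2 : Real.log (4 : ℝ) = 2 * Real.log 2 := by
        rw [show (4 : ℝ) = 2 ^ 2 by norm_num, Real.log_pow]; norm_num
      rw [Real.log_pow, h2] at h1
      have h3 := Real.log_two_lt_d9
      have h4 : (N : ℝ) ≤ 500 := by exact_mod_cast hN.le
      nlinarith [Nat.cast_nonneg (α := ℝ) N]
    · set n := N / 6 + 1 with hn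
      have h1 : Real.log (primorial N) ≤ Real.log ((primorial n : ℝ) * 512 ^ n) := by
        refine Real.log_le_log (by exact_mod_cast primorial_pos N) ?_
        exact_mod_cast (primorial_mono (by omega)).trans (primorial_six_mul_le n)
      have h2 : Real.log (512 : ℝ) = 9 * Real.log 2 := by
        rw [show (512 : ℝ) = 2 ^ 9 by norm_num, Real.log_pow]; norm_num
      rw [Real.log_mul (by exact_mod_cast primorial_ne_zero n) (by positivity), Real.log_pow,
        h2] at h1
      have h3 := Real.log_two_lt_d9
      have h4 := ih n (by omega)
      have h5 : (6 : ℝ) * n ≤ N + 6 := by exact_mod_cast (by omega : 6 * n ≤ N + 6)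
      have h6 : (500 : ℝ) ≤ N := by exact_mod_cast not_lt.1 hN
      nlinarith [Nat.cast_nonneg (α := ℝ) n]

/-- Every prime factor of the central binomial coefficient is at most `√(2 n)`, or at most
`2 * n / 3`, or larger than `n`, and only those of the first kind can occur with an exponent
above `1`. -/
theorem log_centralBinom_le {n : ℕ} (hn : 2 < n) :
    Real.log n.centralBinom ≤
      ((2 * n).sqrt + ((Finset.Ioc n (2 * n)).filter Nat.Prime).card) * Real.log (2 * n) +
        Real.log (primorial (2 * n / 3)) := by
  have hlog : 0 ≤ Real.log (2 * (n : ℝ)) := Real.log_nonneg (by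
    have : (2 : ℝ) < n := by exact_mod_cast hn
    linarith)
  have h0 : Real.log n.centralBinom = ∑ p ∈ Nat.primesLE (2 * n),
      (n.centralBinom.factorization p : ℝ) * Real.log p := by
    have h1 := Nat.prod_pow_factorization_centralBinom n
    rw [← Finset.prod_filter_of_ne (p := Nat.Prime)] at h1
    · rw [← h1, Nat.cast_prod, Real.log_prod]
      · refine Finset.sum_congr rfl fun p _ => ?_
        rw [h1, Nat.cast_pow, Real.log_pow]
      · intro p hp
        have := (Finset.mem_filter.1 hp).2.pos
        positivity
    · intro p _ h
      by_contra hp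
      exact h (by rw [Nat.factorization_eq_zero_of_not_prime _ hp, pow_zero])
  have hterm : ∀ p ∈ Nat.primesLE (2 * n), (n.centralBinom.factorization p : ℝ) * Real.log p ≤
      (if p ≤ (2 * n).sqrt then Real.log (2 * n) else 0) +
        (if n < p then Real.log (2 * n) else 0) + if p ≤ 2 * n / 3 then Real.log p else 0 := by
    intro p hp
    obtain ⟨hp2, hp⟩ := Nat.mem_primesLE.1 hp
    have hp0 : (0 : ℝ) < p := by exact_mod_cast hp.pos
    have hlp : 0 ≤ Real.log p := Real.log_nonneg (by exact_mod_cast hp.one_le)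
    have hlp2 : Real.log p ≤ Real.log (2 * n) := Real.log_le_log hp0 (by exact_mod_cast hp2)
    by_cases h1 : p ≤ (2 * n).sqrt
    · have h2 : (n.centralBinom.factorization p : ℝ) * Real.log p ≤ Real.log (2 * n) := by
        rw [← Real.log_pow]
        refine Real.log_le_log (by positivity) ?_
        exact_mod_cast Nat.pow_factorization_choose_le (by omega)
      rw [if_pos h1]
      have h3 : 0 ≤ if n < p then Real.log (2 * n) else (0 : ℝ) := by split_ifs <;> simp [hlog]
      have h4 : 0 ≤ if p ≤ 2 * n / 3 then Real.log p else (0 : ℝ) := by split_ifs <;> simp [hlp]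
      linarith
    · have h2 : (n.centralBinom.factorization p : ℝ) ≤ 1 := by
        exact_mod_cast Nat.factorization_choose_le_one (Nat.sqrt_lt'.1 (not_le.1 h1))
      have h3 : (n.centralBinom.factorization p : ℝ) * Real.log p ≤ Real.log p :=
        mul_le_of_le_one_left hlp h2
      rw [if_neg h1, zero_add]
      by_cases h4 : n < p
      · have h5 : ¬ p ≤ 2 * n / 3 := by omega
        rw [if_pos h4, if_neg h5]; linarith
      · by_cases h5 : p ≤ 2 * n / 3
        · rw [if_neg h4, if_pos h5]; linarith
        · rw [Nat.factorization_centralBinom_of_two_mul_self_lt_three_mul hn (by omega) (by omega),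
            if_neg h4, if_neg h5]
          simp
  rw [h0]
  refine (Finset.sum_le_sum hterm).trans ?_
  rw [Finset.sum_add_distrib, Finset.sum_add_distrib, add_mul]
  refine add_le_add (add_le_add ?_ (le_of_eq ?_)) (le_of_eq ?_)
  · rw [← Finset.sum_filter, Finset.sum_const, nsmul_eq_mul]
    refine mul_le_mul_of_nonneg_right ?_ hlog
    have : ((Nat.primesLE (2 * n)).filter (· ≤ (2 * n).sqrt)).card ≤
        (Finset.Icc 1 (2 * n).sqrt).card := by
      refine Finset.card_le_card fun p hp => ?_
      obtain ⟨hp, h1⟩ := Finset.mem_filter.1 hp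
      exact Finset.mem_Icc.2 ⟨(Nat.mem_primesLE.1 hp).2.one_le, h1⟩
    rw [Nat.card_Icc, Nat.add_sub_cancel] at this
    exact_mod_cast this
  · rw [← Finset.sum_filter, Finset.sum_const, nsmul_eq_mul]
    congr 3
    ext p
    simp only [Finset.mem_filter, Nat.mem_primesLE, Finset.mem_Ioc]
    tauto
  · rw [← Finset.sum_filter, primorial_eq_prod_primesLE, Nat.cast_prod, Real.log_prod]
    · refine Finset.sum_congr ?_ fun _ _ => rfl
      ext p
      simp only [Finset.mem_filter, Nat.mem_primesLE]
      constructor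
      · tauto
      · rintro ⟨h1, h2⟩
        exact ⟨⟨by omega, h2⟩, h1⟩
    · intro p hp
      have := (Nat.mem_primesLE.1 hp).2.pos
      positivity

open Filter in
/-- The error terms are smaller than the difference between `2 * log 2 - 1.3 * 2 / 3 > 0.519`, the
rate obtained for the number of primes between `n` and `2 * n` times `log n`, and the rate `1 / 2`
that is needed. -/
theorem eventually_error_le : ∀ᶠ x : ℝ in atTop,
    (1 + √(2 * x)) * Real.log (2 * x) + 50 + x * Real.log 2 / (2 * Real.log x) ≤ 0.019 * x := by
  have h1 : ∀ᶠ y : ℝ in atTop, √y * Real.log y ≤ 0.002 * y := by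
    have := (Asymptotics.isBigO_refl (fun y : ℝ => √y) atTop).mul_isLittleO
      (isLittleO_log_rpow_atTop (r := 1 / 2) (by norm_num))
    filter_upwards [this.bound (c := 0.002) (by norm_num), eventually_ge_atTop 1] with y hy hy1
    rw [← Real.sqrt_eq_rpow, Real.mul_self_sqrt (by linarith), Real.norm_of_nonneg,
      Real.norm_of_nonneg (by linarith)] at hy
    · exact hy
    · exact mul_nonneg (Real.sqrt_nonneg _) (Real.log_nonneg hy1)
  have h2 : Tendsto (fun x : ℝ => 2 * x) atTop atTop :=
    tendsto_id.const_mul_atTop (by norm_num)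
  filter_upwards [h2.eventually h1, Real.tendsto_log_atTop.eventually_ge_atTop 70,
    eventually_ge_atTop 10000] with x hx hl hx1
  have h3 : 1 ≤ √(2 * x) := Real.one_le_sqrt.2 (by linarith)
  have h4 : 0 ≤ Real.log (2 * x) := Real.log_nonneg (by linarith)
  have h5 : x * Real.log 2 / (2 * Real.log x) ≤ 0.005 * x := by
    rw [div_le_iff₀ (by linarith)]
    have := Real.log_two_lt_d9
    nlinarith
  nlinarith

/-- For large `n` there are at least `n / (2 * log n) + 1` primes between `n` and `2 * n`. -/
theorem exists_le_card_primes : ∃ n₀ : ℕ, 3 ≤ n₀ ∧ ∀ n ≥ n₀, ∀ k : ℕ,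
    (k : ℝ) - 1 < n / (2 * Real.log n) →
      k ≤ ((Finset.Ioc n (2 * n)).filter Nat.Prime).card := by
  obtain ⟨x₀, hx₀⟩ := Filter.eventually_atTop.1 eventually_error_le
  refine ⟨max 3 ⌈x₀⌉₊, le_max_left _ _, fun n hn k hk => ?_⟩
  have hn3 : 3 ≤ n := (le_max_left _ _).trans hn
  have herr := hx₀ n (Nat.ceil_le.1 ((le_max_right _ _).trans hn))
  by_contra hlt
  set K := ((Finset.Ioc n (2 * n)).filter Nat.Prime).card with hK
  have hK1 : (K : ℝ) < n / (2 * Real.log n) := by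
    have : (K : ℝ) + 1 ≤ k := by exact_mod_cast not_le.1 hlt
    linarith
  have hn0 : (3 : ℝ) ≤ n := by exact_mod_cast hn3
  have hlog : 0 < Real.log n := Real.log_pos (by linarith)
  have hlog2 : Real.log (2 * n) = Real.log 2 + Real.log n :=
    Real.log_mul (by norm_num) (by linarith)
  have hlog3 : 0 < Real.log (2 * n) := by
    rw [hlog2]; have := Real.log_two_gt_d9; linarith
  have h1 := log_centralBinom_le (n := n) (by omega)
  have h2 := log_primorial_le (2 * n / 3)
  have h3 : ((2 * n / 3 : ℕ) : ℝ) ≤ 2 * n / 3 := by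
    have : ((2 * n / 3 : ℕ) : ℝ) ≤ ((2 * n : ℕ) : ℝ) / ((3 : ℕ) : ℝ) := Nat.cast_div_le
    push_cast at this
    exact this
  have h4 : ((2 * n).sqrt : ℝ) ≤ √(2 * n) := by
    have := Real.nat_sqrt_le_real_sqrt (a := 2 * n)
    push_cast at this
    exact this
  have h5 : 2 * n * Real.log 2 - Real.log (2 * n) ≤ Real.log n.centralBinom := by
    have h6 : Real.log ((4 : ℝ) ^ n) ≤ Real.log ((2 * n) * n.centralBinom) :=
      Real.log_le_log (by positivity)
        (by exact_mod_cast Nat.four_pow_le_two_mul_self_mul_centralBinom n (by omega))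
    rw [Real.log_mul (by positivity) (by exact_mod_cast n.centralBinom_ne_zero), Real.log_pow,
      show (4 : ℝ) = 2 ^ 2 by norm_num, Real.log_pow] at h6
    push_cast at h6
    linarith
  have h6 : (K : ℝ) * Real.log (2 * n) ≤ n / 2 + n * Real.log 2 / (2 * Real.log n) := by
    refine (mul_le_mul_of_nonneg_right hK1.le hlog3.le).trans (le_of_eq ?_)
    rw [hlog2]; field_simp; ring
  have h7 := mul_le_mul_of_nonneg_right h4 hlog3.le
  have h8 := Real.log_two_gt_d9
  nlinarith

end Resolution

namespace Resolution

/-! ### Choice of the parameters -/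

theorem CylParams.exists_of_card_primes {n k c : ℕ} [NeZero k] (hk : 4 ≤ k)
    (hc : c + 1 ≤ k) (h : k ≤ ((Finset.Ioc n (2 * n)).filter Nat.Prime).card) :
    ∃ p : CylParams k, p.c = c ∧ ∀ i, n ≤ p.q i ∧ p.q i ≤ 2 * n := by
  obtain ⟨f⟩ := Function.Embedding.nonempty_of_card_le
    (α := ZMod k) (β := (Finset.Ioc n (2 * n)).filter Nat.Prime)
    (by rw [ZMod.card, Fintype.card_coe]; exact h)
  have hf : ∀ i, (n < (f i : ℕ) ∧ (f i : ℕ) ≤ 2 * n) ∧ (f i : ℕ).Prime := fun i => by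
    have := Finset.mem_filter.1 (f i).2
    rwa [Finset.mem_Ioc] at this
  refine ⟨⟨c, fun i => f i, hk, hc, fun i => (hf i).2.two_le, fun i j hij => ?_⟩, rfl,
    fun i => ⟨(hf i).1.1.le, (hf i).1.2⟩⟩
  exact (Nat.coprime_primes (hf i).2 (hf j).2).2 fun he => hij (f.injective (Subtype.ext he))

/-- The defender survives for a quarter of `∏ i, q i` steps, and this product is at least `n ^ k`.
-/
theorem exists_cnf_of_card_primes {n m k c : ℕ} (hn : 3 ≤ n) (hm : 1 ≤ m) (hk : 4 ≤ k)
    (hc : c + 1 ≤ k) (h : k ≤ ((Finset.Ioc n (2 * n)).filter Nat.Prime).card) :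
    ∃ F : CNF, F.IsKCNF 8 ∧
      F.vars.card ≤ 64 * (m * k ^ 2 * (2 * n) ^ (c + 1)) ∧
      F.size ≤ 1200 * (m ^ 4 * k ^ 2 * (2 * n) ^ (c + 1)) ∧
      (∃ π : Refutation F, π.size ≤ 1440 * (m ^ (k + 4) * k ^ 2 * (4 * n) ^ k)) ∧
      ∀ π : Refutation F, (π.size : ℝ) ≤ (((m : ℝ) + 1) / 2) ^ (k + c) →
        n ^ k ≤ 8 * π.depth := by
  have : NeZero k := ⟨by omega⟩
  obtain ⟨p, rfl, hp⟩ := CylParams.exists_of_card_primes hk hc h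
  let enc : p.Edge × GadgetVar m ↪ ℕ :=
    (Fintype.equivFin (p.Edge × GadgetVar m)).toEmbedding.trans Fin.valEmbedding
  have hM : 1 ≤ 2 * n := by omega
  refine ⟨liftCNF p.system enc, liftCNF_isKCNF p.inc_card_le, p.vars_le hm hM fun i => (hp i).2,
    p.size_le hm hM fun i => (hp i).2, ?_, fun π hπ => ?_⟩
  · obtain ⟨π, hπ⟩ := p.exists_refutation_le (enc := enc) hm (fun i => (hp i).2)
    exact ⟨π, by rwa [← mul_assoc 2 2 n] at hπ⟩
  · have h1 := le_depth_of_strategy hm (by omega) p.defend_isStrategy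
      (p.defend_start (t := p.total / 4) (by omega) fun _ => false) π hπ
    have h2 := p.le_total fun i => (hp i).1
    have h3 : 4 ≤ n ^ k := by
      calc 4 ≤ n ^ 2 := by nlinarith
        _ ≤ n ^ k := Nat.pow_le_pow_right (by omega) (by omega)
    omega

/-! ### The contradiction `x ∧ ¬x` -/

/-- The unit clause consisting of the literal `(0, b)`. -/
def unitClause (b : Bool) : Clause :=
  ⟨{(0, b)}, by intro x hx y hy _; rw [Finset.mem_singleton] at hx hy; rw [hx, hy]⟩

/-- The CNF formula `x ∧ ¬x`. -/
def contradiction : CNF := {unitClause true, unitClause false}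

theorem mem_contradiction {C : Clause} (h : C ∈ contradiction) : ∃ b, C = unitClause b := by
  rw [contradiction, Finset.mem_insert, Finset.mem_singleton] at h
  exact h.elim (fun h => ⟨_, h⟩) fun h => ⟨_, h⟩

theorem contradiction_isKCNF : contradiction.IsKCNF 8 := by
  intro C hC
  obtain ⟨b, rfl⟩ := mem_contradiction hC
  simp [Clause.width, unitClause]

theorem card_vars_contradiction_le : contradiction.vars.card ≤ 1 := by
  refine Finset.card_le_one.2 fun a ha b hb => ?_
  have : ∀ a ∈ contradiction.vars, a = 0 := by
    intro a ha
    simp only [CNF.vars, Finset.mem_biUnion] at ha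
    obtain ⟨C, hC, ha⟩ := ha
    obtain ⟨b, rfl⟩ := mem_contradiction hC
    simpa [unitClause] using ha
  rw [this a ha, this b hb]

theorem size_contradiction_le : contradiction.size ≤ 2 := by
  have h1 : contradiction.card ≤ 2 := Finset.card_le_two
  refine (Finset.sum_le_card_nsmul _ _ 1 fun C hC => ?_).trans (by simpa using h1)
  obtain ⟨b, rfl⟩ := mem_contradiction hC
  simp [Clause.width, unitClause]

theorem exists_refutation_contradiction : ∃ π : Refutation contradiction, π.size ≤ 3 := by
  have h1 : Deriv contradiction [unitClause true, unitClause false] :=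
    (Deriv.nil.ax (by simp [contradiction])).ax (by simp [contradiction])
  have h2 : Deriv contradiction [⟨∅, by simp⟩, unitClause true, unitClause false] :=
    h1.res (A := unitClause true) (B := unitClause false) (by simp) (by simp)
      ⟨0, by simp [unitClause], by simp [unitClause], by simp [unitClause]⟩
  exact h2.exists_refutation ⟨_, List.mem_cons_self, le_rfl⟩

theorem one_le_depth_contradiction (π : Refutation contradiction) : 1 ≤ π.depth := by
  set i : Fin π.size := ⟨π.size - 1, Nat.sub_lt π.size_pos Nat.one_pos⟩ with hi
  rcases h : π.premises i with _ | ⟨j, l⟩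
  · obtain ⟨b, hb⟩ := mem_contradiction (π.mem_of_none _ h)
    have := π.last_eq_empty
    rw [← hi, hb] at this
    simp [unitClause] at this
  · let s : RelSeries π.edges :=
      { length := 1
        toFun := ![j, i]
        step := by
          intro a
          fin_cases a
          exact ⟨l, Or.inl h⟩ }
    exact π.depth_isGreatest.2 ⟨s, rfl⟩

end Resolution

theorem mainTheorem8 :
    ∃ C : ℝ, 0 < C ∧ ∃ ε : ℝ, 0 < ε ∧
      ∀ n m k c : ℕ, 2 ≤ n → 1 ≤ m → 3 ≤ c → c + 1 ≤ k →
        (k : ℝ) - 1 < (n : ℝ) / (2 * Real.log n) →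
        ∃ F : Resolution.CNF,
          F.IsKCNF 8 ∧
          (F.vars.card : ℝ) ≤ C * (m * k ^ 2 * (2 * n) ^ (c + 1)) ∧
          (F.size : ℝ) ≤ C * (m ^ 4 * k ^ 2 * (2 * n) ^ (c + 1)) ∧
          (∃ π : Resolution.Refutation F,
            (π.size : ℝ) ≤ C * (m ^ (k + 4) * k ^ 2 * (4 * n) ^ k)) ∧
          ∀ π : Resolution.Refutation F,
            (π.size : ℝ) ≤ (((m : ℝ) + 1) / 2) ^ (k + c) →
            ε * (n : ℝ) ^ k ≤ (π.depth : ℝ) := by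
  obtain ⟨n₀, hn₀, hprimes⟩ := Resolution.exists_le_card_primes
  have hpos : (0 : ℝ) < (n₀ : ℝ) ^ n₀ := by
    have : (0 : ℝ) < n₀ := by exact_mod_cast (by omega : 0 < n₀)
    positivity
  have hone : (1 : ℝ) ≤ (n₀ : ℝ) ^ n₀ := by
    exact_mod_cast Nat.one_le_pow _ _ (by omega)
  refine ⟨1440, by norm_num, 1 / (8 * (n₀ : ℝ) ^ n₀), by positivity, ?_⟩
  intro n m k c hn hm hc hck hk
  rcases le_or_gt n₀ n with hlarge | hsmall
  · obtain ⟨F, h8, hvars, hsize, ⟨π, hπ⟩, hdepth⟩ := Resolution.exists_cnf_of_card_primes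
      (hn₀.trans hlarge) hm (by omega) hck (hprimes n hlarge k hk)
    refine ⟨F, h8, ?_, ?_, ⟨π, by exact_mod_cast hπ⟩, fun π' hπ' => ?_⟩
    · exact_mod_cast hvars.trans (Nat.mul_le_mul_right _ (by norm_num))
    · exact_mod_cast hsize.trans (Nat.mul_le_mul_right _ (by norm_num))
    · have h1 : (n : ℝ) ^ k ≤ 8 * π'.depth := by exact_mod_cast hdepth π' hπ'
      rw [div_mul_eq_mul_div, one_mul, div_le_iff₀ (by positivity)]
      refine h1.trans ?_
      nlinarith [Nat.cast_nonneg (α := ℝ) π'.depth]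
  -- For bounded `n` the depth bound is a constant, and any contradiction will do.
  · have hk0 : 1 ≤ k := by omega
    have hkn : k ≤ n₀ := by
      have h2 : (2 : ℝ) ≤ n := by exact_mod_cast hn
      have h3 : Real.log 2 ≤ Real.log n := Real.log_le_log (by norm_num) h2
      have h4 := Real.log_two_gt_d9
      have h5 : (k : ℝ) - 1 < n := hk.trans_le (div_le_self (by linarith) (by linarith))
      have h6 : (k : ℝ) < n₀ := by
        have : (n : ℝ) + 1 ≤ n₀ := by exact_mod_cast hsmall
        linarith
      exact_mod_cast h6.le
    obtain ⟨π, hπ⟩ := Resolution.exists_refutation_contradiction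
    refine ⟨Resolution.contradiction, Resolution.contradiction_isKCNF, ?_, ?_, ⟨π, ?_⟩,
      fun π' _ => ?_⟩
    · have h1 : 1 ≤ m * k ^ 2 * (2 * n) ^ (c + 1) := Nat.one_le_iff_ne_zero.2 (by positivity)
      have h2 := Resolution.card_vars_contradiction_le
      exact_mod_cast (by omega : _ ≤ 1440 * (m * k ^ 2 * (2 * n) ^ (c + 1)))
    · have h1 : 1 ≤ m ^ 4 * k ^ 2 * (2 * n) ^ (c + 1) := Nat.one_le_iff_ne_zero.2 (by positivity)
      have h2 := Resolution.size_contradiction_le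
      exact_mod_cast (by omega : _ ≤ 1440 * (m ^ 4 * k ^ 2 * (2 * n) ^ (c + 1)))
    · have h1 : 1 ≤ m ^ (k + 4) * k ^ 2 * (4 * n) ^ k := Nat.one_le_iff_ne_zero.2 (by positivity)
      exact_mod_cast (by omega : π.size ≤ 1440 * (m ^ (k + 4) * k ^ 2 * (4 * n) ^ k))
    · have h1 : (1 : ℝ) ≤ π'.depth := by
        exact_mod_cast Resolution.one_le_depth_contradiction π'
      have h2 : (n : ℝ) ^ k ≤ (n₀ : ℝ) ^ n₀ := by
        exact_mod_cast (Nat.pow_le_pow_left hsmall.le k).trans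
          (Nat.pow_le_pow_right (by omega) hkn)
      rw [div_mul_eq_mul_div, one_mul, div_le_iff₀ (by positivity)]
      nlinarith
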